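/- Let $M$ be an infinite field of characteristic $\neq 2$ with algebraic closure $\overline M$. For $\mathbf a=(a,b)\in M^2$ put $$f_{\mathbf a}(X)=X^4+aX^2+bX+b,\qquad D_{\mathbf a}=b\,(16a^4-128a^2b-4a^3b+256b^2+144ab^2-27b^3)$$ ($D_{\mathbf a}$ is the discriminant of $f_{\mathbf a}$), let $L_{\mathbf a}\subset\overline M$ be the splitting field of $f_{\mathbf a}$ over $M$ and $G_{\mathbf a}=\mathrm{Gal}(L_{\mathbf a}/M)$. For $\mathbf a,\mathbf a'\in M^2$ let $G_{\mathbf a,\mathbf a'}$ be the Galois group of the splitting field $L_{\mathbf a}L_{\mathbf a'}$ of $f_{\mathbf a}f_{\mathbf a'}$ over $M$. For monic separable quartics $f,g\in M[X]$ with roots $\alpha_1,\dots,\alpha_4$ and $\beta_1,\dots,\beta_4$ in $\overline M$, put $$\mathcal R_{f,g}(X)=\prod_{\pi\in\mathcal S_4}\Bigl(X-\sum_{i=1}^4\alpha_i\beta_{\pi(i)}\Bigr)\in M[X].$$ A Tschirnhausen transformation of $f$ over $M$ is a separable polynomial $\prod_{i=1}^4(X-c(\alpha_i))$ with $c\in M[X]$,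 $\deg c\le 3$. For $D_{\mathbf a}D_{\mathbf a'}\neq0$ write $\mathcal R_{\mathbf a,\mathbf a'}=\mathcal R_{f_{\mathbf a},f_{\mathbf a'}}$. Its decomposition type $\mathrm{DT}(\mathcal R_{\mathbf a,\mathbf a'})$ is the partition of $24$ formed by the degrees of the irreducible factors over $M$ of $\mathcal R_{\hat f,\hat g}$, where $\hat f,\hat g$ are Tschirnhausen transformations over $M$ of $f_{\mathbf a},f_{\mathbf a'}$ such that $\mathcal R_{\hat f,\hat g}$ has no repeated factors (if $\mathcal R_{\mathbf a,\mathbf a'}$ has no repeated factors one may take $\hat f=f_{\mathbf a}$, $\hat g=f_{\mathbf a'}$). $\mathcal S_n,\mathcal A_n,\mathcal C_n$ are the symmetric, alternating and cyclic groups, $\mathcal D_n$ is the dihedral group of order $2n$, and $\mathcal V_4=\mathcal C_2\times\mathcal C_2$. In the semidirect products below the generator of the right-hand factor acts on every factor $\mathcal C_3$ by inversion, on $\mathcal A_4$ by conjugation by a transposition of $\mathcal S_4$, and on $\mathcal V_4=\mathcal C_2\times\mathcal C_2$ by exchanging the two factors. **Theorem.** Let $\mathbf a,\mathbf a'\in M^2$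 with $D_{\mathbf a}D_{\mathbf a'}\neq0$ and $\#G_{\mathbf a'}\ge3$. Then $\mathrm{DT}(\mathcal R_{\mathbf a,\mathbf a'})$ is well defined: suitable $\hat f,\hat g$ exist and all of them give the same partition. Moreover: (i) If $G_{\mathbf a}\cong\mathcal S_3$, then exactly one row of the following table describes $G_{\mathbf a'}$ and $G_{\mathbf a,\mathbf a'}$ (up to isomorphism), the relation between $L_{\mathbf a}$ and $L_{\mathbf a'}$, and $\mathrm{DT}(\mathcal R_{\mathbf a,\mathbf a'})$: $$\begin{array}{lllll} & G_{\mathbf a'} & G_{\mathbf a,\mathbf a'} & & \mathrm{DT}(\mathcal R_{\mathbf a,\mathbf a'})\\ \hline 1 & \mathcal S_4 & \mathcal S_3\times\mathcal S_4 & L_{\mathbf a}\cap L_{\mathbf a'}=M & 24\\ 2 & \mathcal S_4 & (\mathcal C_3\times\mathcal A_4)\rtimes\mathcal C_2 & [L_{\mathbf a}\cap L_{\mathbf a'}:M]=2 & 12,12\\ 3 & \mathcal S_4 & \mathcal S_4 & L_{\mathbf a}\subset L_{\mathbf a'} & 12,8,4\\ 4 & \mathcal A_4 & \mathcal S_3\times\mathcal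 A_4 & L_{\mathbf a}\cap L_{\mathbf a'}=M & 24\\ 5 & \mathcal D_4 & \mathcal S_3\times\mathcal D_4 & L_{\mathbf a}\cap L_{\mathbf a'}=M & 24\\ 6 & \mathcal D_4 & \mathcal D_{12} & [L_{\mathbf a}\cap L_{\mathbf a'}:M]=2 & 12,12\\ 7 & \mathcal D_4 & (\mathcal C_3\times\mathcal V_4)\rtimes\mathcal C_2 & [L_{\mathbf a}\cap L_{\mathbf a'}:M]=2 & 24\\ 8 & \mathcal D_4 & (\mathcal C_3\times\mathcal V_4)\rtimes\mathcal C_2 & [L_{\mathbf a}\cap L_{\mathbf a'}:M]=2 & 12,12\\ 9 & \mathcal C_4 & \mathcal S_3\times\mathcal C_4 & L_{\mathbf a}\cap L_{\mathbf a'}=M & 24\\ 10 & \mathcal C_4 & \mathcal C_3\rtimes\mathcal C_4 & [L_{\mathbf a}\cap L_{\mathbf a'}:M]=2 & 12,12\\ 11 & \mathcal V_4 & \mathcal S_3\times\mathcal V_4 & L_{\mathbf a}\cap L_{\mathbf a'}=M & 24\\ 12 & \mathcal V_4 & \mathcal S_3\times\mathcal V_4 & L_{\mathbf a}\cap L_{\mathbf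 a'}=M & 12,12\\ 13 & \mathcal V_4 & \mathcal D_6 & [L_{\mathbf a}\cap L_{\mathbf a'}:M]=2 & 12,12\\ 14 & \mathcal V_4 & \mathcal D_6 & [L_{\mathbf a}\cap L_{\mathbf a'}:M]=2 & 12,6,6\\ 15 & \mathcal V_4 & \mathcal D_6 & [L_{\mathbf a}\cap L_{\mathbf a'}:M]=2 & 6,6,6,6\\ 16 & \mathcal S_3 & \mathcal S_3\times\mathcal S_3 & L_{\mathbf a}\cap L_{\mathbf a'}=M & 18,6\\ 17 & \mathcal S_3 & (\mathcal C_3\times\mathcal C_3)\rtimes\mathcal C_2 & [L_{\mathbf a}\cap L_{\mathbf a'}:M]=2 & 9,9,3,3\\ 18 & \mathcal S_3 & \mathcal S_3 & L_{\mathbf a}=L_{\mathbf a'} & 6,6,3,3,3,2,1\\ 19 & \mathcal C_3 & \mathcal S_3\times\mathcal C_3 & L_{\mathbf a}\cap L_{\mathbf a'}=M & 18,6 \end{array}$$ (ii) If $G_{\mathbf a}\cong\mathcal C_3$, then the same holds with exactly one row of the following table: $$\begin{array}{lllll} & G_{\mathbf a'} & G_{\mathbf a,\mathbf a'} & & \mathrm{DT}(\mathcal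 R_{\mathbf a,\mathbf a'})\\ \hline 1 & \mathcal S_4 & \mathcal C_3\times\mathcal S_4 & L_{\mathbf a}\cap L_{\mathbf a'}=M & 24\\ 2 & \mathcal A_4 & \mathcal C_3\times\mathcal A_4 & L_{\mathbf a}\cap L_{\mathbf a'}=M & 12,12\\ 3 & \mathcal A_4 & \mathcal A_4 & L_{\mathbf a}\subset L_{\mathbf a'} & 12,4,4,4\\ 4 & \mathcal D_4 & \mathcal C_3\times\mathcal D_4 & L_{\mathbf a}\cap L_{\mathbf a'}=M & 24\\ 5 & \mathcal C_4 & \mathcal C_{12} & L_{\mathbf a}\cap L_{\mathbf a'}=M & 12,12\\ 6 & \mathcal V_4 & \mathcal C_3\times\mathcal V_4 & L_{\mathbf a}\cap L_{\mathbf a'}=M & 12,12\\ 7 & \mathcal S_3 & \mathcal C_3\times\mathcal S_3 & L_{\mathbf a}\cap L_{\mathbf a'}=M & 18,6\\ 8 & \mathcal C_3 & \mathcal C_3\times\mathcal C_3 & L_{\mathbf a}\cap L_{\mathbf a'}=M & 9,9,3,3\\ 9 & \mathcal C_3 & \mathcal C_3 & L_{\mathbf a}=L_{\mathbf a'} & 3,3,3,3,3,3,3,1,1,1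 \end{array}$$ -/

import Mathlib

open Polynomial

namespace QuarticIntersection

noncomputable section

/-! ### The groups occurring in the tables -/

/-- The symmetric group of degree `n`. -/
abbrev Sn (n : ℕ) : Type := Equiv.Perm (Fin n)

/-- The cyclic group of order `n`. -/
abbrev Cn (n : ℕ) : Type := Multiplicative (ZMod n)

/-- The dihedral group of degree `n`, of order `2 * n`. -/
abbrev Dn (n : ℕ) : Type := DihedralGroup n

/-- The alternating group of degree four. -/
abbrev A4 : Type := alternatingGroup (Fin 4)

/-- The Klein four group. -/
abbrev V4 : Type := Cn 2 × Cn 2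

/-- The action of the cyclic group of order `n` on `N` in which the generator acts by `θ`. -/
def cyclicAction (n : ℕ) {N : Type} [Group N] (θ : MulAut N) (h : θ ^ n = 1) :
    Cn n →* MulAut N :=
  AddMonoidHom.toMultiplicativeLeft
    (ZMod.lift n ⟨zmultiplesHom (Additive (MulAut N)) (Additive.ofMul θ), by
      rw [zmultiplesHom_apply, natCast_zsmul, ← ofMul_pow, h, ofMul_one]⟩)

theorem cyclicAction_gen (n : ℕ) {N : Type} [Group N] (θ : MulAut N) (h : θ ^ n = 1) :
    cyclicAction n θ h (Multiplicative.ofAdd 1) = θ := by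
  have := ZMod.lift_coe n ⟨zmultiplesHom (Additive (MulAut N)) (Additive.ofMul θ), by
      rw [zmultiplesHom_apply, natCast_zsmul, ← ofMul_pow, h, ofMul_one]⟩ 1
  simp only [Int.cast_one, zmultiplesHom_apply, one_zsmul] at this
  exact congrArg Additive.toMul this

/-- Inversion on a commutative group. -/
def inversion (N : Type) [CommGroup N] : MulAut N := MulEquiv.inv N

theorem inversion_sq (N : Type) [CommGroup N] : inversion N ^ 2 = 1 := by
  ext x; simp [inversion, pow_two, MulAut.mul_apply]

theorem inversion_pow_four (N : Type) [CommGroup N] : inversion N ^ 4 = 1 := by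
  rw [show 4 = 2 * 2 from rfl, pow_mul, inversion_sq, one_pow]

/-- Inversion on `Cn 3`, together with conjugation by the transposition `(0 1)` on `A4`. -/
def thetaC3A4 : MulAut (Cn 3 × A4) :=
  (inversion (Cn 3)).prodCongr (MulAut.conjNormal (Equiv.swap (0 : Fin 4) 1))

theorem thetaC3A4_sq : thetaC3A4 ^ 2 = 1 := by
  have h2 : (MulAut.conjNormal (Equiv.swap (0 : Fin 4) 1) : MulAut A4) *
      MulAut.conjNormal (Equiv.swap (0 : Fin 4) 1) = 1 := by
    rw [← map_mul, Equiv.swap_mul_self, map_one]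
  apply MulEquiv.ext
  rintro ⟨x, y⟩
  refine Prod.ext ?_ ?_
  · exact inv_inv x
  · exact DFunLike.congr_fun h2 y

/-- Inversion on `Cn 3`, together with the exchange of the two factors of `V4`. -/
def thetaC3V4 : MulAut (Cn 3 × V4) :=
  (inversion (Cn 3)).prodCongr MulEquiv.prodComm

theorem thetaC3V4_sq : thetaC3V4 ^ 2 = 1 := by
  apply MulEquiv.ext
  rintro ⟨x, y⟩
  exact Prod.ext (inv_inv x) rfl

/-- `(C₃ × A₄) ⋊ C₂`, the group `[72,43]` of the small groups library. -/
abbrev C3A4sdC2 : Type := (Cn 3 × A4) ⋊[cyclicAction 2 thetaC3A4 thetaC3A4_sq] Cn 2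

/-- `(C₃ × V₄) ⋊ C₂`, the group `[24,8]` of the small groups library. -/
abbrev C3V4sdC2 : Type := (Cn 3 × V4) ⋊[cyclicAction 2 thetaC3V4 thetaC3V4_sq] Cn 2

/-- `C₃ ⋊ C₄` with the generator of `C₄` acting by inversion, the group `[12,1]`. -/
abbrev C3sdC4 : Type := Cn 3 ⋊[cyclicAction 4 (inversion (Cn 3)) (inversion_pow_four _)] Cn 4

/-- `(C₃ × C₃) ⋊ C₂` with the generator of `C₂` acting by inversion, the group `[18,4]`. -/
abbrev C3C3sdC2 : Type :=
  (Cn 3 × Cn 3) ⋊[cyclicAction 2 (inversion (Cn 3 × Cn 3)) (inversion_sq _)] Cn 2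

/-! ### Polynomials, splitting fields, resolvents -/

/-- The quartic `X⁴ + sX² + tX + t`. -/
def quartic {M : Type*} [Field M] (s t : M) : M[X] :=
  X ^ 4 + Polynomial.C s * X ^ 2 + Polynomial.C t * X + Polynomial.C t

/-- The discriminant of `quartic s t`. -/
def quarticDisc {M : Type*} [Field M] (s t : M) : M :=
  t * (16 * s ^ 4 - 128 * s ^ 2 * t - 4 * s ^ 3 * t + 256 * t ^ 2 + 144 * s * t ^ 2 - 27 * t ^ 3)

/-- The splitting field of `f` over `M` inside the algebraic closure of `M`. -/
def splittingIn {M : Type*} [Field M] (f : M[X]) : IntermediateField M (AlgebraicClosure M) :=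
  IntermediateField.adjoin M (f.rootSet (AlgebraicClosure M))

/-- `f'` is a (separable) Tschirnhausen transformation of `f` over `M`: its roots are
`c(α)`, where `α` runs through the roots of `f` (with multiplicity), for some `c ∈ M[X]` of degree
smaller than the degree of `f`. -/
def IsTschirnhausen {M : Type*} [Field M] (f f' : M[X]) : Prop :=
  f'.Separable ∧ ∃ c : M[X], c.degree < f.degree ∧
    f'.map (algebraMap M (AlgebraicClosure M)) =
      ((f.aroots (AlgebraicClosure M)).map
        fun α => (X - Polynomial.C (aeval α c) : (AlgebraicClosure M)[X])).prod

/-- `x` is an ordering of the roots of the monic quartic polynomial `f`. -/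
def IsRootOrdering {M : Type*} [Field M] (f : M[X]) (x : Fin 4 → AlgebraicClosure M) : Prop :=
  f.map (algebraMap M (AlgebraicClosure M)) = ∏ i, (X - Polynomial.C (x i))

/-- `R ∈ M[X]` is the `S₄ × S₄'`-relative `S₄''`-invariant resolvent of `f * g` by
`P = x₁y₁ + x₂y₂ + x₃y₃ + x₄y₄`, where `x` and `y` are the roots of the monic quartics `f` and `g`,
and `S₄''` is the diagonal of `S₄ × S₄'`. The product over the left cosets of `S₄''` is taken over
the representatives `(1, π)`, `π ∈ S₄`. The resolvent does not depend on the orderings of the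
roots. -/
def IsResolvent {M : Type*} [Field M] (f g R : M[X]) : Prop :=
  ∃ x y : Fin 4 → AlgebraicClosure M, IsRootOrdering f x ∧ IsRootOrdering g y ∧
    R.map (algebraMap M (AlgebraicClosure M)) =
      ∏ π : Equiv.Perm (Fin 4), (X - Polynomial.C (∑ i, x i * y (π i)))

open Classical in
/-- The degrees of the irreducible factors of `R` over `M`, with multiplicity. -/
def factorDegrees {M : Type*} [Field M] (R : M[X]) : Multiset ℕ :=
  (UniqueFactorizationMonoid.normalizedFactors R).map natDegree

/-- The resolvent of `f * g` has decomposition type `d` over `M`: there are Tschirnhausen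
transformations of `f` and of `g` over `M` whose resolvent has no repeated factors, and for every
such choice the degrees of the irreducible factors of that resolvent form the multiset `d`. (If the
resolvent of `f * g` itself has no repeated factors, then `f` and `g` may be taken themselves.) -/
def HasDT {M : Type*} [Field M] (f g : M[X]) (d : Multiset ℕ) : Prop :=
  (∃ f' g' R : M[X], IsTschirnhausen f f' ∧ IsTschirnhausen g g' ∧ IsResolvent f' g' R ∧
    Squarefree R) ∧
  ∀ f' g' R : M[X], IsTschirnhausen f f' → IsTschirnhausen g g' → IsResolvent f' g' R →
    Squarefree R → factorDegrees R = d

/-! ### The tables -/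

/-- A row of the tables: the Galois groups of `f`, of `g` and of `f * g` over `M` are isomorphic to
`A`, `B` and `E`, the condition `inter` on the splitting fields of `f` and of `g` holds, and the
resolvent of `f * g` has decomposition type `d`. -/
def Row {M : Type*} [Field M] (f g : M[X]) (A B E : Type) [Group A] [Group B] [Group E]
    (inter : IntermediateField M (AlgebraicClosure M) →
      IntermediateField M (AlgebraicClosure M) → Prop) (d : Multiset ℕ) : Prop :=
  Nonempty (f.Gal ≃* A) ∧ Nonempty (g.Gal ≃* B) ∧ Nonempty ((f * g).Gal ≃* E) ∧
    inter (splittingIn f) (splittingIn g) ∧ HasDT f g d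

/-- `L ∩ L' = M`. -/
def InterTrivial {M : Type*} [Field M] (L L' : IntermediateField M (AlgebraicClosure M)) : Prop :=
  L ⊓ L' = ⊥

/-- `[L ∩ L' : M] = 2`. -/
def InterQuadratic {M : Type*} [Field M] (L L' : IntermediateField M (AlgebraicClosure M)) :
    Prop :=
  Module.finrank M ↥(L ⊓ L') = 2

/-- The rows for which the Galois group of `f` is `S₃`. -/
def tableS3 {M : Type*} [Field M] (f g : M[X]) : Fin 19 → Prop := ![
  Row f g (Sn 3) (Sn 4) (Sn 3 × Sn 4) InterTrivial {24},
  Row f g (Sn 3) (Sn 4) C3A4sdC2 InterQuadratic {12, 12},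
  Row f g (Sn 3) (Sn 4) (Sn 4) (· ≤ ·) {12, 8, 4},
  Row f g (Sn 3) A4 (Sn 3 × A4) InterTrivial {24},
  Row f g (Sn 3) (Dn 4) (Sn 3 × Dn 4) InterTrivial {24},
  Row f g (Sn 3) (Dn 4) (Dn 12) InterQuadratic {12, 12},
  Row f g (Sn 3) (Dn 4) C3V4sdC2 InterQuadratic {24},
  Row f g (Sn 3) (Dn 4) C3V4sdC2 InterQuadratic {12, 12},
  Row f g (Sn 3) (Cn 4) (Sn 3 × Cn 4) InterTrivial {24},
  Row f g (Sn 3) (Cn 4) C3sdC4 InterQuadratic {12, 12},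
  Row f g (Sn 3) V4 (Sn 3 × V4) InterTrivial {24},
  Row f g (Sn 3) V4 (Sn 3 × V4) InterTrivial {12, 12},
  Row f g (Sn 3) V4 (Dn 6) InterQuadratic {12, 12},
  Row f g (Sn 3) V4 (Dn 6) InterQuadratic {12, 6, 6},
  Row f g (Sn 3) V4 (Dn 6) InterQuadratic {6, 6, 6, 6},
  Row f g (Sn 3) (Sn 3) (Sn 3 × Sn 3) InterTrivial {18, 6},
  Row f g (Sn 3) (Sn 3) C3C3sdC2 InterQuadratic {9, 9, 3, 3},
  Row f g (Sn 3) (Sn 3) (Sn 3) (· = ·) {6, 6, 3, 3, 3, 2, 1},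
  Row f g (Sn 3) (Cn 3) (Sn 3 × Cn 3) InterTrivial {18, 6}]

/-- The rows for which the Galois group of `f` is `C₃`. -/
def tableC3 {M : Type*} [Field M] (f g : M[X]) : Fin 9 → Prop := ![
  Row f g (Cn 3) (Sn 4) (Cn 3 × Sn 4) InterTrivial {24},
  Row f g (Cn 3) A4 (Cn 3 × A4) InterTrivial {12, 12},
  Row f g (Cn 3) A4 A4 (· ≤ ·) {12, 4, 4, 4},
  Row f g (Cn 3) (Dn 4) (Cn 3 × Dn 4) InterTrivial {24},
  Row f g (Cn 3) (Cn 4) (Cn 12) InterTrivial {12, 12},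
  Row f g (Cn 3) V4 (Cn 3 × V4) InterTrivial {12, 12},
  Row f g (Cn 3) (Sn 3) (Cn 3 × Sn 3) InterTrivial {18, 6},
  Row f g (Cn 3) (Cn 3) (Cn 3 × Cn 3) InterTrivial {9, 9, 3, 3},
  Row f g (Cn 3) (Cn 3) (Cn 3) (· = ·) {3, 3, 3, 3, 3, 3, 3, 1, 1, 1}]

end

end QuarticIntersection

namespace QuarticIntersection

/-! ### Galois groups as permutation groups of the roots -/

section Galois

variable {M : Type*} [Field M] {K : Type*} [Field K] [Algebra M K]

/-! Number the roots of `f` and of `g`. The Galois group of `f * g` becomes a subgroup `E` of `S₄ ×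
S₄` whose two projections are the Galois groups of `f` and `g`. The roots of the resolvent are
indexed by `π ∈ S₄`, and `(s, t) ∈ E` sends the root of `π` to the root of `t * π * s⁻¹`. When these
roots are distinct, the degrees of the irreducible factors are the orbit lengths of `E` on `S₄`.
Tschirnhausen transformations keep the numbering, hence the same `E`, so they all give the same
partition (`hasDT_of_orbitCard`). One with squarefree resolvent exists because over an infinite
field finitely many linear coincidences can be avoided (`exists_polynomial_injective_sum`). The
relation between the splitting fields follows from the group orders and `[L ∩ L' : M] [L L' : M] =
[L : M] [L' : M]`.

Renumbering the roots conjugates `E`, so the tables amount to a classification of subgroups of `S₄ ×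
S₄` up to conjugation. The first projection `G` may be taken to be the stabilizer of `0` or its
subgroup of order three, and the second projection `H` is one of eight standard groups
(`conjTo_cases`). By Goursat's argument, the kernel of the projection to `H` is a normal subgroup of
`G`. If it is `G`, then `E = G × H`. If it is `A₃` inside `S₃`, then `E` is a fibre product over the
group of order two, given by a subgroup of index two in `H` (`IsSubdirect.exists_fiberPred`). If it
is trivial, then `E` is the graph of a surjection from `H` onto `G`; this leaves `H = S₄` or `S₃`
for `G = S₃`, and `H = A₄` or `C₃` for `G = C₃`, and after conjugation the surjection is reduction
modulo the normal Klein group (`IsSubdirect.mem_conjSub_iff_graphPred`). Each representative is then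
a finite computation.

The row is unique because the order of the second group, the order of the joint group and the
decomposition type separate all rows, apart from a few pairs that differ by `C₄ ≇ V₄` or `D₁₂ ≇ (C₃
× V₄) ⋊ C₂`. -/

theorem exists_permHom {ι : Type*} [Finite ι] (x : ι → K) (hx : Function.Injective x)
    (h : ∀ (σ : K ≃ₐ[M] K) i, ∃ j, σ (x i) = x j) :
    ∃ ρ : (K ≃ₐ[M] K) →* Equiv.Perm ι, ∀ σ i, σ (x i) = x (ρ σ i) := by
  choose r hr using h
  let : MulAction (K ≃ₐ[M] K) ι :=
    { smul := r
      one_smul := fun i => hx (hr 1 i).symm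
      mul_smul := fun σ τ i => hx <| by
        change x (r (σ * τ) i) = x (r σ (r τ i))
        rw [← hr, ← hr, ← hr]; rfl }
  exact ⟨MulAction.toPermHom (K ≃ₐ[M] K) ι, fun σ i => hr σ i⟩

/-- Restriction to the splitting field is onto and has the same kernel as `ρ`, namely the
automorphisms fixing every root of `p`. The first isomorphism theorem, applied twice, gives the
result. -/
theorem gal_mulEquiv_range [IsAlgClosed K] [Normal M K] (p : M[X])
    {P : Type*} [Group P] (ρ : (K ≃ₐ[M] K) →* P)
    (hρ : ∀ σ, ρ σ = 1 ↔ ∀ z ∈ p.rootSet K, σ z = z) : Nonempty (p.Gal ≃* ρ.range) := by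
  have : Fact ((p.map (algebraMap M K)).Splits) := ⟨IsAlgClosed.splits _⟩
  have hs := Gal.restrict_surjective p K
  have hker : (Gal.restrict p K).ker = ρ.ker := by
    ext σ
    rw [MonoidHom.mem_ker, MonoidHom.mem_ker, hρ]
    constructor
    · intro h z hz
      have := Gal.restrict_smul (p := p) σ ⟨z, hz⟩
      rw [h, one_smul] at this
      exact this.symm
    · intro h
      apply Gal.galActionHom_injective p K
      ext z
      rw [map_one, Gal.galActionHom_restrict]
      exact h _ z.2
  exact ⟨(QuotientGroup.quotientKerEquivOfSurjective _ hs).symm.trans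
    ((QuotientGroup.quotientMulEquivOfEq hker).trans (QuotientGroup.quotientKerEquivRange ρ))⟩

/-- Seen as extensions of `A ⊓ B`, the two fields meet in their base field and one of them is
Galois. Hence they are linearly disjoint there, and the tower law brings the degrees back to `M`. -/
theorem finrank_inf_mul_finrank_sup (A B : IntermediateField M K) [IsGalois M A]
    [FiniteDimensional M A] [FiniteDimensional M B] :
    Module.finrank M ↥(A ⊓ B) * Module.finrank M ↥(A ⊔ B) =
      Module.finrank M A * Module.finrank M B := by
  have hA : A ⊓ B ≤ A := inf_le_left
  have hB : A ⊓ B ≤ B := inf_le_right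
  let A' := IntermediateField.extendScalars hA
  let B' := IntermediateField.extendScalars hB
  have h1 : A' ⊓ B' = ⊥ := by
    apply IntermediateField.restrictScalars_injective M
    ext z
    simp only [IntermediateField.mem_restrictScalars, IntermediateField.mem_inf,
      IntermediateField.mem_bot, A', B', IntermediateField.mem_extendScalars]
    constructor
    · intro h
      exact ⟨⟨z, h⟩, rfl⟩
    · rintro ⟨y, rfl⟩
      exact y.2
  let : Algebra ↥(A ⊓ B) A := (IntermediateField.inclusion hA).toRingHom.toAlgebra
  have : IsScalarTower M ↥(A ⊓ B) A := IsScalarTower.of_algebraMap_eq fun _ => rfl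
  have : IsGalois ↥(A ⊓ B) A' := by
    have : IsGalois ↥(A ⊓ B) A := IsGalois.tower_top_of_isGalois M _ A
    exact this
  have : FiniteDimensional ↥(A ⊓ B) A' := by
    have : FiniteDimensional ↥(A ⊓ B) A := Module.Finite.of_restrictScalars_finite M _ A
    exact this
  let : Algebra ↥(A ⊓ B) B := (IntermediateField.inclusion hB).toRingHom.toAlgebra
  have : IsScalarTower M ↥(A ⊓ B) B := IsScalarTower.of_algebraMap_eq fun _ => rfl
  have : FiniteDimensional ↥(A ⊓ B) B' := by
    have : FiniteDimensional ↥(A ⊓ B) B := Module.Finite.of_restrictScalars_finite M _ B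
    exact this
  have h2 := (IntermediateField.LinearDisjoint.of_inf_eq_bot h1).finrank_sup
  have hAB : A ⊓ B ≤ A ⊔ B := hA.trans le_sup_left
  have h3 : A' ⊔ B' = IntermediateField.extendScalars hAB :=
    IntermediateField.extendScalars_sup hA hB
  rw [h3, ← IntermediateField.relfinrank_eq_finrank_of_le,
    ← IntermediateField.relfinrank_eq_finrank_of_le,
    ← IntermediateField.relfinrank_eq_finrank_of_le] at h2
  rw [← IntermediateField.finrank_bot_mul_relfinrank hA,
    ← IntermediateField.finrank_bot_mul_relfinrank hB,
    ← IntermediateField.finrank_bot_mul_relfinrank hAB, h2]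
  ring

end Galois

/-! ### Root orderings -/

section RootOrdering

variable {M : Type*} [Field M] {f g : M[X]} {x y : Fin 4 → AlgebraicClosure M}

theorem exists_isRootOrdering (hf : f.Monic) (hd : f.natDegree = 4) :
    ∃ x, IsRootOrdering f x := by
  have hs : (f.map (algebraMap M (AlgebraicClosure M))).Splits := IsAlgClosed.splits _
  have hcard : (f.aroots (AlgebraicClosure M)).card = 4 := by
    rw [← hd, ← f.natDegree_map (algebraMap M (AlgebraicClosure M)),
      splits_iff_card_roots.mp hs]
  obtain ⟨l, hl⟩ := Quot.exists_rep (f.aroots (AlgebraicClosure M))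
  have hl' : (l : Multiset (AlgebraicClosure M)) = f.aroots (AlgebraicClosure M) := hl
  have hlen : l.length = 4 := by rw [← hcard, ← hl']; rfl
  refine ⟨fun i => l.get (i.cast hlen.symm), ?_⟩
  have h1 := hs.eq_prod_roots_of_monic (hf.map _)
  change _ = (Multiset.map _ (f.aroots (AlgebraicClosure M))).prod at h1
  rw [IsRootOrdering, h1, ← hl', Multiset.map_coe, Multiset.prod_coe,
    ← Fin.prod_univ_fun_getElem]
  exact (Fintype.prod_equiv (finCongr hlen.symm) _ _ fun i => rfl).symm

theorem IsRootOrdering.monic (hx : IsRootOrdering f x) : f.Monic := by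
  apply monic_of_injective (algebraMap M (AlgebraicClosure M)).injective
  rw [hx]
  exact monic_prod_of_monic _ _ fun i _ => monic_X_sub_C _

theorem IsRootOrdering.aroots (hx : IsRootOrdering f x) :
    f.aroots (AlgebraicClosure M) = Finset.univ.val.map x := by
  rw [Polynomial.aroots, hx, Finset.prod_eq_multiset_prod,
    ← roots_multiset_prod_X_sub_C (Finset.univ.val.map x), Multiset.map_map]
  rfl

theorem IsRootOrdering.aeval_eq_zero_iff (hx : IsRootOrdering f x) (z : AlgebraicClosure M) :
    aeval z f = 0 ↔ ∃ i, x i = z := by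
  rw [← eval_map_algebraMap, hx, eval_prod, Finset.prod_eq_zero_iff]
  simp [sub_eq_zero, eq_comm]

theorem IsRootOrdering.mem_rootSet_iff (hx : IsRootOrdering f x) (z : AlgebraicClosure M) :
    z ∈ f.rootSet (AlgebraicClosure M) ↔ ∃ i, x i = z := by
  rw [mem_rootSet, hx.aeval_eq_zero_iff]
  exact and_iff_right hx.monic.ne_zero

theorem IsRootOrdering.injective (hx : IsRootOrdering f x) (hf : f.Separable) :
    Function.Injective x := by
  have h : (∏ i, (X - C (x i))).Separable := hx ▸ hf.map
  exact h.injective_of_prod_X_sub_C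

theorem IsRootOrdering.exists_apply (hx : IsRootOrdering f x)
    (σ : AlgebraicClosure M ≃ₐ[M] AlgebraicClosure M) (i : Fin 4) : ∃ j, σ (x i) = x j := by
  have h : aeval (σ (x i)) f = 0 := by
    change aeval ((σ : AlgebraicClosure M →ₐ[M] AlgebraicClosure M) (x i)) f = 0
    rw [aeval_algHom_apply, (hx.aeval_eq_zero_iff (x i)).2 ⟨i, rfl⟩, map_zero]
  obtain ⟨j, hj⟩ := (hx.aeval_eq_zero_iff _).1 h
  exact ⟨j, hj.symm⟩

theorem IsRootOrdering.isSeparable (hx : IsRootOrdering f x) (hf : f.Separable) (i : Fin 4) :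
    IsSeparable M (x i) :=
  hf.of_dvd (minpoly.dvd _ _ ((hx.aeval_eq_zero_iff _).2 ⟨i, rfl⟩))

/-- Two orderings of the same simple roots differ by a permutation. -/
theorem IsRootOrdering.exists_perm {x' : Fin 4 → AlgebraicClosure M} (hx : IsRootOrdering f x)
    (hx' : IsRootOrdering f x') (hf : f.Separable) : ∃ c : Equiv.Perm (Fin 4), x' = x ∘ c := by
  have h : ∀ i, ∃ j, x j = x' i := fun i =>
    (hx.aeval_eq_zero_iff _).1 ((hx'.aeval_eq_zero_iff _).2 ⟨i, rfl⟩)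
  choose c hc using h
  have hinj : Function.Injective c := fun i j hij =>
    hx'.injective hf (by rw [← hc, ← hc, hij])
  exact ⟨Equiv.ofBijective c (Finite.injective_iff_bijective.1 hinj),
    funext fun i => (hc i).symm⟩

theorem finiteDimensional_splittingIn (f : M[X]) : FiniteDimensional M (splittingIn f) := by
  have : IsSplittingField M (splittingIn f) f :=
    IntermediateField.adjoin_rootSet_isSplittingField (IsAlgClosed.splits _)
  exact IsSplittingField.finiteDimensional _ f

theorem isGalois_splittingIn (f : M[X]) (hf : f.Separable) : IsGalois M (splittingIn f) := by
  have : IsSplittingField M (splittingIn f) f :=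
    IntermediateField.adjoin_rootSet_isSplittingField (IsAlgClosed.splits _)
  exact IsGalois.of_separable_splitting_field hf

theorem finrank_splittingIn (f : M[X]) [IsGalois M (splittingIn f)] :
    Module.finrank M (splittingIn f) = Nat.card f.Gal := by
  have : IsSplittingField M (splittingIn f) f :=
    IntermediateField.adjoin_rootSet_isSplittingField (IsAlgClosed.splits _)
  have := finiteDimensional_splittingIn f
  rw [← IsGalois.card_aut_eq_finrank]
  exact Nat.card_congr (IsSplittingField.algEquiv (splittingIn f) f).autCongr.toEquiv

theorem splittingIn_mul (hf : f ≠ 0) (hg : g ≠ 0) :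
    splittingIn (f * g) = splittingIn f ⊔ splittingIn g := by
  rw [splittingIn, splittingIn, splittingIn, ← IntermediateField.adjoin_union]
  congr 1
  ext z
  simp [mem_rootSet, hf, hg]

end RootOrdering

/-! ### Degrees of irreducible factors as orbit lengths -/

/-- Writing each part `k` of a partition `k` times turns the list of orbit lengths into the list
that gives every point the length of its orbit. The latter can be computed point by point, without
orbit representatives. -/
theorem count_bind_replicate_self (d : Multiset ℕ) (a : ℕ) :
    (d.bind fun k => Multiset.replicate k k).count a = a * d.count a := by
  induction d using Multiset.induction_on with
  | empty => simp
  | cons k d ih =>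
    rw [Multiset.cons_bind, Multiset.count_add, ih, Multiset.count_replicate,
      Multiset.count_cons]
    split_ifs with h1 h2 h2
    · subst h1; ring
    · exact absurd h1.symm h2
    · exact absurd h2.symm h1
    · ring

theorem eq_of_bind_replicate_self_eq {d d' : Multiset ℕ} (hd : 0 ∉ d) (hd' : 0 ∉ d')
    (h : (d.bind fun k => Multiset.replicate k k) = d'.bind fun k => Multiset.replicate k k) :
    d = d' := by
  ext a
  rcases Nat.eq_zero_or_pos a with rfl | ha
  · rw [Multiset.count_eq_zero_of_notMem hd, Multiset.count_eq_zero_of_notMem hd']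
  · have := congrArg (Multiset.count a) h
    rw [count_bind_replicate_self, count_bind_replicate_self] at this
    exact Nat.eq_of_mul_eq_mul_left ha this

/-- Applied with `m` the minimal polynomial of a root and `w` its degree: the fibres of `m` are then
the conjugacy classes of roots. -/
theorem map_eq_bind_image {ι T : Type*} [Fintype ι] [DecidableEq T] (m : ι → T) (w : T → ℕ)
    (h : ∀ i, (Finset.univ.filter fun j => m j = m i).card = w (m i)) :
    (Finset.univ.val.map fun i => w (m i)) =
      ((Finset.univ.image m).val.map w).bind fun k => Multiset.replicate k k := by
  ext a
  rw [count_bind_replicate_self, Multiset.count_map, Multiset.count_map,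
    ← Finset.filter_val, ← Finset.filter_val, Finset.card_val, Finset.card_val,
    Finset.card_eq_sum_card_fiberwise (f := m)
      (t := (Finset.univ.image m).filter fun p => a = w p), mul_comm]
  · rw [← smul_eq_mul, ← Finset.sum_const]
    refine Finset.sum_congr rfl fun p hp => ?_
    obtain ⟨hp, ha⟩ := Finset.mem_filter.1 hp
    obtain ⟨i, -, rfl⟩ := Finset.mem_image.1 hp
    rw [ha, ← h i, Finset.filter_filter]
    congr 1
    ext j
    simp only [Finset.mem_filter, Finset.mem_univ, true_and]
    constructor
    · exact fun hj => hj.2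
    · exact fun hj => ⟨by rw [hj, h i], hj⟩
  · intro i hi
    simpa using hi

section Factor

variable {M : Type*} [Field M] {K : Type*} [Field K] [Algebra M K]
  {ι : Type*} [Fintype ι] {R : M[X]} {z : ι → K}

theorem aeval_eq_zero_iff_of_map_eq_prod (hR : R.map (algebraMap M K) = ∏ i, (X - C (z i)))
    (w : K) : aeval w R = 0 ↔ ∃ i, z i = w := by
  rw [← eval_map_algebraMap, hR, eval_prod, Finset.prod_eq_zero_iff]
  simp [sub_eq_zero, eq_comm]

theorem monic_of_map_eq_prod (hR : R.map (algebraMap M K) = ∏ i, (X - C (z i))) : R.Monic := by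
  apply monic_of_injective (algebraMap M K).injective
  rw [hR]
  exact monic_prod_of_monic _ _ fun i _ => monic_X_sub_C _

/-- Since `M` may be imperfect, squarefreeness over `M` gives distinct roots only because the `z i`
are separable. The minimal polynomial of a multiple root has it as a simple root, so it also divides
the cofactor, and its square divides `R`. -/
theorem injective_of_squarefree (hR : R.map (algebraMap M K) = ∏ i, (X - C (z i)))
    (hsep : ∀ i, IsSeparable M (z i)) (hsq : Squarefree R) : Function.Injective z := by
  classical
  have hroots : (R.map (algebraMap M K)).roots = Finset.univ.val.map z := by
    rw [hR, Finset.prod_eq_multiset_prod,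
      ← roots_multiset_prod_X_sub_C (Finset.univ.val.map z), Multiset.map_map]
    rfl
  have hnd : (Finset.univ.val.map z).Nodup := by
    rw [← hroots, Multiset.nodup_iff_count_le_one]
    intro w
    by_contra! hlt
    have hmem : w ∈ Finset.univ.val.map z := by
      rw [← hroots, ← Multiset.count_pos]; omega
    obtain ⟨i, -, rfl⟩ := Multiset.mem_map.1 hmem
    obtain ⟨q, hq⟩ : minpoly M (z i) ∣ R :=
      minpoly.dvd _ _ ((aeval_eq_zero_iff_of_map_eq_prod hR _).2 ⟨i, rfl⟩)
    have hR0 : R.map (algebraMap M K) ≠ 0 := ((monic_of_map_eq_prod hR).map _).ne_zero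
    have hint : IsIntegral M (z i) := (hsep i).isIntegral
    rw [count_roots, hq, Polynomial.map_mul, rootMultiplicity_mul (by
      rwa [← Polynomial.map_mul, ← hq])] at hlt
    have h1 : rootMultiplicity (z i) ((minpoly M (z i)).map (algebraMap M K)) ≤ 1 :=
      rootMultiplicity_le_one_of_separable (Separable.map (hsep i)) _
    have h2 : 0 < rootMultiplicity (z i) (q.map (algebraMap M K)) := by omega
    have h3 : aeval (z i) q = 0 := by
      rw [← eval_map_algebraMap]
      refine (rootMultiplicity_pos ?_).1 h2
      intro h0
      rw [h0] at h2
      simp at h2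
    obtain ⟨r, hr⟩ := minpoly.dvd _ _ h3
    exact (minpoly.irreducible hint).not_isUnit
      (hsq _ ⟨r, by rw [mul_assoc, ← hr, ← hq]⟩)
  intro i j hij
  exact Multiset.inj_on_of_nodup_map hnd i (Finset.mem_univ_val i) j (Finset.mem_univ_val j) hij

open Classical in
theorem normalizedFactors_eq_image_minpoly [IsAlgClosed K] [Algebra.IsAlgebraic M K]
    (hR : R.map (algebraMap M K) = ∏ i, (X - C (z i))) (hsq : Squarefree R) :
    UniqueFactorizationMonoid.normalizedFactors R =
      (Finset.univ.image fun i => minpoly M (z i)).val := by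
  have hR0 : R ≠ 0 := (monic_of_map_eq_prod hR).ne_zero
  have hint : ∀ i, IsIntegral M (z i) := fun i => Algebra.IsIntegral.isIntegral _
  refine (Multiset.Nodup.ext
    ((UniqueFactorizationMonoid.squarefree_iff_nodup_normalizedFactors hR0).1 hsq)
    (Finset.nodup _)).2 fun p => ?_
  rw [UniqueFactorizationMonoid.mem_normalizedFactors_iff' hR0, Finset.mem_val,
    Finset.mem_image]
  constructor
  · rintro ⟨hp, hn, hdvd⟩
    have hpm : p.Monic := by
      rw [← hn]; exact monic_normalize hp.ne_zero
    obtain ⟨w, hw⟩ := IsAlgClosed.exists_aeval_eq_zero K p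
      (degree_pos_of_irreducible hp).ne'
    obtain ⟨q, rfl⟩ := hdvd
    obtain ⟨i, rfl⟩ := (aeval_eq_zero_iff_of_map_eq_prod hR w).1 (by simp [hw])
    exact ⟨i, Finset.mem_univ _, (minpoly.eq_of_irreducible_of_monic hp hw hpm).symm⟩
  · rintro ⟨i, -, rfl⟩
    exact ⟨minpoly.irreducible (hint i), (minpoly.monic (hint i)).normalize_eq_self,
      minpoly.dvd _ _ ((aeval_eq_zero_iff_of_map_eq_prod hR _).2 ⟨i, rfl⟩)⟩

open Classical in
theorem card_filter_minpoly_eq [IsAlgClosed K] [Normal M K]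
    (hR : R.map (algebraMap M K) = ∏ i, (X - C (z i)))
    (hz : Function.Injective z) (hsep : ∀ i, IsSeparable M (z i)) (i : ι) :
    (Finset.univ.filter fun j => minpoly M (z j) = minpoly M (z i)).card =
      (minpoly M (z i)).natDegree := by
  rw [← card_rootSet_eq_natDegree (K := K) (hsep i) (IsAlgClosed.splits _),
    ← Nat.card_eq_fintype_card, Nat.card_coe_set_eq, ← Set.ncard_coe_finset,
    ← Set.ncard_image_of_injective _ hz]
  congr 1
  ext w
  have hint : IsIntegral M (z i) := (hsep i).isIntegral
  rw [mem_rootSet]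
  constructor
  · rintro ⟨j, hj, rfl⟩
    refine ⟨minpoly.ne_zero hint, ?_⟩
    rw [Finset.mem_coe, Finset.mem_filter] at hj
    rw [← hj.2, minpoly.aeval]
  · rintro ⟨-, hw⟩
    obtain ⟨j, rfl⟩ := (aeval_eq_zero_iff_of_map_eq_prod hR w).1
      (aeval_eq_zero_of_dvd_aeval_eq_zero (minpoly.dvd _ _
        ((aeval_eq_zero_iff_of_map_eq_prod hR _).2 ⟨i, rfl⟩)) hw)
    refine ⟨j, ?_, rfl⟩
    rw [Finset.mem_coe, Finset.mem_filter]
    exact ⟨Finset.mem_univ _, (isConjRoot_of_aeval_eq_zero hint hw).symm⟩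

/-- The degrees of the irreducible factors of a squarefree polynomial with separable roots are the
lengths of the orbits of the automorphism group on the roots. -/
theorem bind_factorDegrees [IsAlgClosed K] [Normal M K]
    (hR : R.map (algebraMap M K) = ∏ i, (X - C (z i)))
    (hsep : ∀ i, IsSeparable M (z i)) (hsq : Squarefree R) :
    ((factorDegrees R).bind fun k => Multiset.replicate k k) =
      Finset.univ.val.map fun i => Nat.card {j // ∃ σ : K ≃ₐ[M] K, σ (z i) = z j} := by
  classical
  have hz := injective_of_squarefree hR hsep hsq
  have h1 := map_eq_bind_image (fun i => minpoly M (z i)) natDegree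
    (card_filter_minpoly_eq hR hz hsep)
  rw [factorDegrees, normalizedFactors_eq_image_minpoly hR hsq]
  refine Eq.trans ?_ (h1.symm.trans ?_)
  · congr!
  · refine Multiset.map_congr rfl fun i _ => ?_
    rw [← card_filter_minpoly_eq hR hz hsep, ← Fintype.card_subtype,
      ← Nat.card_eq_fintype_card]
    refine Nat.card_congr (Equiv.subtypeEquivRight fun j => ?_)
    exact isConjRoot_iff_exists_algEquiv

theorem zero_notMem_factorDegrees : 0 ∉ factorDegrees R := by
  classical
  intro h
  obtain ⟨p, hp, h0⟩ := Multiset.mem_map.1 h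
  have hirr := UniqueFactorizationMonoid.irreducible_of_normalized_factor p hp
  exact hirr.natDegree_pos.ne' h0

/-! ### Descent -/

/-- A separable element outside `M` has a second conjugate, which some automorphism reaches.
Separability is needed because `K` is only normal over `M`. -/
theorem mem_range_algebraMap_of_fixed [Normal M K] {w : K} (hsep : IsSeparable M w)
    (hfix : ∀ σ : K ≃ₐ[M] K, σ w = w) : w ∈ (algebraMap M K).range := by
  by_contra h
  obtain ⟨v, hv, hc⟩ := (notMem_iff_exists_ne_and_isConjRoot hsep
    (Normal.splits inferInstance w)).1 h
  obtain ⟨σ, hσ⟩ := hc.exists_algEquiv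
  exact hv (σ.injective ((hfix σ).trans hσ.symm))

/-- The coefficients lie in the separable closure, where the roots lie, and are fixed by every
automorphism, since these permute the factors. -/
theorem exists_map_eq_prod [Normal M K] (hsep : ∀ i, IsSeparable M (z i))
    (hperm : ∀ σ : K ≃ₐ[M] K, ∃ e : Equiv.Perm ι, ∀ i, σ (z i) = z (e i)) :
    ∃ p : M[X], p.map (algebraMap M K) = ∏ i, (X - C (z i)) := by
  have h1 : (∏ i, (X - C (z i))) ∈ lifts (algebraMap (separableClosure M K) K) := by
    refine prod_mem fun i _ => ?_
    rw [mem_lifts]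
    exact ⟨X - C ⟨z i, mem_separableClosure_iff.2 (hsep i)⟩, by simp⟩
  have h2 : ∀ σ : K ≃ₐ[M] K, (∏ i, (X - C (z i))).map (σ : K →+* K) = ∏ i, (X - C (z i)) := by
    intro σ
    obtain ⟨e, he⟩ := hperm σ
    rw [Polynomial.map_prod, ← Equiv.prod_comp e fun i => X - C (z i)]
    simp [he]
  have h3 : (∏ i, (X - C (z i))) ∈ lifts (algebraMap M K) := by
    rw [lifts_iff_coeff_lifts] at h1 ⊢
    intro n
    refine mem_range_algebraMap_of_fixed ?_ fun σ => ?_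
    · obtain ⟨v, hv⟩ := h1 n
      rw [← hv]
      exact mem_separableClosure_iff.1 v.2
    · conv_rhs => rw [← h2 σ, coeff_map]
      rfl
  exact (mem_lifts _).1 h3

end Factor

/-! ### Resolvents of Tschirnhausen transformations -/

section Resolvent

variable {M : Type*} [Field M]

/-- Each `j` excludes a subspace of the polynomials of degree below four. It is proper: vanishing on
`1, X, X², X³` would force `w j = 0` by the Vandermonde determinant. Over an infinite field a vector
space is not a finite union of proper subspaces. -/
theorem exists_polynomial_forall_sum_ne_zero [Infinite M] {K : Type*} [Field K] [Algebra M K]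
    {x : Fin 4 → K} (hx : Function.Injective x) {J : Type*} [Finite J] (w : J → Fin 4 → K)
    (hw : ∀ j, w j ≠ 0) :
    ∃ c : M[X], c.degree < 4 ∧ ∀ j, ∑ i, aeval (x i) c * w j i ≠ 0 := by
  let φ : J → (degreeLT M 4 →ₗ[M] K) := fun j =>
    (∑ i, (LinearMap.mulRight M (w j i)) ∘ₗ (aeval (x i) : M[X] →ₐ[M] K).toLinearMap) ∘ₗ
      (degreeLT M 4).subtype
  have hφ : ∀ j c, φ j c = ∑ i, aeval (x i) (c : M[X]) * w j i := fun j c => by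
    simp [φ]
  have hne : ⋃ j, (LinearMap.ker (φ j) : Set (degreeLT M 4)) ≠ Set.univ := by
    intro h
    obtain ⟨j, hj⟩ := Subspace.exists_eq_top_of_iUnion_eq_univ h
    apply hw j
    refine Matrix.eq_zero_of_forall_pow_sum_mul_pow_eq_zero hx fun k => ?_
    have hk : (X ^ (k : ℕ) : M[X]) ∈ degreeLT M 4 := by
      rw [mem_degreeLT, degree_X_pow]
      exact_mod_cast k.2
    have h1 : φ j ⟨_, hk⟩ = 0 := by
      rw [← LinearMap.mem_ker, hj]; trivial
    rw [hφ] at h1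
    rw [← h1]
    refine Finset.sum_congr rfl fun i _ => ?_
    simp [mul_comm]
  obtain ⟨c, hc⟩ := (Set.ne_univ_iff_exists_notMem _).1 hne
  refine ⟨c, mem_degreeLT.1 c.2, fun j h => hc ?_⟩
  exact Set.mem_iUnion.2 ⟨j, by rw [SetLike.mem_coe, LinearMap.mem_ker, hφ, h]⟩

theorem exists_polynomial_injective_sum [Infinite M] {K : Type*} [Field K] [Algebra M K]
    {x y : Fin 4 → K} (hx : Function.Injective x) (hy : Function.Injective y) :
    ∃ c : M[X], c.degree < 4 ∧ (Function.Injective fun i => aeval (x i) c) ∧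
      Function.Injective fun π : Equiv.Perm (Fin 4) => ∑ i, aeval (x i) c * y (π i) := by
  -- Both kinds of coincidence, between two values of `c` and between two resolvent roots, are
  -- linear in the values `c (x i)`, with nonzero coefficient vectors `w`.
  let J := {p : Fin 4 × Fin 4 // p.1 ≠ p.2} ⊕
    {p : Equiv.Perm (Fin 4) × Equiv.Perm (Fin 4) // p.1 ≠ p.2}
  let w : J → Fin 4 → K := Sum.elim (fun p => Pi.single p.1.1 1 - Pi.single p.1.2 1)
    (fun p i => y (p.1.1 i) - y (p.1.2 i))
  have hw : ∀ j, w j ≠ 0 := by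
    rintro (⟨⟨i, j⟩, hij⟩ | ⟨⟨π, π'⟩, hπ⟩) h
    · have := congrFun h i
      simp only [ne_eq] at hij
      simp [w, hij] at this
    · apply hπ
      ext1 i
      exact hy (sub_eq_zero.1 (congrFun h i))
  obtain ⟨c, hc, h⟩ := exists_polynomial_forall_sum_ne_zero (M := M) hx w hw
  refine ⟨c, hc, fun i j hij => ?_, fun π π' hπ => ?_⟩
  · by_contra hne
    apply h (Sum.inl ⟨(i, j), hne⟩)
    simp only [w, Sum.elim_inl, Pi.sub_apply, mul_sub, Finset.sum_sub_distrib]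
    simpa [Pi.single_apply, sub_eq_zero] using hij
  · by_contra hne
    apply h (Sum.inr ⟨(π, π'), hne⟩)
    simp only [w, Sum.elim_inr, mul_sub, Finset.sum_sub_distrib]
    exact sub_eq_zero.2 hπ

variable {f g f' g' R : M[X]} {x y : Fin 4 → AlgebraicClosure M}

theorem IsRootOrdering.natDegree (hx : IsRootOrdering f x) : f.natDegree = 4 := by
  rw [← f.natDegree_map (algebraMap M (AlgebraicClosure M)), hx,
    natDegree_prod_of_monic _ _ fun i _ => monic_X_sub_C _]
  simp

theorem IsRootOrdering.degree (hx : IsRootOrdering f x) : f.degree = 4 := by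
  rw [degree_eq_natDegree hx.monic.ne_zero, hx.natDegree]; rfl

theorem IsRootOrdering.isTschirnhausen_iff (hx : IsRootOrdering f x) :
    IsTschirnhausen f f' ↔ f'.Separable ∧ ∃ c : M[X], c.degree < 4 ∧
      IsRootOrdering f' fun i => aeval (x i) c := by
  rw [IsTschirnhausen, hx.degree, hx.aroots]
  simp only [Multiset.map_map]
  rfl

/-- The root of the resolvent belonging to `π`. -/
noncomputable def resolventRoot (x y : Fin 4 → AlgebraicClosure M) (π : Equiv.Perm (Fin 4)) :
    AlgebraicClosure M := ∑ i, x i * y (π i)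

/-- Substituting along `c` in the sum. Renumbering the roots thus acts on the index `π` by
multiplication on both sides, which only permutes the factors of the resolvent and is also how
automorphisms act. -/
theorem resolventRoot_comp (c d π : Equiv.Perm (Fin 4)) :
    resolventRoot (x ∘ c) (y ∘ d) π = resolventRoot x y (d * π * c⁻¹) := by
  unfold resolventRoot
  rw [← Equiv.sum_comp c fun i => x i * y ((d * π * c⁻¹) i)]
  simp

theorem isResolvent_iff (hx : IsRootOrdering f x) (hy : IsRootOrdering g y) (hf : f.Separable)
    (hg : g.Separable) : IsResolvent f g R ↔
      R.map (algebraMap M (AlgebraicClosure M)) = ∏ π, (X - C (resolventRoot x y π)) := by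
  refine ⟨?_, fun h => ⟨x, y, hx, hy, h⟩⟩
  rintro ⟨x', y', hx', hy', h⟩
  obtain ⟨c, rfl⟩ := hx.exists_perm hx' hf
  obtain ⟨d, rfl⟩ := hy.exists_perm hy' hg
  rw [h]
  change ∏ π, (X - C (resolventRoot (x ∘ c) (y ∘ d) π)) = _
  simp only [resolventRoot_comp]
  exact Equiv.prod_comp ((Equiv.mulLeft d).trans (Equiv.mulRight c⁻¹))
    fun π => X - C (resolventRoot x y π)

theorem isSeparable_aeval {K : Type*} [Field K] [Algebra M K] {w : K} (hw : IsSeparable M w)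
    (c : M[X]) : IsSeparable M (aeval w c) := by
  have h : aeval w c = ((aeval (⟨w, mem_separableClosure_iff.2 hw⟩ : separableClosure M K) c :
      separableClosure M K) : K) := by
    exact aeval_algHom_apply (separableClosure M K).val
      ⟨w, mem_separableClosure_iff.2 hw⟩ c
  rw [h]
  exact mem_separableClosure_iff.1 (Subtype.prop _)

theorem isSeparable_resolventRoot (hx : ∀ i, IsSeparable M (x i)) (hy : ∀ i, IsSeparable M (y i))
    (π : Equiv.Perm (Fin 4)) : IsSeparable M (resolventRoot x y π) := by
  rw [← mem_separableClosure_iff]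
  exact sum_mem fun i _ => mul_mem (mem_separableClosure_iff.2 (hx i))
    (mem_separableClosure_iff.2 (hy _))

theorem apply_resolventRoot (σ : AlgebraicClosure M ≃ₐ[M] AlgebraicClosure M)
    {s t : Equiv.Perm (Fin 4)} (hs : ∀ i, σ (x i) = x (s i)) (ht : ∀ i, σ (y i) = y (t i))
    (π : Equiv.Perm (Fin 4)) :
    σ (resolventRoot x y π) = resolventRoot x y (t * π * s⁻¹) := by
  rw [← resolventRoot_comp, resolventRoot, resolventRoot, map_sum]
  simp [hs, ht]

/-- The number of permutations `t * π * s⁻¹` with `(s, t) ∈ E`. -/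
noncomputable def orbitCard (E : Subgroup (Equiv.Perm (Fin 4) × Equiv.Perm (Fin 4)))
    (π : Equiv.Perm (Fin 4)) : ℕ :=
  Nat.card {π' // ∃ e ∈ E, e.2 * π * e.1⁻¹ = π'}

/-- Squarefreeness makes the resolvent roots distinct, so two of them are conjugate over `M` exactly
when their indices lie in one orbit of `ρ.range`. The transformations chosen do not enter this
criterion. -/
theorem hasDT_of_orbitCard [Infinite M] (hx : IsRootOrdering f x) (hy : IsRootOrdering g y)
    (hf : f.Separable) (hg : g.Separable)
    (ρ : (AlgebraicClosure M ≃ₐ[M] AlgebraicClosure M) →*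
      Equiv.Perm (Fin 4) × Equiv.Perm (Fin 4))
    (hρx : ∀ σ i, σ (x i) = x ((ρ σ).1 i)) (hρy : ∀ σ i, σ (y i) = y ((ρ σ).2 i))
    {d : Multiset ℕ} (hd0 : 0 ∉ d)
    (hd : (d.bind fun k => Multiset.replicate k k) = Finset.univ.val.map (orbitCard ρ.range)) :
    HasDT f g d := by
  constructor
  · obtain ⟨c, hc, hcx, hcz⟩ := exists_polynomial_injective_sum (M := M)
      (hx.injective hf) (hy.injective hg)
    obtain ⟨f', hf'⟩ := exists_map_eq_prod (M := M) (z := fun i => aeval (x i) c)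
      (fun i => isSeparable_aeval (hx.isSeparable hf i) c)
      (fun σ => ⟨(ρ σ).1, fun i => by
        rw [← hρx]
        exact (aeval_algHom_apply (σ : AlgebraicClosure M →ₐ[M] AlgebraicClosure M) _ c).symm⟩)
    have hsep : f'.Separable := by
      rw [← separable_map (algebraMap M (AlgebraicClosure M)), hf']
      exact separable_prod_X_sub_C_iff.2 hcx
    have hsepx : ∀ i, IsSeparable M (aeval (x i) c) := fun i =>
      isSeparable_aeval (hx.isSeparable hf i) c
    obtain ⟨R, hR⟩ := exists_map_eq_prod (M := M)
      (z := resolventRoot (fun i => aeval (x i) c) y)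
      (isSeparable_resolventRoot hsepx (hy.isSeparable hg))
      (fun σ => ⟨(Equiv.mulLeft (ρ σ).2).trans (Equiv.mulRight (ρ σ).1⁻¹), fun π => by
        refine apply_resolventRoot σ (fun i => ?_) (hρy σ) π
        rw [← hρx]
        exact (aeval_algHom_apply (σ : AlgebraicClosure M →ₐ[M] AlgebraicClosure M) _ c).symm⟩)
    -- Only `f` has to be transformed; `g` is its own transformation by `X`.
    refine ⟨f', g, R, hx.isTschirnhausen_iff.2 ⟨hsep, c, hc, hf'⟩,
      hy.isTschirnhausen_iff.2 ⟨hg, X, ?_, ?_⟩, (isResolvent_iff hf' hy hsep hg).2 hR, ?_⟩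
    · rw [degree_X]; norm_num
    · simpa using hy
    · apply Separable.squarefree
      rw [← separable_map (algebraMap M (AlgebraicClosure M)), hR]
      exact separable_prod_X_sub_C_iff.2 hcz
  · intro f' g' R hf' hg' hR hsq
    obtain ⟨hsf, c, -, hf'⟩ := hx.isTschirnhausen_iff.1 hf'
    obtain ⟨hsg, c', -, hg'⟩ := hy.isTschirnhausen_iff.1 hg'
    have hR := (isResolvent_iff hf' hg' hsf hsg).1 hR
    have hsep := isSeparable_resolventRoot (fun i => isSeparable_aeval (hx.isSeparable hf i) c)
      (fun i => isSeparable_aeval (hy.isSeparable hg i) c')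
    have hinj := injective_of_squarefree hR hsep hsq
    refine eq_of_bind_replicate_self_eq zero_notMem_factorDegrees hd0 ?_
    rw [bind_factorDegrees hR hsep hsq, hd]
    refine Multiset.map_congr rfl fun π _ => Nat.card_congr (Equiv.subtypeEquivRight fun π' => ?_)
    have key : ∀ σ, σ (resolventRoot (fun i => aeval (x i) c) (fun i => aeval (y i) c') π) =
        resolventRoot (fun i => aeval (x i) c) (fun i => aeval (y i) c')
          ((ρ σ).2 * π * (ρ σ).1⁻¹) := by
      intro σ
      refine apply_resolventRoot σ (fun i => ?_) (fun i => ?_) π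
      · rw [← hρx]
        exact (aeval_algHom_apply (σ : AlgebraicClosure M →ₐ[M] AlgebraicClosure M) _ c).symm
      · rw [← hρy]
        exact (aeval_algHom_apply (σ : AlgebraicClosure M →ₐ[M] AlgebraicClosure M) _ c').symm
    constructor
    · rintro ⟨σ, hσ⟩
      exact ⟨ρ σ, ⟨σ, rfl⟩, hinj ((key σ).symm.trans hσ)⟩
    · rintro ⟨-, ⟨σ, rfl⟩, rfl⟩
      exact ⟨σ, key σ⟩

end Resolvent

/-! ### From permutation groups to rows of the tables -/

/-- The subgroup `E` of `S₄ × S₄` has projections isomorphic to `A` and `B`, is isomorphic to `G`,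
and its orbits on `S₄` have the lengths `d`. -/
structure GroupRow (E : Subgroup (Equiv.Perm (Fin 4) × Equiv.Perm (Fin 4))) (A B G : Type)
    [Group A] [Group B] [Group G] (d : Multiset ℕ) : Prop where
  fst : Nonempty (E.map (MonoidHom.fst _ _) ≃* A)
  snd : Nonempty (E.map (MonoidHom.snd _ _) ≃* B)
  all : Nonempty (E ≃* G)
  zero : 0 ∉ d
  orbits : (d.bind fun k => Multiset.replicate k k) = Finset.univ.val.map (orbitCard E)

section

variable {M : Type*} [Field M] {f g : M[X]} {x y : Fin 4 → AlgebraicClosure M}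

/-- The Galois group of `f * g` as a group of permutations of the roots of `f` and of `g`. -/
theorem exists_permHom_prod (hx : IsRootOrdering f x) (hy : IsRootOrdering g y)
    (hf : f.Separable) (hg : g.Separable) :
    ∃ ρ : (AlgebraicClosure M ≃ₐ[M] AlgebraicClosure M) →*
      Equiv.Perm (Fin 4) × Equiv.Perm (Fin 4),
      (∀ σ i, σ (x i) = x ((ρ σ).1 i)) ∧ ∀ σ i, σ (y i) = y ((ρ σ).2 i) := by
  obtain ⟨r, hr⟩ := exists_permHom x (hx.injective hf) hx.exists_apply
  obtain ⟨r', hr'⟩ := exists_permHom y (hy.injective hg) hy.exists_apply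
  exact ⟨r.prod r', hr, hr'⟩

theorem nonempty_gal_mulEquiv (hx : IsRootOrdering f x) (hy : IsRootOrdering g y)
    (hf : f.Separable) (hg : g.Separable)
    (ρ : (AlgebraicClosure M ≃ₐ[M] AlgebraicClosure M) →*
      Equiv.Perm (Fin 4) × Equiv.Perm (Fin 4))
    (hρx : ∀ σ i, σ (x i) = x ((ρ σ).1 i)) (hρy : ∀ σ i, σ (y i) = y ((ρ σ).2 i)) :
    Nonempty (f.Gal ≃* ρ.range.map (MonoidHom.fst _ _)) ∧
      Nonempty (g.Gal ≃* ρ.range.map (MonoidHom.snd _ _)) ∧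
      Nonempty ((f * g).Gal ≃* ρ.range) := by
  have h1 : ∀ σ, (ρ σ).1 = 1 ↔ ∀ z ∈ f.rootSet (AlgebraicClosure M), σ z = z := fun σ => by
    simp only [hx.mem_rootSet_iff, forall_exists_index, forall_apply_eq_imp_iff, hρx,
      (hx.injective hf).eq_iff, Equiv.ext_iff, Equiv.Perm.one_apply]
  have h2 : ∀ σ, (ρ σ).2 = 1 ↔ ∀ z ∈ g.rootSet (AlgebraicClosure M), σ z = z := fun σ => by
    simp only [hy.mem_rootSet_iff, forall_exists_index, forall_apply_eq_imp_iff, hρy,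
      (hy.injective hg).eq_iff, Equiv.ext_iff, Equiv.Perm.one_apply]
  have h3 : ∀ σ, ρ σ = 1 ↔ ∀ z ∈ (f * g).rootSet (AlgebraicClosure M), σ z = z := fun σ => by
    have : (f * g).rootSet (AlgebraicClosure M) =
        f.rootSet (AlgebraicClosure M) ∪ g.rootSet (AlgebraicClosure M) := by
      ext z
      simp [mem_rootSet, hx.monic.ne_zero, hy.monic.ne_zero]
    rw [Prod.ext_iff, Prod.fst_one, Prod.snd_one, h1, h2, this]
    constructor
    · rintro ⟨h, h'⟩ z (hz | hz)
      exacts [h z hz, h' z hz]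
    · exact fun h => ⟨fun z hz => h z (Or.inl hz), fun z hz => h z (Or.inr hz)⟩
  rw [← MonoidHom.range_comp, ← MonoidHom.range_comp]
  exact ⟨gal_mulEquiv_range f ((MonoidHom.fst _ _).comp ρ) h1,
    gal_mulEquiv_range g ((MonoidHom.snd _ _).comp ρ) h2, gal_mulEquiv_range _ ρ h3⟩

theorem finrank_inf_mul_card (hf : f.Separable) (hg : g.Separable) (hf0 : f ≠ 0) (hg0 : g ≠ 0)
    {A B G : Type} [Group A] [Group B] [Group G] (hA : Nonempty (f.Gal ≃* A))
    (hB : Nonempty (g.Gal ≃* B)) (hG : Nonempty ((f * g).Gal ≃* G)) :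
    Module.finrank M ↥(splittingIn f ⊓ splittingIn g) * Nat.card G = Nat.card A * Nat.card B ∧
      Module.finrank M ↥(splittingIn f ⊔ splittingIn g) = Nat.card G ∧
      Module.finrank M (splittingIn f) = Nat.card A ∧
      Module.finrank M (splittingIn g) = Nat.card B := by
  obtain ⟨eA⟩ := hA
  obtain ⟨eB⟩ := hB
  obtain ⟨eG⟩ := hG
  have := isGalois_splittingIn f hf
  have := isGalois_splittingIn g hg
  have := finiteDimensional_splittingIn f
  have := finiteDimensional_splittingIn g
  have hG : Module.finrank M ↥(splittingIn f ⊔ splittingIn g) = Nat.card G := by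
    have hs : splittingIn (f * g) = splittingIn f ⊔ splittingIn g := splittingIn_mul hf0 hg0
    have hgal : IsGalois M (splittingIn (f * g)) := hs ▸ inferInstance
    rw [← hs, finrank_splittingIn, Nat.card_congr eG.toEquiv]
  have hA : Module.finrank M (splittingIn f) = Nat.card A := by
    rw [finrank_splittingIn f, Nat.card_congr eA.toEquiv]
  have hB : Module.finrank M (splittingIn g) = Nat.card B := by
    rw [finrank_splittingIn g, Nat.card_congr eB.toEquiv]
  refine ⟨?_, hG, hA, hB⟩
  rw [← hG, ← hA, ← hB, finrank_inf_mul_finrank_sup]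

/-- The hypothesis `hi` asks that the field condition follow from degrees alone, so one statement
covers all kinds of rows. -/
theorem GroupRow.row [Infinite M] (hx : IsRootOrdering f x) (hy : IsRootOrdering g y)
    (hf : f.Separable) (hg : g.Separable)
    (ρ : (AlgebraicClosure M ≃ₐ[M] AlgebraicClosure M) →*
      Equiv.Perm (Fin 4) × Equiv.Perm (Fin 4))
    (hρx : ∀ σ i, σ (x i) = x ((ρ σ).1 i)) (hρy : ∀ σ i, σ (y i) = y ((ρ σ).2 i))
    {A B G : Type} [Group A] [Group B] [Group G] {d : Multiset ℕ}
   
    (h : GroupRow ρ.range A B G d)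
    {inter : IntermediateField M (AlgebraicClosure M) →
      IntermediateField M (AlgebraicClosure M) → Prop}
    (hi : ∀ L L' : IntermediateField M (AlgebraicClosure M), FiniteDimensional M L →
      FiniteDimensional M L' →
      Module.finrank M ↥(L ⊓ L') * Nat.card G = Nat.card A * Nat.card B →
      Module.finrank M ↥(L ⊔ L') = Nat.card G → Module.finrank M L = Nat.card A →
      Module.finrank M L' = Nat.card B → inter L L') :
    Row f g A B G inter d := by
  obtain ⟨⟨e₁⟩, ⟨e₂⟩, ⟨e₃⟩⟩ := nonempty_gal_mulEquiv hx hy hf hg ρ hρx hρy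
  obtain ⟨e₁'⟩ := h.fst
  obtain ⟨e₂'⟩ := h.snd
  obtain ⟨e₃'⟩ := h.all
  have hA : Nonempty (f.Gal ≃* A) := ⟨e₁.trans e₁'⟩
  have hB : Nonempty (g.Gal ≃* B) := ⟨e₂.trans e₂'⟩
  have hG : Nonempty ((f * g).Gal ≃* G) := ⟨e₃.trans e₃'⟩
  obtain ⟨h1, h2, h3, h4⟩ :=
    finrank_inf_mul_card hf hg hx.monic.ne_zero hy.monic.ne_zero hA hB hG
  exact ⟨hA, hB, hG, hi _ _ (finiteDimensional_splittingIn f) (finiteDimensional_splittingIn g)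
    h1 h2 h3 h4, hasDT_of_orbitCard hx hy hf hg ρ hρx hρy h.zero h.orbits⟩

theorem interTrivial_of_card {a b e : ℕ} (he : e = a * b) (h0 : 0 < e)
    (L L' : IntermediateField M (AlgebraicClosure M))
    (h : Module.finrank M ↥(L ⊓ L') * e = a * b) : InterTrivial L L' := by
  rw [← he] at h
  exact IntermediateField.finrank_eq_one_iff.1 (Nat.eq_of_mul_eq_mul_right h0 (by rw [h, one_mul]))

theorem interQuadratic_of_card {a b e : ℕ} (he : 2 * e = a * b) (h0 : 0 < e)
    (L L' : IntermediateField M (AlgebraicClosure M))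
    (h : Module.finrank M ↥(L ⊓ L') * e = a * b) : InterQuadratic L L' := by
  rw [← he] at h
  exact Nat.eq_of_mul_eq_mul_right h0 h

theorem le_of_finrank_sup (L L' : IntermediateField M (AlgebraicClosure M))
    [FiniteDimensional M L] [FiniteDimensional M L']
    (h : Module.finrank M ↥(L ⊔ L') = Module.finrank M L') : L ≤ L' :=
  (IntermediateField.eq_of_le_of_finrank_eq (le_sup_right : L' ≤ L ⊔ L') h.symm).symm ▸
    le_sup_left

theorem eq_of_finrank_sup (L L' : IntermediateField M (AlgebraicClosure M))
    [FiniteDimensional M L] [FiniteDimensional M L']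
    (h : Module.finrank M ↥(L ⊔ L') = Module.finrank M L')
    (h' : Module.finrank M L = Module.finrank M L') : L = L' :=
  IntermediateField.eq_of_le_of_finrank_eq (le_of_finrank_sup L L' h) h'

/-! ### The family of quartics -/

theorem quartic_monic (a b : M) : (quartic a b).Monic := by
  unfold quartic
  monicity!

theorem quartic_natDegree (a b : M) : (quartic a b).natDegree = 4 := by
  unfold quartic
  compute_degree!

theorem quartic_separable {a b : M} (h : quarticDisc a b ≠ 0) : (quartic a b).Separable := by
  -- Explicit Bézout cofactors expressing the discriminant in terms of `f` and its derivative;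
  -- dividing by the discriminant gives separability.
  let u : M[X] := C (144 * b ^ 2 - 128 * a * b + 32 * a ^ 3) * X ^ 2 +
    C (-192 * b ^ 2 - 16 * a ^ 2 * b) * X +
    C (256 * b ^ 2 + 96 * a * b ^ 2 - 128 * a ^ 2 * b + 16 * a ^ 4)
  let v : M[X] := C (-36 * b ^ 2 + 32 * a * b - 8 * a ^ 3) * X ^ 3 +
    C (48 * b ^ 2 + 4 * a ^ 2 * b) * X ^ 2 +
    C (-64 * b ^ 2 - 42 * a * b ^ 2 + 48 * a ^ 2 * b - 8 * a ^ 4) * X +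
    C (-27 * b ^ 3 + 48 * a * b ^ 2 - 4 * a ^ 3 * b)
  have key : u * quartic a b + v * derivative (quartic a b) = C (quarticDisc a b) := by
    simp only [u, v, quartic, quarticDisc, derivative_mul, derivative_C,
      derivative_X_pow, derivative_X, map_add, map_mul, map_sub, map_pow, map_neg, map_ofNat]
    push_cast
    simp only [map_ofNat]
    ring
  refine ⟨C (quarticDisc a b)⁻¹ * u, C (quarticDisc a b)⁻¹ * v, ?_⟩
  rw [mul_assoc, mul_assoc, ← mul_add, key, ← C_mul, inv_mul_cancel₀ h, C_1]

end

/-! ### Homomorphisms out of the groups of the tables -/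

section Homs

variable {G : Type*} [Group G]

/-- The homomorphism on the cyclic group of order `n` which takes the generator to `g`. -/
def cyclicHom (n : ℕ) [NeZero n] (g : G) (h : g ^ n = 1) : Cn n →* G where
  toFun z := g ^ (Multiplicative.toAdd z).val
  map_one' := by simp
  map_mul' x y := by
    rw [toAdd_mul, ZMod.val_add, ← pow_add, ← pow_eq_pow_mod _ h]

/-- The homomorphism on the dihedral group of degree `n` given by a rotation and a reflection. -/
def dihedralHom (n : ℕ) [NeZero n] (g s : G) (hg : g ^ n = 1) (hs : s * s = 1)
    (h : s * g * s⁻¹ = g⁻¹) : Dn n →* G where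
  toFun
    | .r i => cyclicHom n g hg (Multiplicative.ofAdd i)
    | .sr i => s * cyclicHom n g hg (Multiplicative.ofAdd i)
  map_one' := map_one (cyclicHom n g hg)
  map_mul' x y := by
    -- A rotation moves past the reflection by being inverted; all four products reduce to this.
    have key : ∀ i : ZMod n, cyclicHom n g hg (Multiplicative.ofAdd i) * s =
        s * cyclicHom n g hg (Multiplicative.ofAdd (-i)) := fun i => by
      have hs' : s⁻¹ = s := inv_eq_of_mul_eq_one_right hs
      have h1 : s * cyclicHom n g hg (Multiplicative.ofAdd i) * s⁻¹ =
          (cyclicHom n g hg (Multiplicative.ofAdd i))⁻¹ := by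
        change s * g ^ _ * s⁻¹ = (g ^ _)⁻¹
        rw [← conj_pow, h, inv_pow]
      rw [ofAdd_neg, map_inv, ← h1, hs', ← mul_assoc, ← mul_assoc, hs, one_mul]
    rcases x with i | i <;> rcases y with j | j
    · change cyclicHom n g hg (Multiplicative.ofAdd (i + j)) = _
      rw [ofAdd_add, map_mul]
    · change s * cyclicHom n g hg (Multiplicative.ofAdd (j - i)) = _ * (s * _)
      rw [← mul_assoc, key, mul_assoc, ← map_mul, ← ofAdd_add, neg_add_eq_sub]
    · change s * cyclicHom n g hg (Multiplicative.ofAdd (i + j)) = s * _ * _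
      rw [ofAdd_add, map_mul, mul_assoc]
    · change cyclicHom n g hg (Multiplicative.ofAdd (j - i)) = s * _ * (s * _)
      rw [mul_assoc, ← mul_assoc _ s, key, mul_assoc, ← mul_assoc s s, hs, one_mul, ← map_mul,
        ← ofAdd_add, neg_add_eq_sub]

/-- The homomorphism on the Klein four group given by two commuting involutions. -/
def kleinHom (u v : G) (hu : u ^ 2 = 1) (hv : v ^ 2 = 1) (huv : Commute u v) : V4 →* G :=
  (cyclicHom 2 u hu).noncommCoprod (cyclicHom 2 v hv) fun _ _ => huv.pow_pow _ _

/-- The homomorphism on the semidirect product of `N` and a cyclic group, where the generator of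
the cyclic group is taken to `c`. -/
def semidirectHom (n : ℕ) [NeZero n] {N : Type} [Group N] (θ : MulAut N) (h : θ ^ n = 1)
    (f : N →* G) (c : G) (hc : c ^ n = 1) (hθ : ∀ x, f (θ x) = c * f x * c⁻¹) :
    N ⋊[cyclicAction n θ h] Cn n →* G :=
  SemidirectProduct.lift f (cyclicHom n c hc) fun z => by
    -- Every element is a power of the generator, so compatibility of the actions need only be
    -- assumed for `θ` and `c`.
    have hz : z = Multiplicative.ofAdd (1 : ZMod n) ^ (Multiplicative.toAdd z).val := by
      rw [← ofAdd_nsmul, nsmul_one, ZMod.natCast_zmod_val, ofAdd_toAdd]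
    have key : ∀ k : ℕ, ∀ x, f ((θ ^ k) x) = c ^ k * f x * (c ^ k)⁻¹ := by
      intro k
      induction k with
      | zero => simp
      | succ k ih =>
        intro x
        rw [pow_succ, MulAut.mul_apply, ih, hθ, pow_succ]
        group
    ext x
    conv_lhs => rw [hz]
    rw [map_pow, cyclicAction_gen]
    exact key _ x

end Homs

/-! ### Subgroups of `S₄ × S₄` given by decidable conditions -/

section Builder

theorem nonempty_mulEquiv_of_hom {A G : Type*} [Group A] [Group G] (φ : A →* G)
    (hφ : Function.Injective φ) (H : Subgroup G) (h : ∀ g, g ∈ H ↔ ∃ a, φ a = g) :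
    Nonempty (H ≃* A) := by
  have : H = φ.range := by ext g; rw [h, MonoidHom.mem_range]
  subst this
  exact ⟨(MonoidHom.ofInjective hφ).symm⟩

variable (p : Sn 4 → Sn 4 → Prop) [∀ s t, Decidable (p s t)]

/-- The number of `s` for which `(s, π * s * π⁻¹)` satisfies `p`. -/
def stabCount (π : Sn 4) : ℕ := (Finset.univ.filter fun s => p s (π * s * π⁻¹)).card

variable {p} {E : Subgroup (Sn 4 × Sn 4)}

theorem card_eq_of_mem_iff (hE : ∀ s t, (s, t) ∈ E ↔ p s t) :
    Nat.card E = (Finset.univ.filter fun e : Sn 4 × Sn 4 => p e.1 e.2).card := by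
  rw [← Fintype.card_subtype, ← Nat.card_eq_fintype_card]
  exact Nat.card_congr (Equiv.subtypeEquivRight fun e => hE e.1 e.2)

/-- Orbit-stabilizer: `(s, t)` fixes `π` exactly when `t = π * s * π⁻¹`, so the stabilizer is
parametrized by `s` alone. An orbit length becomes a count over 24 permutations, which the kernel
can evaluate. -/
theorem orbitCard_eq (hE : ∀ s t, (s, t) ∈ E ↔ p s t) (π : Sn 4) :
    orbitCard E π = Nat.card E / stabCount p π := by
  let act : MulAction E (Sn 4) :=
    { smul := fun e π => e.1.2 * π * e.1.1⁻¹
      one_smul := fun π => by change 1 * π * 1⁻¹ = π; simp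
      mul_smul := fun e e' π => by
        change (e.1.2 * e'.1.2) * π * (e.1.1 * e'.1.1)⁻¹ = e.1.2 * (e'.1.2 * π * e'.1.1⁻¹) * e.1.1⁻¹
        group }
  have hsmul : ∀ (e : E), e • π = e.1.2 * π * e.1.1⁻¹ := fun e => rfl
  have h1 : Nat.card (MulAction.orbit E π) = orbitCard E π := by
    refine Nat.card_congr (Equiv.subtypeEquivRight fun π' => ?_)
    rw [MulAction.mem_orbit_iff]
    simp only [hsmul, Subtype.exists, exists_prop]
  have h2 : Nat.card (MulAction.stabilizer E π) = stabCount p π := by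
    rw [stabCount, ← Fintype.card_subtype, ← Nat.card_eq_fintype_card]
    have hmem : ∀ e : E, e ∈ MulAction.stabilizer E π ↔ e.1.2 = π * e.1.1 * π⁻¹ := fun e => by
      rw [MulAction.mem_stabilizer_iff, hsmul, mul_inv_eq_iff_eq_mul, eq_mul_inv_iff_mul_eq]
    refine Nat.card_congr
      { toFun := fun e => ⟨e.1.1.1, ?_⟩
        invFun := fun s => ⟨⟨(s.1, π * s.1 * π⁻¹), (hE _ _).2 s.2⟩, (hmem _).2 rfl⟩
        left_inv := ?_
        right_inv := fun s => rfl }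
    · rw [← (hmem _).1 e.2, ← hE]
      exact e.1.2
    · rintro ⟨⟨⟨s, t⟩, he⟩, hs⟩
      have := (hmem _).1 hs
      ext1
      ext1
      exact Prod.ext rfl this.symm
  have h3 : orbitCard E π * stabCount p π = Nat.card E := by
    rw [← h1, ← h2, Nat.card_congr (MulAction.orbitEquivQuotientStabilizer E π)]
    exact (Subgroup.card_eq_card_quotient_mul_card_subgroup _).symm
  rw [← h3, Nat.mul_div_cancel]
  rw [← h2]
  exact Nat.card_pos

variable {A B G : Type} [Group A] [Group B] [Group G] {d : Multiset ℕ}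

/-- Once membership in `E` is a decidable predicate, the projections and orbit lengths are finite
checks; the numeral `e` keeps `Nat.card` out of the computation. -/
theorem groupRow_of_mem_iff (hE : ∀ s t, (s, t) ∈ E ↔ p s t)
    (φ : A →* Sn 4) (hφ : Function.Injective φ) (hA : ∀ s, (∃ t, p s t) ↔ ∃ a, φ a = s)
    (ψ : B →* Sn 4) (hψ : Function.Injective ψ) (hB : ∀ t, (∃ s, p s t) ↔ ∃ b, ψ b = t)
    (hG : Nonempty (E ≃* G)) {e : ℕ} (he : Nat.card G = e) (hd0 : 0 ∉ d)
    (hd : (d.bind fun k => Multiset.replicate k k) =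
      Finset.univ.val.map fun π => e / stabCount p π) : GroupRow E A B G d where
  fst := nonempty_mulEquiv_of_hom φ hφ _ fun s => by simp [← hA, hE]
  snd := nonempty_mulEquiv_of_hom ψ hψ _ fun t => by simp [← hB, hE]
  all := hG
  zero := hd0
  orbits := by
    rw [hd]
    refine Multiset.map_congr rfl fun π _ => ?_
    obtain ⟨f⟩ := hG
    rw [orbitCard_eq hE, Nat.card_congr f.toEquiv, he]

/-- An embedding of `G` into `E` is enough once `E` is counted to be no larger, which spares
checking surjectivity. -/
theorem nonempty_mulEquiv_of_card (hE : ∀ s t, (s, t) ∈ E ↔ p s t)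
    (χ : G →* Sn 4 × Sn 4) (hχ : Function.Injective χ) (h : ∀ x, p (χ x).1 (χ x).2)
    (hc : (Finset.univ.filter fun e : Sn 4 × Sn 4 => p e.1 e.2).card ≤ Nat.card G) :
    Nonempty (E ≃* G) := by
  have hle : χ.range ≤ E := by
    rintro - ⟨x, rfl⟩
    exact (hE _ _).2 (h x)
  have hcard : Nat.card E ≤ Nat.card χ.range := by
    rwa [card_eq_of_mem_iff hE, ← Nat.card_congr (MonoidHom.ofInjective hχ).toEquiv]
  rw [← Subgroup.eq_of_le_of_card_ge hle hcard]
  exact ⟨(MonoidHom.ofInjective hχ).symm⟩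

theorem nonempty_mulEquiv_of_snd_injective (h : ∀ s, (s, 1) ∈ E → s = 1)
    (hB : Nonempty (E.map (MonoidHom.snd _ _) ≃* G)) : Nonempty (E ≃* G) := by
  obtain ⟨e⟩ := hB
  have hinj : Function.Injective ((MonoidHom.snd (Sn 4) (Sn 4)).comp E.subtype) := by
    rw [injective_iff_map_eq_one]
    rintro ⟨⟨s, t⟩, he⟩ h1
    obtain rfl : t = 1 := h1
    ext1
    exact Prod.ext (h s he) rfl
  have hr : ((MonoidHom.snd (Sn 4) (Sn 4)).comp E.subtype).range =
      E.map (MonoidHom.snd _ _) := by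
    rw [MonoidHom.range_comp, Subgroup.range_subtype]
  exact ⟨(MonoidHom.ofInjective hinj).trans ((MulEquiv.subgroupCongr hr).trans e)⟩

end Builder

open Equiv

/-! ### The subgroups of `S₄ × S₄` belonging to the rows -/

/-- The `3`-cycle `1 ↦ 2 ↦ 3 ↦ 1`. -/
abbrev rot3 : Sn 4 := swap 1 2 * swap 2 3

/-- The `4`-cycle `i ↦ i + 1`. -/
abbrev rot4 : Sn 4 := finRotate 4

/-- The stabilizer of a point. -/
def pointStab (i : Fin 4) : Subgroup (Sn 4) := MulAction.stabilizer (Sn 4) i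

/-- The centralizer of a permutation. -/
def cent (g : Sn 4) : Subgroup (Sn 4) := Subgroup.centralizer {g}

/-- The transitive Klein four group. -/
def klein : Subgroup (Sn 4) := cent (rot4 * rot4) ⊓ cent (swap 0 1 * swap 2 3)

theorem mem_pointStab {i : Fin 4} {s : Sn 4} : s ∈ pointStab i ↔ s i = i := Iff.rfl

theorem mem_cent {g t : Sn 4} : t ∈ cent g ↔ t * g = g * t :=
  Subgroup.mem_centralizer_singleton_iff

instance (i : Fin 4) : DecidablePred (· ∈ pointStab i) :=
  fun _ => decidable_of_iff _ mem_pointStab.symm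

instance (g : Sn 4) : DecidablePred (· ∈ cent g) := fun _ => decidable_of_iff _ mem_cent.symm

instance : DecidablePred (· ∈ klein) := fun _ => decidable_of_iff _ Subgroup.mem_inf.symm

instance : DecidablePred (· ∈ (⊤ : Subgroup (Sn 4))) := fun _ => isTrue trivial

instance : DecidablePred (· ∈ alternatingGroup (Fin 4)) :=
  fun _ => decidable_of_iff _ Perm.mem_alternatingGroup.symm

section Conditions

variable (G H N : Subgroup (Sn 4))

/-- Membership in the full product of `G` and `H`. -/
def FullPred (s t : Sn 4) : Prop := s ∈ G ∧ t ∈ H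

/-- Membership in the fibre product of the stabilizer of `0` and `H` over the group of order two,
with kernels the even permutations and `N`. -/
def FiberPred (s t : Sn 4) : Prop := s ∈ pointStab 0 ∧ t ∈ H ∧ (Perm.sign s = 1 ↔ t ∈ N)

/-- Membership in the fibre product of `G` and `H` over the quotient of `S₄` by its normal Klein
four group. -/
def GraphPred (s t : Sn 4) : Prop := s ∈ G ∧ t ∈ H ∧ t * s⁻¹ ∈ klein

variable [DecidablePred (· ∈ G)] [DecidablePred (· ∈ H)] [DecidablePred (· ∈ N)]

instance (s t : Sn 4) : Decidable (FullPred G H s t) :=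
  inferInstanceAs (Decidable (s ∈ G ∧ t ∈ H))

instance (s t : Sn 4) : Decidable (FiberPred H N s t) :=
  inferInstanceAs (Decidable (s ∈ pointStab 0 ∧ t ∈ H ∧ (Perm.sign s = 1 ↔ t ∈ N)))

instance (s t : Sn 4) : Decidable (GraphPred G H s t) :=
  inferInstanceAs (Decidable (s ∈ G ∧ t ∈ H ∧ t * s⁻¹ ∈ klein))

end Conditions

/-! ### Homomorphisms onto the projections -/

/-- `S₃` as the stabilizer of `0` in `S₄`. -/
def symHom : Sn 3 →* Sn 4 := Perm.extendDomainHom (finSuccAboveEquiv (0 : Fin 4))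

/-- `C₃` as a subgroup of `S₄`. -/
def c3Hom : Cn 3 →* Sn 4 := cyclicHom 3 rot3 (by decide)

/-- `C₄` as a subgroup of `S₄`. -/
def c4Hom : Cn 4 →* Sn 4 := cyclicHom 4 rot4 (by decide)

/-- `D₄` as a subgroup of `S₄`. -/
def d4Hom : Dn 4 →* Sn 4 := dihedralHom 4 rot4 (swap 0 2) (by decide) (by decide) (by decide)

/-- The transitive Klein four group in `S₄`. -/
def kleinTransHom : V4 →* Sn 4 :=
  kleinHom (swap 0 1 * swap 2 3) (swap 0 3 * swap 1 2) (by decide) (by decide)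
    (by unfold Commute SemiconjBy; decide)

/-- The Klein four group in `S₄` generated by two transpositions. -/
def kleinIntransHom : V4 →* Sn 4 :=
  kleinHom (swap 0 1) (swap 2 3) (by decide) (by decide) (by unfold Commute SemiconjBy; decide)

theorem symHom_injective : Function.Injective symHom := Perm.extendDomainHom_injective _

theorem c3Hom_injective : Function.Injective c3Hom :=
  (injective_iff_map_eq_one _).2 (by decide +kernel)

theorem c4Hom_injective : Function.Injective c4Hom :=
  (injective_iff_map_eq_one _).2 (by decide +kernel)

theorem d4Hom_injective : Function.Injective d4Hom :=
  (injective_iff_map_eq_one _).2 (by decide +kernel)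

theorem kleinTransHom_injective : Function.Injective kleinTransHom :=
  (injective_iff_map_eq_one _).2 (by decide +kernel)

theorem kleinIntransHom_injective : Function.Injective kleinIntransHom :=
  (injective_iff_map_eq_one _).2 (by decide +kernel)

theorem mem_pointStab_iff : ∀ s, s ∈ pointStab 0 ↔ ∃ a, symHom a = s := by decide +kernel

theorem mem_cent_rot3_iff : ∀ s, s ∈ cent rot3 ↔ ∃ a, c3Hom a = s := by decide +kernel

theorem mem_cent_rot4_iff : ∀ s, s ∈ cent rot4 ↔ ∃ a, c4Hom a = s := by decide +kernel

theorem mem_cent_rot4_sq_iff : ∀ s, s ∈ cent (rot4 * rot4) ↔ ∃ a, d4Hom a = s := by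
  decide +kernel

theorem mem_klein_iff : ∀ s, s ∈ klein ↔ ∃ a, kleinTransHom a = s := by decide +kernel

theorem mem_cent_swap_iff : ∀ s, s ∈ cent (swap 0 1) ↔ ∃ a, kleinIntransHom a = s := by
  decide +kernel

theorem mem_alternating_iff (s : Sn 4) :
    s ∈ alternatingGroup (Fin 4) ↔ ∃ a, (alternatingGroup (Fin 4)).subtype a = s :=
  ⟨fun h => ⟨⟨s, h⟩, rfl⟩, by rintro ⟨a, rfl⟩; exact a.2⟩

theorem mem_top_iff (s : Sn 4) : s ∈ (⊤ : Subgroup (Sn 4)) ↔ ∃ a, MonoidHom.id (Sn 4) a = s :=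
  ⟨fun _ => ⟨s, rfl⟩, fun _ => trivial⟩

/-! ### The rows with full products -/

section Full

variable {E : Subgroup (Sn 4 × Sn 4)} {G H : Subgroup (Sn 4)}
  {A B : Type} [Group A] [Group B] {d : Multiset ℕ}

theorem groupRow_of_fullPred [DecidablePred (· ∈ G)] [DecidablePred (· ∈ H)]
    (hE : ∀ s t, (s, t) ∈ E ↔ FullPred G H s t)
    {φ : A →* Sn 4} (hφ : Function.Injective φ) (hA : ∀ s, s ∈ G ↔ ∃ a, φ a = s)
    {ψ : B →* Sn 4} (hψ : Function.Injective ψ) (hB : ∀ t, t ∈ H ↔ ∃ b, ψ b = t)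
    {e : ℕ} (he : Nat.card A * Nat.card B = e) (hd0 : 0 ∉ d)
    (hd : (d.bind fun k => Multiset.replicate k k) =
      Finset.univ.val.map fun π => e / stabCount (FullPred G H) π) :
    GroupRow E A B (A × B) d := by
  refine groupRow_of_mem_iff hE φ hφ (fun s => ?_) ψ hψ (fun t => ?_) ?_
    ((Nat.card_prod A B).trans he) hd0 hd
  · exact ⟨fun ⟨_, h⟩ => (hA s).1 h.1, fun h => ⟨1, (hA s).2 h, H.one_mem⟩⟩
  · exact ⟨fun ⟨_, h⟩ => (hB t).1 h.2, fun h => ⟨1, G.one_mem, (hB t).2 h⟩⟩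
  · refine nonempty_mulEquiv_of_hom (φ.prodMap ψ) (hφ.prodMap hψ) _ ?_
    rintro ⟨s, t⟩
    rw [hE, FullPred, hA, hB]
    simp

theorem groupRow_of_fiberPred {G : Type} [Group G] {N : Subgroup (Sn 4)}
    [DecidablePred (· ∈ H)] [DecidablePred (· ∈ N)]
    (hE : ∀ s t, (s, t) ∈ E ↔ FiberPred H N s t)
    {ψ : B →* Sn 4} (hψ : Function.Injective ψ) (hB : ∀ t, t ∈ H ↔ ∃ b, ψ b = t)
    (hN : ∃ t ∈ H, t ∉ N) (χ : G →* Sn 4 × Sn 4) (hχ : Function.Injective χ)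
    (h : ∀ x, FiberPred H N (χ x).1 (χ x).2) {e : ℕ} (he : Nat.card G = e)
    (hc : (Finset.univ.filter fun x : Sn 4 × Sn 4 => FiberPred H N x.1 x.2).card ≤ e)
    (hd0 : 0 ∉ d)
    (hd : (d.bind fun k => Multiset.replicate k k) =
      Finset.univ.val.map fun π => e / stabCount (FiberPred H N) π) :
    GroupRow E (Sn 3) B G d := by
  refine groupRow_of_mem_iff hE symHom symHom_injective (fun s => ?_) ψ hψ (fun t => ?_)
    (nonempty_mulEquiv_of_card hE χ hχ h (he ▸ hc)) he hd0 hd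
  · rw [← mem_pointStab_iff]
    refine ⟨fun ⟨_, h⟩ => h.1, fun hs => ?_⟩
    by_cases h1 : Perm.sign s = 1
    · exact ⟨1, hs, H.one_mem, iff_of_true h1 N.one_mem⟩
    · obtain ⟨t, ht, htN⟩ := hN
      exact ⟨t, hs, ht, iff_of_false h1 htN⟩
  · rw [← hB]
    refine ⟨fun ⟨_, h⟩ => h.2.1, fun ht => ?_⟩
    by_cases h1 : t ∈ N
    · exact ⟨1, one_mem _, ht, iff_of_true (map_one _) h1⟩
    -- Any odd permutation fixing `0` serves as partner for an element outside `N`.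
    · exact ⟨swap 1 2, by decide, ht, iff_of_false (by decide) h1⟩

theorem groupRow_of_graphPred [DecidablePred (· ∈ G)] [DecidablePred (· ∈ H)]
    (hE : ∀ s t, (s, t) ∈ E ↔ GraphPred G H s t)
    {φ : A →* Sn 4} (hφ : Function.Injective φ)
    (hA : ∀ s, (∃ t, GraphPred G H s t) ↔ ∃ a, φ a = s)
    {ψ : B →* Sn 4} (hψ : Function.Injective ψ) (hB : ∀ t, (∃ s, GraphPred G H s t) ↔ ∃ b, ψ b = t)
    (h1 : ∀ s, GraphPred G H s 1 → s = 1)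
    {e : ℕ} (he : Nat.card B = e) (hd0 : 0 ∉ d)
    (hd : (d.bind fun k => Multiset.replicate k k) =
      Finset.univ.val.map fun π => e / stabCount (GraphPred G H) π) :
    GroupRow E A B B d := by
  refine groupRow_of_mem_iff hE φ hφ hA ψ hψ hB ?_ he hd0 hd
  refine nonempty_mulEquiv_of_snd_injective (fun s hs => h1 s ((hE _ _).1 hs))
    (nonempty_mulEquiv_of_hom ψ hψ _ fun t => ?_)
  rw [← hB]
  simp [hE]

end Full

/-! ### Orders of the groups in the tables. -/

theorem card_Sn3 : Nat.card (Sn 3) = 6 := by rw [Nat.card_perm, Nat.card_fin]; rfl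
theorem card_Sn4 : Nat.card (Sn 4) = 24 := by rw [Nat.card_perm, Nat.card_fin]; rfl
theorem card_A4 : Nat.card A4 = 12 := by
  have := two_mul_nat_card_alternatingGroup (α := Fin 4)
  rw [card_Sn4] at this
  change Nat.card (alternatingGroup (Fin 4)) = 12
  omega
theorem card_Cn (n : ℕ) : Nat.card (Cn n) = n := Nat.card_zmod n
theorem card_Dn (n : ℕ) : Nat.card (Dn n) = 2 * n := DihedralGroup.nat_card
theorem card_V4 : Nat.card V4 = 4 := by rw [Nat.card_prod, card_Cn]

/-! ### Verification of each row on a representative subgroup. -/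

section Rows

variable {E : Subgroup (Sn 4 × Sn 4)}

theorem groupRow_S3_S4 (hE : ∀ s t, (s, t) ∈ E ↔ FullPred (pointStab 0) ⊤ s t) :
    GroupRow E (Sn 3) (Sn 4) (Sn 3 × Sn 4) {24} :=
  groupRow_of_fullPred hE symHom_injective mem_pointStab_iff Function.injective_id mem_top_iff
    (by rw [card_Sn3, card_Sn4]) (by decide) (by decide +kernel)

theorem groupRow_S3_A4
    (hE : ∀ s t, (s, t) ∈ E ↔ FullPred (pointStab 0) (alternatingGroup (Fin 4)) s t) :
    GroupRow E (Sn 3) A4 (Sn 3 × A4) {24} :=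
  groupRow_of_fullPred hE symHom_injective mem_pointStab_iff (Subgroup.subtype_injective _)
    mem_alternating_iff
    (by rw [card_Sn3, card_A4]) (by decide) (by decide +kernel)

theorem groupRow_S3_D4 (hE : ∀ s t, (s, t) ∈ E ↔ FullPred (pointStab 0) (cent (rot4 * rot4)) s t) :
    GroupRow E (Sn 3) (Dn 4) (Sn 3 × Dn 4) {24} :=
  groupRow_of_fullPred hE symHom_injective mem_pointStab_iff d4Hom_injective mem_cent_rot4_sq_iff
    (by rw [card_Sn3, card_Dn]) (by decide) (by decide +kernel)

theorem groupRow_S3_C4 (hE : ∀ s t, (s, t) ∈ E ↔ FullPred (pointStab 0) (cent rot4) s t) :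
    GroupRow E (Sn 3) (Cn 4) (Sn 3 × Cn 4) {24} :=
  groupRow_of_fullPred hE symHom_injective mem_pointStab_iff c4Hom_injective mem_cent_rot4_iff
    (by rw [card_Sn3, card_Cn]) (by decide) (by decide +kernel)

theorem groupRow_S3_trans_V4 (hE : ∀ s t, (s, t) ∈ E ↔ FullPred (pointStab 0) klein s t) :
    GroupRow E (Sn 3) V4 (Sn 3 × V4) {24} :=
  groupRow_of_fullPred hE symHom_injective mem_pointStab_iff kleinTransHom_injective mem_klein_iff
    (by rw [card_Sn3, card_V4]) (by decide) (by decide +kernel)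

theorem groupRow_S3_intrans_V4
    (hE : ∀ s t, (s, t) ∈ E ↔ FullPred (pointStab 0) (cent (swap 0 1)) s t) :
    GroupRow E (Sn 3) V4 (Sn 3 × V4) {12, 12} :=
  groupRow_of_fullPred hE symHom_injective mem_pointStab_iff kleinIntransHom_injective
    mem_cent_swap_iff
    (by rw [card_Sn3, card_V4]) (by decide) (by decide +kernel)

theorem groupRow_S3_S3 (hE : ∀ s t, (s, t) ∈ E ↔ FullPred (pointStab 0) (pointStab 0) s t) :
    GroupRow E (Sn 3) (Sn 3) (Sn 3 × Sn 3) {18, 6} :=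
  groupRow_of_fullPred hE symHom_injective mem_pointStab_iff symHom_injective mem_pointStab_iff
    (by rw [card_Sn3]) (by decide) (by decide +kernel)

theorem groupRow_S3_C3 (hE : ∀ s t, (s, t) ∈ E ↔ FullPred (pointStab 0) (cent rot3) s t) :
    GroupRow E (Sn 3) (Cn 3) (Sn 3 × Cn 3) {18, 6} :=
  groupRow_of_fullPred hE symHom_injective mem_pointStab_iff c3Hom_injective mem_cent_rot3_iff
    (by rw [card_Sn3, card_Cn]) (by decide) (by decide +kernel)

theorem groupRow_C3_S4 (hE : ∀ s t, (s, t) ∈ E ↔ FullPred (cent rot3) ⊤ s t) :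
    GroupRow E (Cn 3) (Sn 4) (Cn 3 × Sn 4) {24} :=
  groupRow_of_fullPred hE c3Hom_injective mem_cent_rot3_iff Function.injective_id mem_top_iff
    (by rw [card_Cn, card_Sn4]) (by decide) (by decide +kernel)

theorem groupRow_C3_A4
    (hE : ∀ s t, (s, t) ∈ E ↔ FullPred (cent rot3) (alternatingGroup (Fin 4)) s t) :
    GroupRow E (Cn 3) A4 (Cn 3 × A4) {12, 12} :=
  groupRow_of_fullPred hE c3Hom_injective mem_cent_rot3_iff (Subgroup.subtype_injective _)
    mem_alternating_iff
    (by rw [card_Cn, card_A4]) (by decide) (by decide +kernel)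

theorem groupRow_C3_D4 (hE : ∀ s t, (s, t) ∈ E ↔ FullPred (cent rot3) (cent (rot4 * rot4)) s t) :
    GroupRow E (Cn 3) (Dn 4) (Cn 3 × Dn 4) {24} :=
  groupRow_of_fullPred hE c3Hom_injective mem_cent_rot3_iff d4Hom_injective mem_cent_rot4_sq_iff
    (by rw [card_Cn, card_Dn]) (by decide) (by decide +kernel)

theorem groupRow_C3_C4 (hE : ∀ s t, (s, t) ∈ E ↔ FullPred (cent rot3) (cent rot4) s t) :
    GroupRow E (Cn 3) (Cn 4) (Cn 3 × Cn 4) {12, 12} :=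
  groupRow_of_fullPred hE c3Hom_injective mem_cent_rot3_iff c4Hom_injective mem_cent_rot4_iff
    (by rw [card_Cn, card_Cn]) (by decide) (by decide +kernel)

theorem groupRow_C3_trans_V4 (hE : ∀ s t, (s, t) ∈ E ↔ FullPred (cent rot3) klein s t) :
    GroupRow E (Cn 3) V4 (Cn 3 × V4) {12, 12} :=
  groupRow_of_fullPred hE c3Hom_injective mem_cent_rot3_iff kleinTransHom_injective mem_klein_iff
    (by rw [card_Cn, card_V4]) (by decide) (by decide +kernel)

theorem groupRow_C3_intrans_V4
    (hE : ∀ s t, (s, t) ∈ E ↔ FullPred (cent rot3) (cent (swap 0 1)) s t) :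
    GroupRow E (Cn 3) V4 (Cn 3 × V4) {12, 12} :=
  groupRow_of_fullPred hE c3Hom_injective mem_cent_rot3_iff kleinIntransHom_injective
    mem_cent_swap_iff
    (by rw [card_Cn, card_V4]) (by decide) (by decide +kernel)

theorem groupRow_C3_S3 (hE : ∀ s t, (s, t) ∈ E ↔ FullPred (cent rot3) (pointStab 0) s t) :
    GroupRow E (Cn 3) (Sn 3) (Cn 3 × Sn 3) {18, 6} :=
  groupRow_of_fullPred hE c3Hom_injective mem_cent_rot3_iff symHom_injective mem_pointStab_iff
    (by rw [card_Cn, card_Sn3]) (by decide) (by decide +kernel)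

theorem groupRow_C3_C3 (hE : ∀ s t, (s, t) ∈ E ↔ FullPred (cent rot3) (cent rot3) s t) :
    GroupRow E (Cn 3) (Cn 3) (Cn 3 × Cn 3) {9, 9, 3, 3} :=
  groupRow_of_fullPred hE c3Hom_injective mem_cent_rot3_iff c3Hom_injective mem_cent_rot3_iff
    (by rw [card_Cn]) (by decide) (by decide +kernel)

theorem groupRow_graph_S3_S4 (hE : ∀ s t, (s, t) ∈ E ↔ GraphPred (pointStab 0) ⊤ s t) :
    GroupRow E (Sn 3) (Sn 4) (Sn 4) {12, 8, 4} :=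
  groupRow_of_graphPred hE symHom_injective (by decide +kernel) (ψ := MonoidHom.id _)
    Function.injective_id
    (by decide +kernel) (by decide +kernel) card_Sn4 (by decide) (by decide +kernel)

theorem groupRow_graph_S3_S3 (hE : ∀ s t, (s, t) ∈ E ↔ GraphPred (pointStab 0) (pointStab 0) s t) :
    GroupRow E (Sn 3) (Sn 3) (Sn 3) {6, 6, 3, 3, 3, 2, 1} :=
  groupRow_of_graphPred hE symHom_injective (by decide +kernel) symHom_injective
    (by decide +kernel) (by decide +kernel) card_Sn3 (by decide) (by decide +kernel)

theorem groupRow_graph_C3_A4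
    (hE : ∀ s t, (s, t) ∈ E ↔ GraphPred (cent rot3) (alternatingGroup (Fin 4)) s t) :
    GroupRow E (Cn 3) A4 A4 {12, 4, 4, 4} :=
  groupRow_of_graphPred hE c3Hom_injective (by decide +kernel) (Subgroup.subtype_injective _)
    -- Being an image of an element of `A4` is turned back into membership, which is decided by the
    -- sign.
    (by unfold GraphPred; simp only [← mem_alternating_iff]; decide +kernel)
    (by decide +kernel) card_A4 (by decide) (by decide +kernel)

theorem groupRow_graph_C3_C3 (hE : ∀ s t, (s, t) ∈ E ↔ GraphPred (cent rot3) (cent rot3) s t) :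
    GroupRow E (Cn 3) (Cn 3) (Cn 3) {3, 3, 3, 3, 3, 3, 3, 1, 1, 1} :=
  groupRow_of_graphPred hE c3Hom_injective (by decide +kernel) c3Hom_injective
    (by decide +kernel) (by decide +kernel) (card_Cn _) (by decide) (by decide +kernel)

/-- The group `(C₃ × A₄) ⋊ C₂` in `S₄ × S₄`. -/
def c3A4Hom : C3A4sdC2 →* Sn 4 × Sn 4 :=
  semidirectHom 2 _ _ (c3Hom.prodMap (alternatingGroup (Fin 4)).subtype) (swap 1 2, swap 0 1)
    (by decide) (by decide +kernel)

theorem groupRow_fiber_S4 (hE : ∀ s t, (s, t) ∈ E ↔ FiberPred ⊤ (alternatingGroup (Fin 4)) s t) :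
    GroupRow E (Sn 3) (Sn 4) C3A4sdC2 {12, 12} :=
  groupRow_of_fiberPred hE Function.injective_id mem_top_iff (by decide +kernel) c3A4Hom
    ((injective_iff_map_eq_one _).2 fun x => by
      obtain ⟨n, g⟩ := x
      revert n g
      simp only [SemidirectProduct.ext_iff]
      decide +kernel)
    (fun x => by
      obtain ⟨n, g⟩ := x
      revert n g
      decide +kernel)
    (e := 72) (by rw [SemidirectProduct.card, Nat.card_prod, card_Cn, card_Cn, card_A4])
    (by decide +kernel) (by decide) (by decide +kernel)

/-- The group `D₁₂` in `S₄ × S₄`. -/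
def d12Hom : Dn 12 →* Sn 4 × Sn 4 :=
  dihedralHom 12 (rot3, rot4) (swap 1 2, swap 0 2)
    (by decide +kernel) (by decide +kernel) (by decide +kernel)

theorem groupRow_fiber_D4_cyclic
    (hE : ∀ s t, (s, t) ∈ E ↔ FiberPred (cent (rot4 * rot4)) (cent rot4) s t) :
    GroupRow E (Sn 3) (Dn 4) (Dn 12) {12, 12} :=
  groupRow_of_fiberPred hE d4Hom_injective mem_cent_rot4_sq_iff (by decide +kernel) d12Hom
    ((injective_iff_map_eq_one _).2 (by decide +kernel))
    (by decide +kernel)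
    (e := 24) (by rw [card_Dn]) (by decide +kernel) (by decide) (by decide +kernel)

/-- The group `(C₃ × V₄) ⋊ C₂` in `S₄ × S₄`, with an intransitive group `V₄`. -/
def c3KleinIntransHom : C3V4sdC2 →* Sn 4 × Sn 4 :=
  semidirectHom 2 _ _ (c3Hom.prodMap (kleinHom (swap 0 2) (swap 1 3) (by decide) (by decide)
    (by unfold Commute SemiconjBy; decide))) (swap 1 2, swap 0 1 * swap 2 3)
    (by decide) (by decide +kernel)

/-- The two Klein subgroups of `D₄` are exchanged by an outer automorphism, so their fibre products
with `S₃` are isomorphic abstract groups. In `S₄` one is transitive and the other is not, and the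
orbits tell them apart. -/
theorem groupRow_fiber_D4_intrans
    (hE : ∀ s t, (s, t) ∈ E ↔ FiberPred (cent (rot4 * rot4)) (cent (swap 0 2)) s t) :
    GroupRow E (Sn 3) (Dn 4) C3V4sdC2 {24} :=
  groupRow_of_fiberPred hE d4Hom_injective mem_cent_rot4_sq_iff (by decide +kernel)
    c3KleinIntransHom
    ((injective_iff_map_eq_one _).2 fun x => by
      obtain ⟨n, g⟩ := x
      revert n g
      simp only [SemidirectProduct.ext_iff]
      decide +kernel)
    (fun x => by
      obtain ⟨n, g⟩ := x
      revert n g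
      decide +kernel)
    (e := 24) (by rw [SemidirectProduct.card, Nat.card_prod, card_Cn, card_Cn, card_V4])
    (by decide +kernel) (by decide) (by decide +kernel)

/-- The group `(C₃ × V₄) ⋊ C₂` in `S₄ × S₄`, with the transitive group `V₄`. -/
def c3KleinTransHom : C3V4sdC2 →* Sn 4 × Sn 4 :=
  semidirectHom 2 _ _ (c3Hom.prodMap kleinTransHom) (swap 1 2, swap 0 2)
    (by decide) (by decide +kernel)

theorem groupRow_fiber_D4_trans
    (hE : ∀ s t, (s, t) ∈ E ↔ FiberPred (cent (rot4 * rot4)) klein s t) :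
    GroupRow E (Sn 3) (Dn 4) C3V4sdC2 {12, 12} :=
  groupRow_of_fiberPred hE d4Hom_injective mem_cent_rot4_sq_iff (by decide +kernel) c3KleinTransHom
    ((injective_iff_map_eq_one _).2 fun x => by
      obtain ⟨n, g⟩ := x
      revert n g
      simp only [SemidirectProduct.ext_iff]
      decide +kernel)
    (fun x => by
      obtain ⟨n, g⟩ := x
      revert n g
      decide +kernel)
    (e := 24) (by rw [SemidirectProduct.card, Nat.card_prod, card_Cn, card_Cn, card_V4])
    (by decide +kernel) (by decide) (by decide +kernel)

/-- The group `C₃ ⋊ C₄` in `S₄ × S₄`. -/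
def c3C4Hom : C3sdC4 →* Sn 4 × Sn 4 :=
  semidirectHom 4 _ _ (c3Hom.prod 1) (swap 1 2, rot4) (by decide) (by decide +kernel)

theorem groupRow_fiber_C4
    (hE : ∀ s t, (s, t) ∈ E ↔ FiberPred (cent rot4) (alternatingGroup (Fin 4)) s t) :
    GroupRow E (Sn 3) (Cn 4) C3sdC4 {12, 12} :=
  groupRow_of_fiberPred hE c4Hom_injective mem_cent_rot4_iff (by decide +kernel) c3C4Hom
    ((injective_iff_map_eq_one _).2 fun x => by
      obtain ⟨n, g⟩ := x
      revert n g
      simp only [SemidirectProduct.ext_iff]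
      decide +kernel)
    (fun x => by
      obtain ⟨n, g⟩ := x
      revert n g
      decide +kernel)
    (e := 12) (by rw [SemidirectProduct.card, card_Cn, card_Cn])
    (by decide +kernel) (by decide) (by decide +kernel)

/-- The group `D₆` in `S₄ × S₄`, projecting onto the transitive group `V₄`. -/
def d6TransHom : Dn 6 →* Sn 4 × Sn 4 :=
  dihedralHom 6 (rot3, rot4 * rot4) (swap 1 2, swap 0 1 * swap 2 3)
    (by decide +kernel) (by decide +kernel) (by decide +kernel)

/-- Only the intersection of the two groups in `FiberPred` matters: `cent rot4` meets `klein` in the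
group generated by `rot4 * rot4`. -/
theorem groupRow_fiber_trans_V4 (hE : ∀ s t, (s, t) ∈ E ↔ FiberPred klein (cent rot4) s t) :
    GroupRow E (Sn 3) V4 (Dn 6) {12, 12} :=
  groupRow_of_fiberPred hE kleinTransHom_injective mem_klein_iff (by decide +kernel) d6TransHom
    ((injective_iff_map_eq_one _).2 (by decide +kernel))
    (by decide +kernel)
    (e := 12) (by rw [card_Dn]) (by decide +kernel) (by decide) (by decide +kernel)

/-- The group `D₆` in `S₄ × S₄`, with a rotation projecting to a transposition. -/
def d6SwapHom : Dn 6 →* Sn 4 × Sn 4 :=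
  dihedralHom 6 (rot3, swap 0 1) (swap 1 2, swap 2 3)
    (by decide +kernel) (by decide +kernel) (by decide +kernel)

/-- Here `pointStab 2` stands for its intersection with `cent (swap 0 1)`, the group generated by
`swap 0 1`. -/
theorem groupRow_fiber_intrans_V4_swap
    (hE : ∀ s t, (s, t) ∈ E ↔ FiberPred (cent (swap 0 1)) (pointStab 2) s t) :
    GroupRow E (Sn 3) V4 (Dn 6) {12, 6, 6} :=
  groupRow_of_fiberPred hE kleinIntransHom_injective mem_cent_swap_iff (by decide +kernel) d6SwapHom
    ((injective_iff_map_eq_one _).2 (by decide +kernel))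
    (by decide +kernel)
    (e := 12) (by rw [card_Dn]) (by decide +kernel) (by decide) (by decide +kernel)

/-- The group `D₆` in `S₄ × S₄`, with rotations projecting to even permutations. -/
def d6EvenHom : Dn 6 →* Sn 4 × Sn 4 :=
  dihedralHom 6 (rot3, swap 0 1 * swap 2 3) (swap 1 2, swap 0 1)
    (by decide +kernel) (by decide +kernel) (by decide +kernel)

theorem groupRow_fiber_intrans_V4_even
    (hE : ∀ s t, (s, t) ∈ E ↔ FiberPred (cent (swap 0 1)) (alternatingGroup (Fin 4)) s t) :
    GroupRow E (Sn 3) V4 (Dn 6) {6, 6, 6, 6} :=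
  groupRow_of_fiberPred hE kleinIntransHom_injective mem_cent_swap_iff (by decide +kernel) d6EvenHom
    ((injective_iff_map_eq_one _).2 (by decide +kernel))
    (by decide +kernel)
    (e := 12) (by rw [card_Dn]) (by decide +kernel) (by decide) (by decide +kernel)

/-- The group `(C₃ × C₃) ⋊ C₂` in `S₄ × S₄`. -/
def c3C3Hom : C3C3sdC2 →* Sn 4 × Sn 4 :=
  semidirectHom 2 _ _ (c3Hom.prodMap c3Hom) (swap 1 2, swap 1 2) (by decide) (by decide +kernel)

theorem groupRow_fiber_S3
    (hE : ∀ s t, (s, t) ∈ E ↔ FiberPred (pointStab 0) (alternatingGroup (Fin 4)) s t) :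
    GroupRow E (Sn 3) (Sn 3) C3C3sdC2 {9, 9, 3, 3} :=
  groupRow_of_fiberPred hE symHom_injective mem_pointStab_iff (by decide +kernel) c3C3Hom
    ((injective_iff_map_eq_one _).2 fun x => by
      obtain ⟨n, g⟩ := x
      revert n g
      simp only [SemidirectProduct.ext_iff]
      decide +kernel)
    (fun x => by
      obtain ⟨n, g⟩ := x
      revert n g
      decide +kernel)
    (e := 18) (by rw [SemidirectProduct.card, Nat.card_prod, card_Cn, card_Cn])
    (by decide +kernel) (by decide) (by decide +kernel)

/-- The isomorphism of `C₁₂` and `C₃ × C₄`. -/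
def c12Hom : Cn 12 →* Cn 3 × Cn 4 :=
  cyclicHom 12 (Multiplicative.ofAdd 1, Multiplicative.ofAdd 1) (by decide +kernel)

theorem c12Hom_injective : Function.Injective c12Hom :=
  (injective_iff_map_eq_one _).2 (by decide +kernel)

theorem nonempty_C3_prod_C4_mulEquiv : Nonempty (Cn 3 × Cn 4 ≃* Cn 12) := by
  have hc : Nat.card (Cn 12) = Nat.card (Cn 3 × Cn 4) := by
    rw [Nat.card_prod, card_Cn, card_Cn, card_Cn]
  exact ⟨(MulEquiv.ofBijective c12Hom
    ((Nat.bijective_iff_injective_and_card _).2 ⟨c12Hom_injective, hc⟩)).symm⟩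

theorem groupRow_C3_C4_cyclic
    (hE : ∀ s t, (s, t) ∈ E ↔ FullPred (cent rot3) (cent rot4) s t) :
    GroupRow E (Cn 3) (Cn 4) (Cn 12) {12, 12} := by
  have h := groupRow_C3_C4 hE
  obtain ⟨e⟩ := h.all
  obtain ⟨e'⟩ := nonempty_C3_prod_C4_mulEquiv
  exact ⟨h.fst, h.snd, ⟨e.trans e'⟩, h.zero, h.orbits⟩

end Rows

/-! ### Subgroups of `S₄` up to conjugation -/

section Conj

variable {G : Type*} [Group G]

/-- The subgroup `H` is conjugate to `K`. -/
def ConjTo (H K : Subgroup G) : Prop := ∃ c : G, ∀ t, t ∈ H ↔ c * t * c⁻¹ ∈ K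

theorem ConjTo.trans {H K L : Subgroup G} (h : ConjTo H K) (h' : ConjTo K L) : ConjTo H L := by
  obtain ⟨c, hc⟩ := h
  obtain ⟨d, hd⟩ := h'
  refine ⟨d * c, fun t => ?_⟩
  rw [hc, hd]
  simp only [mul_inv_rev, mul_assoc]

-- Both are Sylow `p`-subgroups, which are all conjugate.
open scoped Pointwise in
theorem conjTo_of_card_sylow [Finite G] {p : ℕ} [Fact p.Prime] {H K : Subgroup G}
    (hH : Nat.card H = p ^ (Nat.card G).factorization p)
    (hK : Nat.card K = p ^ (Nat.card G).factorization p) : ConjTo H K := by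
  obtain ⟨c, hc⟩ := MulAction.exists_smul_eq G (Sylow.ofCard H hH) (Sylow.ofCard K hK)
  have h : MulAut.conj c • H = K := congrArg Sylow.toSubgroup hc
  refine ⟨c, fun t => ?_⟩
  rw [← h, Subgroup.mem_pointwise_smul_iff_inv_smul_mem, ← map_inv, MulAut.smul_def,
    MulAut.conj_apply]
  group

theorem conjTo_of_le_of_card [Finite G] {H K : Subgroup G} (c : G)
    (h : ∀ t ∈ H, c * t * c⁻¹ ∈ K) (hc : Nat.card K ≤ Nat.card H) : ConjTo H K := by
  have hmem : ∀ t, c * t * c⁻¹ ∈ H.map (MulAut.conj c).toMonoidHom ↔ t ∈ H := fun t =>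
    Subgroup.mem_map_iff_mem (f := (MulAut.conj c).toMonoidHom) (MulAut.conj c).injective
  have hle : H.map (MulAut.conj c).toMonoidHom ≤ K := by
    rintro - ⟨t, ht, rfl⟩
    exact h t ht
  have hcard : Nat.card (H.map (MulAut.conj c).toMonoidHom) = Nat.card H :=
    Subgroup.card_map_of_injective (f := (MulAut.conj c).toMonoidHom) (MulAut.conj c).injective
  have heq := Subgroup.eq_of_le_of_card_ge hle (hcard ▸ hc)
  exact ⟨c, fun t => by rw [← hmem, heq]⟩

/-- On `H`, lying in `N` behaves like lying in a subgroup of index at most two. -/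
def IndexTwoRule (H N : Subgroup G) : Prop :=
  ∀ x ∈ H, ∀ y ∈ H, (x * y ∈ N ↔ (x ∈ N ↔ y ∈ N))

theorem indexTwoRule_of_card [Finite G] {H N : Subgroup G} (hle : N ≤ H)
    (hc : 2 * Nat.card N = Nat.card H) : IndexTwoRule H N := by
  intro x hx y hy
  have h1 : (N.subgroupOf H).index = 2 := by
    have h2 := (N.subgroupOf H).card_mul_index
    rw [Nat.card_congr (Subgroup.subgroupOfEquivOfLe hle).toEquiv, ← hc, mul_comm] at h2
    exact Nat.eq_of_mul_eq_mul_right Nat.card_pos h2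
  exact Subgroup.mul_mem_iff_of_index_two (a := ⟨x, hx⟩) (b := ⟨y, hy⟩) h1

theorem IndexTwoRule.pow_mul_pow_iff {H N K : Subgroup G} (hN : IndexTwoRule H N)
    (hK : IndexTwoRule H K) {u v : G} (hu : u ∈ H) (hv : v ∈ H) (h1 : u ∈ N ↔ u ∈ K)
    (h2 : v ∈ N ↔ v ∈ K) (i j : ℕ) : u ^ i * v ^ j ∈ N ↔ u ^ i * v ^ j ∈ K := by
  have key : ∀ w ∈ H, (w ∈ N ↔ w ∈ K) → ∀ k : ℕ, (w ^ k ∈ N ↔ w ^ k ∈ K) := by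
    intro w hw h k
    induction k with
    | zero => simp [one_mem]
    | succ k ih => rw [pow_succ, hN _ (pow_mem hw k) _ hw, hK _ (pow_mem hw k) _ hw, ih, h]
  rw [hN _ (pow_mem hu i) _ (pow_mem hv j), hK _ (pow_mem hu i) _ (pow_mem hv j),
    key u hu h1, key v hv h2]

/-- On `H`, membership in `N` behaves like the kernel of a homomorphism to a group of order two, so
it is determined by its values at the generators `u` and `v`. -/
theorem IndexTwoRule.mem_iff {H N K : Subgroup G} (hN : IndexTwoRule H N)
    (hK : IndexTwoRule H K) {u v : G} (hu : u ∈ H) (hv : v ∈ H) {m n : ℕ}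
    (hgen : ∀ t ∈ H, ∃ i : Fin m, ∃ j : Fin n, u ^ (i : ℕ) * v ^ (j : ℕ) = t)
    (h1 : u ∈ N ↔ u ∈ K) (h2 : v ∈ N ↔ v ∈ K) (t : G) (ht : t ∈ H) : t ∈ N ↔ t ∈ K := by
  obtain ⟨i, j, rfl⟩ := hgen t ht
  exact hN.pow_mul_pow_iff hK hu hv h1 h2 i j

theorem indexTwoRule_top (H : Subgroup G) : IndexTwoRule H ⊤ := fun _ _ _ _ => by simp

theorem IndexTwoRule.sq_mem {H N : Subgroup G} (hN : IndexTwoRule H N) {x : G} (hx : x ∈ H) :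
    x * x ∈ N := (hN x hx x hx).2 Iff.rfl

end Conj

theorem card_cent_rot4_sq : Nat.card (cent (rot4 * rot4)) = 8 := by
  obtain ⟨e⟩ := nonempty_mulEquiv_of_hom d4Hom d4Hom_injective _ mem_cent_rot4_sq_iff
  rw [Nat.card_congr e.toEquiv, card_Dn]

theorem card_cent_rot3 : Nat.card (cent rot3) = 3 := by
  obtain ⟨e⟩ := nonempty_mulEquiv_of_hom c3Hom c3Hom_injective _ mem_cent_rot3_iff
  rw [Nat.card_congr e.toEquiv, card_Cn]

theorem card_pointStab : Nat.card (pointStab 0) = 6 := by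
  obtain ⟨e⟩ := nonempty_mulEquiv_of_hom symHom symHom_injective _ mem_pointStab_iff
  rw [Nat.card_congr e.toEquiv, card_Sn3]

theorem factorization_two : (Nat.card (Sn 4)).factorization 2 = 3 := by
  rw [card_Sn4]; decide +kernel

theorem factorization_three : (Nat.card (Sn 4)).factorization 3 = 1 := by
  rw [card_Sn4]; decide +kernel

theorem indexTwoRule_cent_rot4 : IndexTwoRule (cent (rot4 * rot4)) (cent rot4) := by
  unfold IndexTwoRule; decide +kernel

theorem indexTwoRule_klein : IndexTwoRule (cent (rot4 * rot4)) klein := by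
  unfold IndexTwoRule; decide +kernel

theorem indexTwoRule_cent_swap : IndexTwoRule (cent (rot4 * rot4)) (cent (swap 0 2)) := by
  unfold IndexTwoRule; decide +kernel

theorem indexTwoRule_alternating (H : Subgroup (Sn 4)) :
    IndexTwoRule H (alternatingGroup (Fin 4)) := by
  intro x _ y _
  simp only [Perm.mem_alternatingGroup, map_mul]
  rcases Int.units_eq_one_or (Perm.sign x) with h | h <;>
    rcases Int.units_eq_one_or (Perm.sign y) with h' | h' <;> simp [h, h']

/-- The subgroups of index at most two of the dihedral group of order eight. -/
theorem IndexTwoRule.of_cent_rot4_sq {N : Subgroup (Sn 4)}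
    (hN : IndexTwoRule (cent (rot4 * rot4)) N) :
    (∀ t ∈ cent (rot4 * rot4), t ∈ N) ∨
    (∀ t ∈ cent (rot4 * rot4), t ∈ N ↔ t ∈ cent rot4) ∨
    (∀ t ∈ cent (rot4 * rot4), t ∈ N ↔ t ∈ cent (swap 0 2)) ∨
    (∀ t ∈ cent (rot4 * rot4), t ∈ N ↔ t ∈ klein) := by
  have hu : rot4 ∈ cent (rot4 * rot4) := by decide
  have hv : swap 0 2 ∈ cent (rot4 * rot4) := by decide
  have hgen : ∀ t ∈ cent (rot4 * rot4), ∃ i : Fin 4, ∃ j : Fin 2,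
      rot4 ^ (i : ℕ) * swap 0 2 ^ (j : ℕ) = t := by decide +kernel
  -- The four answers for the two generators correspond to the four homomorphisms from `D₄` to a
  -- group of order two.
  by_cases h1 : rot4 ∈ N <;> by_cases h2 : swap 0 2 ∈ N
  · left
    intro t ht
    exact (hN.mem_iff (indexTwoRule_top _) hu hv hgen (iff_of_true h1 trivial)
      (iff_of_true h2 trivial) t ht).2 trivial
  · exact Or.inr <| Or.inl <| hN.mem_iff indexTwoRule_cent_rot4 hu hv hgen
      (iff_of_true h1 (by decide)) (iff_of_false h2 (by decide))
  · exact Or.inr <| Or.inr <| Or.inl <| hN.mem_iff indexTwoRule_cent_swap hu hv hgen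
      (iff_of_false h1 (by decide)) (iff_of_true h2 (by decide))
  · exact Or.inr <| Or.inr <| Or.inr <| hN.mem_iff indexTwoRule_klein hu hv hgen
      (iff_of_false h1 (by decide)) (iff_of_false h2 (by decide))

/-- Such a group lies in a Sylow 2-subgroup, a conjugate of `D₄`, and has index two there; `D₄` has
just three subgroups of index two. -/
theorem conjTo_of_card_four {H : Subgroup (Sn 4)} (h : Nat.card H = 4) :
    ConjTo H (cent rot4) ∨ ConjTo H klein ∨ ConjTo H (cent (swap 0 1)) := by
  have : Fact (Nat.Prime 2) := ⟨Nat.prime_two⟩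
  obtain ⟨Q, hQ⟩ := (IsPGroup.of_card (p := 2) (n := 2) h).exists_le_sylow
  obtain ⟨c, hc⟩ : ConjTo (Q : Subgroup (Sn 4)) (cent (rot4 * rot4)) := by
    apply conjTo_of_card_sylow (p := 2)
    · exact Q.card_eq_multiplicity
    · rw [card_cent_rot4_sq, factorization_two]; rfl
  let N : Subgroup (Sn 4) := H.map (MulAut.conj c).toMonoidHom
  have hmem : ∀ t, c * t * c⁻¹ ∈ N ↔ t ∈ H := fun t =>
    Subgroup.mem_map_iff_mem (f := (MulAut.conj c).toMonoidHom) (MulAut.conj c).injective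
  have hcard : Nat.card N = 4 :=
    (Subgroup.card_map_of_injective (f := (MulAut.conj c).toMonoidHom)
      (MulAut.conj c).injective).trans h
  have hle : N ≤ cent (rot4 * rot4) := by
    rintro - ⟨t, ht, rfl⟩
    exact (hc t).1 (hQ ht)
  have key : ∀ {K : Subgroup (Sn 4)}, (∀ t, t ∈ K → t ∈ cent (rot4 * rot4)) →
      (∀ t ∈ cent (rot4 * rot4), t ∈ N ↔ t ∈ K) → ConjTo H K := fun {K} hK hNK =>
    ⟨c, fun t => by
      rw [← hmem]
      exact ⟨fun ht => (hNK _ (hle ht)).1 ht, fun ht => (hNK _ (hK _ ht)).2 ht⟩⟩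
  rcases (indexTwoRule_of_card hle (by rw [hcard, card_cent_rot4_sq])).of_cent_rot4_sq with
    h1 | h1 | h1 | h1
  · have := Subgroup.card_le_of_le (H := cent (rot4 * rot4)) (K := N) h1
    rw [hcard, card_cent_rot4_sq] at this
    omega
  · exact Or.inl (key (by decide +kernel) h1)
  -- Conjugation by `swap 1 2` takes `swap 0 2` to `swap 0 1`.
  · refine Or.inr (Or.inr ((key (by decide +kernel) h1).trans ⟨swap 1 2, ?_⟩))
    decide +kernel
  · exact Or.inr (Or.inl (key (by decide +kernel) h1))

theorem conjTo_of_card_three {H : Subgroup (Sn 4)} (h : Nat.card H = 3) :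
    ConjTo H (cent rot3) := by
  have : Fact (Nat.Prime 3) := ⟨Nat.prime_three⟩
  apply conjTo_of_card_sylow (p := 3)
  · rw [h, factorization_three]; rfl
  · rw [card_cent_rot3, factorization_three]; rfl

/-- A subgroup of order three has index two in `H`, hence is normal. Moved to the group generated by
`rot3`, it has the stabilizer of `0` as normalizer, and the orders agree. -/
theorem conjTo_of_card_six {H : Subgroup (Sn 4)} (h : Nat.card H = 6) :
    ConjTo H (pointStab 0) := by
  have : Fact (Nat.Prime 3) := ⟨Nat.prime_three⟩
  obtain ⟨⟨x, hxH⟩, hx⟩ := exists_prime_orderOf_dvd_card' (G := H) 3 (by rw [h]; norm_num)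
  rw [← Subgroup.orderOf_coe] at hx
  change orderOf x = 3 at hx
  have hle : Subgroup.zpowers x ≤ H := Subgroup.zpowers_le.2 hxH
  have hcard : Nat.card (Subgroup.zpowers x) = 3 := by rw [Nat.card_zpowers, hx]
  have hrule := indexTwoRule_of_card hle (by rw [hcard, h])
  obtain ⟨c, hc⟩ := conjTo_of_card_three hcard
  have hxz := Subgroup.mem_zpowers x
  have hx1 : c * x * c⁻¹ ≠ 1 := by
    intro h1
    rw [conj_eq_one_iff] at h1
    rw [h1, orderOf_one] at hx
    omega
  -- A permutation conjugating some 3-cycle of `{1, 2, 3}` to another one must fix `0`.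
  have hdec : ∀ z ∈ cent rot3, z ≠ 1 → ∀ k, k * z * k⁻¹ ∈ cent rot3 → k ∈ pointStab 0 := by
    decide +kernel
  refine conjTo_of_le_of_card c (fun k hk => ?_) (by rw [card_pointStab, h])
  refine hdec _ ((hc x).1 hxz) hx1 _ ?_
  have h1 : k * x * k⁻¹ ∈ Subgroup.zpowers x := by
    rw [hrule _ (H.mul_mem hk hxH) _ (H.inv_mem hk), hrule _ hk _ hxH, inv_mem_iff]
    simp [hxz]
  rw [hc] at h1
  convert h1 using 1
  group

theorem eq_alternatingGroup_of_card {H : Subgroup (Sn 4)} (h : Nat.card H = 12) :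
    H = alternatingGroup (Fin 4) := by
  apply Perm.eq_alternatingGroup_of_index_eq_two
  have h2 := H.card_mul_index
  rw [h, card_Sn4] at h2
  omega

theorem conjTo_cases {H : Subgroup (Sn 4)} (h : 3 ≤ Nat.card H) :
    ConjTo H ⊤ ∨ ConjTo H (alternatingGroup (Fin 4)) ∨ ConjTo H (cent (rot4 * rot4)) ∨
    ConjTo H (cent rot4) ∨ ConjTo H klein ∨ ConjTo H (cent (swap 0 1)) ∨
    ConjTo H (pointStab 0) ∨ ConjTo H (cent rot3) := by
  have hdvd : Nat.card H ∣ 24 := card_Sn4 ▸ H.card_subgroup_dvd_card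
  have hle : Nat.card H ≤ 24 := Nat.le_of_dvd (by norm_num) hdvd
  have hcases : Nat.card H = 3 ∨ Nat.card H = 4 ∨ Nat.card H = 6 ∨ Nat.card H = 8 ∨
      Nat.card H = 12 ∨ Nat.card H = 24 := by
    generalize Nat.card H = n at *
    interval_cases n <;> simp_all (decide := true)
  rcases hcases with h | h | h | h | h | h
  · have := conjTo_of_card_three h
    tauto
  · have := conjTo_of_card_four h
    tauto
  · have := conjTo_of_card_six h
    tauto
  · have : Fact (Nat.Prime 2) := ⟨Nat.prime_two⟩
    have : ConjTo H (cent (rot4 * rot4)) := by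
      apply conjTo_of_card_sylow (p := 2)
      · rw [h, factorization_two]; rfl
      · rw [card_cent_rot4_sq, factorization_two]; rfl
    tauto
  · have : ConjTo H (alternatingGroup (Fin 4)) :=
      ⟨1, fun t => by simp [eq_alternatingGroup_of_card h]⟩
    tauto
  · have : H = ⊤ := Subgroup.eq_top_of_card_eq _ (h.trans card_Sn4.symm)
    exact Or.inl ⟨1, fun t => by simp [this]⟩

/-! ### Subdirect products in `S₄ × S₄` -/

/-- The subgroup `E` projects onto `G` and onto `H`. -/
structure IsSubdirect (E : Subgroup (Sn 4 × Sn 4)) (G H : Subgroup (Sn 4)) : Prop where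
  fst : ∀ s, s ∈ G ↔ ∃ t, (s, t) ∈ E
  snd : ∀ t, t ∈ H ↔ ∃ s, (s, t) ∈ E

/-- The conjugate of a subgroup of `S₄ × S₄`. -/
def conjSub (w : Sn 4 × Sn 4) (E : Subgroup (Sn 4 × Sn 4)) : Subgroup (Sn 4 × Sn 4) :=
  E.map (MulAut.conj w).toMonoidHom

section Subdirect

variable {E : Subgroup (Sn 4 × Sn 4)} {G H : Subgroup (Sn 4)}

theorem mem_conjSub (w : Sn 4 × Sn 4) (s t : Sn 4) :
    (s, t) ∈ conjSub w E ↔ (w.1⁻¹ * s * w.1, w.2⁻¹ * t * w.2) ∈ E := by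
  have h : (s, t) = (MulAut.conj w).toMonoidHom (w.1⁻¹ * s * w.1, w.2⁻¹ * t * w.2) := by
    change (s, t) = w * (w.1⁻¹ * s * w.1, w.2⁻¹ * t * w.2) * w⁻¹
    refine Prod.ext ?_ ?_ <;> simp [mul_assoc]
  rw [h]
  exact Subgroup.mem_map_iff_mem (f := (MulAut.conj w).toMonoidHom) (MulAut.conj w).injective

theorem mem_conjSub_iff {w : Sn 4 × Sn 4} {p : Sn 4 → Sn 4 → Prop}
    (h : ∀ s t, (s, t) ∈ E ↔ p (w.1 * s * w.1⁻¹) (w.2 * t * w.2⁻¹)) (s t : Sn 4) :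
    (s, t) ∈ conjSub w E ↔ p s t := by
  rw [mem_conjSub, h]
  simp [mul_assoc]

theorem conjSub_one : conjSub 1 E = E := by
  ext ⟨s, t⟩
  simp [mem_conjSub]

theorem conjSub_conjSub (w v : Sn 4 × Sn 4) : conjSub w (conjSub v E) = conjSub (w * v) E := by
  ext ⟨s, t⟩
  simp [mem_conjSub, mul_assoc]

theorem IsSubdirect.mem_fst (hE : IsSubdirect E G H) {s t : Sn 4} (h : (s, t) ∈ E) : s ∈ G :=
  (hE.fst s).2 ⟨t, h⟩

theorem IsSubdirect.mem_snd (hE : IsSubdirect E G H) {s t : Sn 4} (h : (s, t) ∈ E) : t ∈ H :=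
  (hE.snd t).2 ⟨s, h⟩

theorem mul_mem_pair {s t s' t' : Sn 4} (h : (s, t) ∈ E) (h' : (s', t') ∈ E) :
    (s * s', t * t') ∈ E := E.mul_mem h h'

theorem inv_mem_pair {s t : Sn 4} (h : (s, t) ∈ E) : (s⁻¹, t⁻¹) ∈ E := E.inv_mem h

theorem pow_mem_pair {s t : Sn 4} (h : (s, t) ∈ E) (n : ℕ) : (s ^ n, t ^ n) ∈ E :=
  E.pow_mem h n

theorem IsSubdirect.mem_iff_fullPred (hE : IsSubdirect E G H) (h : ∀ s ∈ G, (s, 1) ∈ E)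
    (s t : Sn 4) : (s, t) ∈ E ↔ FullPred G H s t := by
  refine ⟨fun hst => ⟨hE.mem_fst hst, hE.mem_snd hst⟩, fun ⟨hs, ht⟩ => ?_⟩
  obtain ⟨s', hs'⟩ := (hE.snd t).1 ht
  have := mul_mem_pair (h _ (G.mul_mem hs (G.inv_mem (hE.mem_fst hs')))) hs'
  simpa using this

/-! #### The kernel of the second projection contains the even permutations -/

theorem IsSubdirect.even_mem (hE : IsSubdirect E (pointStab 0) H) {s : Sn 4} (hs : (s, 1) ∈ E)
    (hs1 : s ≠ 1) : ∀ s ∈ pointStab 0, Perm.sign s = 1 → (s, 1) ∈ E := by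
  -- The kernel is normal in `S₃`. A transposition yields `rot3` as a commutator with a suitable
  -- `u`, and a 3-cycle is `rot3` or has it as its square.
  have hdec : ∀ s ∈ pointStab 0, s ≠ 1 → ∃ u ∈ pointStab 0,
      s * (u * s⁻¹ * u⁻¹) = rot3 ∨ s = rot3 ∨ s * s = rot3 := by decide +kernel
  have hrot : (rot3, 1) ∈ E := by
    obtain ⟨u, hu, h⟩ := hdec s (hE.mem_fst hs) hs1
    obtain ⟨t, ht⟩ := (hE.fst u).1 hu
    rcases h with h | h | h <;> rw [← h]
    · simpa using mul_mem_pair hs (mul_mem_pair (mul_mem_pair ht (inv_mem_pair hs))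
        (inv_mem_pair ht))
    · exact hs
    · simpa using mul_mem_pair hs hs
  have hdec' : ∀ s ∈ pointStab 0, Perm.sign s = 1 → ∃ i : Fin 3, rot3 ^ (i : ℕ) = s := by
    decide +kernel
  intro s' h h'
  obtain ⟨i, rfl⟩ := hdec' s' h h'
  simpa using pow_mem_pair hrot i

/-- Goursat's lemma: when the kernel of the projection to `H` consists of the even permutations
fixing `0`, the sign of `s` is determined by `t`, and it is trivial exactly when `(1, t) ∈ E`. -/
theorem IsSubdirect.exists_fiberPred (hE : IsSubdirect E (pointStab 0) H)
    (heven : ∀ s ∈ pointStab 0, Perm.sign s = 1 → (s, 1) ∈ E)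
    (hodd : ∃ s ∈ pointStab 0, (s, 1) ∉ E) :
    ∃ N : Subgroup (Sn 4), IndexTwoRule H N ∧ (¬ ∀ t ∈ H, t ∈ N) ∧
      ∀ s t, (s, t) ∈ E ↔ FiberPred H N s t := by
  -- One odd element in the kernel, together with the even ones, would give all of them, against
  -- `hodd`.
  have hone : ∀ s, (s, 1) ∈ E → Perm.sign s = 1 := by
    intro s hs
    by_contra h
    obtain ⟨s', hs', hn⟩ := hodd
    apply hn
    have h0 : Perm.sign s' ≠ 1 := fun h' => hn (heven s' hs' h')
    have h1 : Perm.sign (s' * s⁻¹) = 1 := by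
      rw [map_mul, Perm.sign_inv, (Int.units_eq_one_or _).resolve_left h0,
        (Int.units_eq_one_or _).resolve_left h]
      rfl
    simpa using mul_mem_pair
      (heven _ (mul_mem hs' (inv_mem (hE.mem_fst hs))) h1) hs
  have hN : ∀ s t, (s, t) ∈ E → (Perm.sign s = 1 ↔ (1, t) ∈ E) := by
    intro s t hst
    constructor
    · intro h
      simpa using mul_mem_pair (inv_mem_pair (heven s (hE.mem_fst hst) h)) hst
    · intro h
      apply hone
      simpa using mul_mem_pair hst (inv_mem_pair h)
  refine ⟨E.comap (MonoidHom.inr _ _), ?_, ?_, ?_⟩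
  · intro x hx y hy
    obtain ⟨s, hs⟩ := (hE.snd x).1 hx
    obtain ⟨s', hs'⟩ := (hE.snd y).1 hy
    change (1, x * y) ∈ E ↔ ((1, x) ∈ E ↔ (1, y) ∈ E)
    rw [← hN _ _ hs, ← hN _ _ hs', ← hN _ _ (mul_mem_pair hs hs'), map_mul]
    rcases Int.units_eq_one_or (Perm.sign s) with h | h <;>
      rcases Int.units_eq_one_or (Perm.sign s') with h' | h' <;> simp [h, h']
  · intro hall
    obtain ⟨s, hs, hn⟩ := hodd
    obtain ⟨t, ht⟩ := (hE.fst s).1 hs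
    exact hn (heven s hs ((hN s t ht).2 (hall t (hE.mem_snd ht))))
  · intro s t
    refine ⟨fun h => ⟨hE.mem_fst h, hE.mem_snd h, hN s t h⟩, fun ⟨hs, ht, h⟩ => ?_⟩
    obtain ⟨s', hs'⟩ := (hE.snd t).1 ht
    have h1 : Perm.sign s = 1 ↔ Perm.sign s' = 1 := h.trans (hN s' t hs').symm
    have h2 : Perm.sign (s * s'⁻¹) = 1 := by
      rw [map_mul, Perm.sign_inv]
      rcases Int.units_eq_one_or (Perm.sign s) with h | h <;>
        rcases Int.units_eq_one_or (Perm.sign s') with h' | h' <;> simp_all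
    simpa using mul_mem_pair (heven _ (mul_mem hs (inv_mem (hE.mem_fst hs'))) h2) hs'

theorem fiberPred_iff {N K : Subgroup (Sn 4)} (h : ∀ s t, (s, t) ∈ E ↔ FiberPred H N s t)
    (hNK : ∀ t ∈ H, t ∈ N ↔ t ∈ K) (s t : Sn 4) : (s, t) ∈ E ↔ FiberPred H K s t := by
  rw [h]
  refine and_congr_right fun _ => and_congr_right fun ht => ?_
  rw [hNK t ht]

/-- Conjugating only the second coordinate by an element normalizing `H` lets `N` be replaced by a
conjugate. -/
theorem fiberPred_conj {N K : Subgroup (Sn 4)} (h : ∀ s t, (s, t) ∈ E ↔ FiberPred H N s t)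
    (c : Sn 4) (hH : ∀ t, t ∈ H ↔ c * t * c⁻¹ ∈ H) (hNK : ∀ t ∈ H, t ∈ N ↔ c * t * c⁻¹ ∈ K)
    (s t : Sn 4) : (s, t) ∈ conjSub (1, c) E ↔ FiberPred H K s t := by
  refine mem_conjSub_iff (fun s t => ?_) s t
  rw [h]
  simp only [FiberPred, one_mul, inv_one, mul_one]
  rw [← hH]
  refine and_congr_right fun _ => and_congr_right fun ht => ?_
  rw [hNK t ht]

/-! #### The second projection is injective -/

/-- With trivial kernel, `E` is the graph of a homomorphism from `H` onto `G`, sending `t` to the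
unique `s` with `(s, t) ∈ E`. The lemmas below work with this homomorphism. -/
theorem eq_of_mem_of_mem (htriv : ∀ s, (s, 1) ∈ E → s = 1) {s s' t : Sn 4} (h : (s, t) ∈ E)
    (h' : (s', t) ∈ E) : s = s' :=
  mul_inv_eq_one.1 (htriv _ (by simpa using mul_mem_pair h (inv_mem_pair h')))

theorem pow_eq_one_of_mem (htriv : ∀ s, (s, 1) ∈ E → s = 1) {s t : Sn 4} (h : (s, t) ∈ E) {n : ℕ}
    (ht : t ^ n = 1) : s ^ n = 1 :=
  htriv _ (ht ▸ pow_mem_pair h n)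

theorem IsSubdirect.pow_eq_one (hE : IsSubdirect E G H) (htriv : ∀ s, (s, 1) ∈ E → s = 1) {n : ℕ}
    (hH : ∀ t ∈ H, t ^ n = 1) {s : Sn 4} (hs : s ∈ G) : s ^ n = 1 := by
  obtain ⟨t, ht⟩ := (hE.fst s).1 hs
  exact pow_eq_one_of_mem htriv ht (hH t (hE.mem_snd ht))

/-- The homomorphism kills the Klein part of `H` by `hk`, and `u`, `v` generate `H` modulo that
part, so it is determined by the images `p` and `q`. -/
theorem IsSubdirect.eq_pow_mul_pow (hE : IsSubdirect E G H) (htriv : ∀ s, (s, 1) ∈ E → s = 1)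
    {u v : Sn 4} (hgen : ∀ t ∈ H, ∃ k ∈ klein, k ∈ H ∧
      ∃ i : Fin 3, ∃ j : Fin 2, k * (u ^ (i : ℕ) * v ^ (j : ℕ)) = t)
    (hk : ∀ k ∈ klein, k ∈ H → (1, k) ∈ E) {p q : Sn 4} (hp : (p, u) ∈ E) (hq : (q, v) ∈ E)
    {s t : Sn 4} (h : (s, t) ∈ E) : ∃ k ∈ klein, ∃ i : Fin 3, ∃ j : Fin 2,
      k * (u ^ (i : ℕ) * v ^ (j : ℕ)) = t ∧ p ^ (i : ℕ) * q ^ (j : ℕ) = s := by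
  obtain ⟨k, hk1, hk2, i, j, hij⟩ := hgen t (hE.mem_snd h)
  refine ⟨k, hk1, i, j, hij, eq_of_mem_of_mem htriv ?_ h⟩
  rw [← hij]
  simpa using mul_mem_pair (hk k hk1 hk2) (mul_mem_pair (pow_mem_pair hp i) (pow_mem_pair hq j))

/-- After conjugation by `d` the homomorphism sends `u` to `u` and `v` to `v`, so it is reduction
modulo the Klein group. Conversely a class modulo `klein` contains at most one element of `G`, as
`G` meets `klein` trivially. -/
theorem IsSubdirect.mem_conjSub_iff_graphPred (hE : IsSubdirect E G H)
    (htriv : ∀ s, (s, 1) ∈ E → s = 1)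
    {u v : Sn 4} (hgen : ∀ t ∈ H, ∃ k ∈ klein, k ∈ H ∧
      ∃ i : Fin 3, ∃ j : Fin 2, k * (u ^ (i : ℕ) * v ^ (j : ℕ)) = t)
    (hk : ∀ k ∈ klein, k ∈ H → (1, k) ∈ E) {p q : Sn 4} (hp : (p, u) ∈ E) (hq : (q, v) ∈ E)
    (d : Sn 4) (hdp : d * p * d⁻¹ = u) (hdq : d * q * d⁻¹ = v)
    (hd : ∀ s, s ∈ G ↔ d * s * d⁻¹ ∈ G) (hG : ∀ s ∈ G, s ∈ klein → s = 1) (s t : Sn 4) :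
    (s, t) ∈ conjSub (d, 1) E ↔ GraphPred G H s t := by
  have key : ∀ s t, (s, t) ∈ E → t * (d * s * d⁻¹)⁻¹ ∈ klein := by
    intro s t h
    obtain ⟨k, hk1, i, j, rfl, rfl⟩ := hE.eq_pow_mul_pow htriv hgen hk hp hq h
    rwa [← conj_mul, ← conj_pow, ← conj_pow, hdp, hdq, mul_inv_cancel_right]
  refine mem_conjSub_iff (fun s t => ?_) s t
  simp only [GraphPred, one_mul, inv_one, mul_one]
  rw [← hd]
  refine ⟨fun h => ⟨hE.mem_fst h, hE.mem_snd h, key s t h⟩, fun ⟨hs, ht, h⟩ => ?_⟩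
  obtain ⟨s', hs'⟩ := (hE.snd t).1 ht
  have h1 := klein.mul_mem (klein.inv_mem h) (key s' t hs')
  have h2 : (t * (d * s * d⁻¹)⁻¹)⁻¹ * (t * (d * s' * d⁻¹)⁻¹) = d * (s * s'⁻¹) * d⁻¹ := by group
  rw [h2] at h1
  have h3 := hG _ ((hd _).1 (G.mul_mem hs (G.inv_mem (hE.mem_fst hs')))) h1
  rw [conj_eq_one_iff, mul_inv_eq_one] at h3
  rwa [h3]

theorem IsSubdirect.exists_graphPred_pointStab (hE : IsSubdirect E (pointStab 0) H)
    (htriv : ∀ s, (s, 1) ∈ E → s = 1) (hr : rot3 ∈ H) (hv : swap 1 2 ∈ H)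
    (hgen : ∀ t ∈ H, ∃ k ∈ klein, k ∈ H ∧
      ∃ i : Fin 3, ∃ j : Fin 2, k * (rot3 ^ (i : ℕ) * swap 1 2 ^ (j : ℕ)) = t)
    (hsq : ∀ k ∈ klein, k ∈ H → ∃ u ∈ H, u * u = k ∧ u ^ 4 = 1) :
    ∃ w, ∀ s t, (s, t) ∈ conjSub w E ↔ GraphPred (pointStab 0) H s t := by
  have hk : ∀ k ∈ klein, k ∈ H → (1, k) ∈ E := by
    intro k hk1 hk2
    obtain ⟨u, hu, rfl, hu4⟩ := hsq k hk1 hk2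
    obtain ⟨s, hs⟩ := (hE.snd u).1 hu
    -- `S₃` has no element of order four, so squares of elements of order dividing four, among them
    -- all of `klein ∩ H`, map to `1`.
    have hdec : ∀ s ∈ pointStab 0, s ^ 4 = 1 → s * s = 1 := by decide +kernel
    have := mul_mem_pair hs hs
    rwa [hdec s (hE.mem_fst hs) (pow_eq_one_of_mem htriv hs hu4)] at this
  obtain ⟨p, hp⟩ := (hE.snd _).1 hr
  obtain ⟨q, hq⟩ := (hE.snd _).1 hv
  have hp3 : p ^ 3 = 1 := pow_eq_one_of_mem htriv hp (by decide)
  have hq2 : q ^ 2 = 1 := pow_eq_one_of_mem htriv hq (by decide)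
  have hsurj : ∀ s ∈ pointStab 0, ∃ i : Fin 3, ∃ j : Fin 2, p ^ (i : ℕ) * q ^ (j : ℕ) = s := by
    intro s hs
    obtain ⟨t, ht⟩ := (hE.fst s).1 hs
    obtain ⟨-, -, i, j, -, h⟩ := hE.eq_pow_mul_pow htriv hgen hk hp hq ht
    exact ⟨i, j, h⟩
  -- The pair `(p, q)` generates `S₃` with the same orders as `(rot3, swap 1 2)`, and the
  -- automorphisms of `S₃` are inner.
  have hdec : ∀ p ∈ pointStab 0, ∀ q ∈ pointStab 0, p ^ 3 = 1 → q ^ 2 = 1 →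
      (∀ s ∈ pointStab 0, ∃ i : Fin 3, ∃ j : Fin 2, p ^ (i : ℕ) * q ^ (j : ℕ) = s) →
      ∃ d, d * p * d⁻¹ = rot3 ∧ d * q * d⁻¹ = swap 1 2 ∧ d ∈ pointStab 0 := by decide +kernel
  obtain ⟨d, hdp, hdq, hd⟩ := hdec p (hE.mem_fst hp) q (hE.mem_fst hq) hp3 hq2 hsurj
  refine ⟨_, hE.mem_conjSub_iff_graphPred htriv hgen hk hp hq d hdp hdq (fun s => ?_)
    (by decide +kernel)⟩
  rw [Subgroup.mul_mem_cancel_right _ (inv_mem hd), Subgroup.mul_mem_cancel_left _ hd]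

theorem IsSubdirect.exists_graphPred_cent (hE : IsSubdirect E (cent rot3) H)
    (htriv : ∀ s, (s, 1) ∈ E → s = 1) (hr : rot3 ∈ H)
    (hgen : ∀ t ∈ H, ∃ k ∈ klein, k ∈ H ∧
      ∃ i : Fin 3, ∃ j : Fin 2, k * (rot3 ^ (i : ℕ) * 1 ^ (j : ℕ)) = t) :
    ∃ w, ∀ s t, (s, t) ∈ conjSub w E ↔ GraphPred (cent rot3) H s t := by
  have hk : ∀ k ∈ klein, k ∈ H → (1, k) ∈ E := by
    intro k hk1 hk2
    obtain ⟨s, hs⟩ := (hE.snd k).1 hk2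
    have hdec : ∀ s ∈ cent rot3, s ^ 2 = 1 → s = 1 := by decide +kernel
    have hdec' : ∀ s ∈ klein, s ^ 2 = 1 := by decide +kernel
    rwa [hdec s (hE.mem_fst hs) (pow_eq_one_of_mem htriv hs (hdec' k hk1))] at hs
  obtain ⟨p, hp⟩ := (hE.snd _).1 hr
  have hsurj : ∀ s ∈ cent rot3, ∃ i : Fin 3, p ^ (i : ℕ) = s := by
    intro s hs
    obtain ⟨t, ht⟩ := (hE.fst s).1 hs
    -- One generator is enough here; the identity fills the place of the second.
    obtain ⟨-, -, i, j, -, h⟩ := hE.eq_pow_mul_pow htriv hgen hk hp E.one_mem ht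
    exact ⟨i, by simpa using h⟩
  have hdec : ∀ p ∈ cent rot3, (∀ s ∈ cent rot3, ∃ i : Fin 3, p ^ (i : ℕ) = s) →
      ∃ d, d * p * d⁻¹ = rot3 ∧ ∀ s, s ∈ cent rot3 ↔ d * s * d⁻¹ ∈ cent rot3 := by
    decide +kernel
  obtain ⟨d, hdp, hd⟩ := hdec p (hE.mem_fst hp) hsurj
  exact ⟨_, hE.mem_conjSub_iff_graphPred htriv hgen hk hp E.one_mem d hdp (by simp) hd
    (by decide +kernel)⟩

end Subdirect

/-! ### Classification of the subdirect products -/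

/-- The rows for which the first projection is `S₃`. -/
def groupTableS3 (E : Subgroup (Sn 4 × Sn 4)) : Fin 19 → Prop := ![
  GroupRow E (Sn 3) (Sn 4) (Sn 3 × Sn 4) {24},
  GroupRow E (Sn 3) (Sn 4) C3A4sdC2 {12, 12},
  GroupRow E (Sn 3) (Sn 4) (Sn 4) {12, 8, 4},
  GroupRow E (Sn 3) A4 (Sn 3 × A4) {24},
  GroupRow E (Sn 3) (Dn 4) (Sn 3 × Dn 4) {24},
  GroupRow E (Sn 3) (Dn 4) (Dn 12) {12, 12},
  GroupRow E (Sn 3) (Dn 4) C3V4sdC2 {24},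
  GroupRow E (Sn 3) (Dn 4) C3V4sdC2 {12, 12},
  GroupRow E (Sn 3) (Cn 4) (Sn 3 × Cn 4) {24},
  GroupRow E (Sn 3) (Cn 4) C3sdC4 {12, 12},
  GroupRow E (Sn 3) V4 (Sn 3 × V4) {24},
  GroupRow E (Sn 3) V4 (Sn 3 × V4) {12, 12},
  GroupRow E (Sn 3) V4 (Dn 6) {12, 12},
  GroupRow E (Sn 3) V4 (Dn 6) {12, 6, 6},
  GroupRow E (Sn 3) V4 (Dn 6) {6, 6, 6, 6},
  GroupRow E (Sn 3) (Sn 3) (Sn 3 × Sn 3) {18, 6},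
  GroupRow E (Sn 3) (Sn 3) C3C3sdC2 {9, 9, 3, 3},
  GroupRow E (Sn 3) (Sn 3) (Sn 3) {6, 6, 3, 3, 3, 2, 1},
  GroupRow E (Sn 3) (Cn 3) (Sn 3 × Cn 3) {18, 6}]

/-- The rows for which the first projection is `C₃`. -/
def groupTableC3 (E : Subgroup (Sn 4 × Sn 4)) : Fin 9 → Prop := ![
  GroupRow E (Cn 3) (Sn 4) (Cn 3 × Sn 4) {24},
  GroupRow E (Cn 3) A4 (Cn 3 × A4) {12, 12},
  GroupRow E (Cn 3) A4 A4 {12, 4, 4, 4},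
  GroupRow E (Cn 3) (Dn 4) (Cn 3 × Dn 4) {24},
  GroupRow E (Cn 3) (Cn 4) (Cn 12) {12, 12},
  GroupRow E (Cn 3) V4 (Cn 3 × V4) {12, 12},
  GroupRow E (Cn 3) (Sn 3) (Cn 3 × Sn 3) {18, 6},
  GroupRow E (Cn 3) (Cn 3) (Cn 3 × Cn 3) {9, 9, 3, 3},
  GroupRow E (Cn 3) (Cn 3) (Cn 3) {3, 3, 3, 3, 3, 3, 3, 1, 1, 1}]

/-- Some conjugate of `E` has the property `P`. -/
def ExistsConj (P : Subgroup (Sn 4 × Sn 4) → Prop) (E : Subgroup (Sn 4 × Sn 4)) : Prop :=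
  ∃ w, P (conjSub w E)

section Classification

variable {E : Subgroup (Sn 4 × Sn 4)} {H N : Subgroup (Sn 4)}

theorem ExistsConj.of_self {P : Subgroup (Sn 4 × Sn 4) → Prop} (h : P E) : ExistsConj P E :=
  ⟨1, by rwa [conjSub_one]⟩

/-- Subdirect products of the stabilizer of a point and `H` are full, fibre products over the
group of order two, or graphs. -/
theorem IsSubdirect.cases_pointStab (hE : IsSubdirect E (pointStab 0) H) :
    (∀ s t, (s, t) ∈ E ↔ FullPred (pointStab 0) H s t) ∨
    (∃ N : Subgroup (Sn 4), IndexTwoRule H N ∧ (¬ ∀ t ∈ H, t ∈ N) ∧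
      ∀ s t, (s, t) ∈ E ↔ FiberPred H N s t) ∨
    ∀ s, (s, 1) ∈ E → s = 1 := by
  by_cases htriv : ∀ s, (s, 1) ∈ E → s = 1
  · exact Or.inr (Or.inr htriv)
  push Not at htriv
  obtain ⟨s, hs, hs1⟩ := htriv
  by_cases hfull : ∀ s ∈ pointStab 0, (s, 1) ∈ E
  · exact Or.inl (hE.mem_iff_fullPred hfull)
  push Not at hfull
  exact Or.inr (Or.inl (hE.exists_fiberPred (hE.even_mem hs hs1) hfull))

/-- The group has prime order, so a nontrivial kernel is everything and no fibre products arise. -/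
theorem IsSubdirect.cases_cent (hE : IsSubdirect E (cent rot3) H) :
    (∀ s t, (s, t) ∈ E ↔ FullPred (cent rot3) H s t) ∨ ∀ s, (s, 1) ∈ E → s = 1 := by
  by_cases htriv : ∀ s, (s, 1) ∈ E → s = 1
  · exact Or.inr htriv
  push Not at htriv
  obtain ⟨s, hs, hs1⟩ := htriv
  refine Or.inl (hE.mem_iff_fullPred fun s' hs' => ?_)
  have hdec : ∀ s ∈ cent rot3, s ≠ 1 → ∀ s' ∈ cent rot3, ∃ i : Fin 3, s ^ (i : ℕ) = s' := by
    decide +kernel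
  obtain ⟨i, rfl⟩ := hdec s (hE.mem_fst hs) hs1 s' hs'
  simpa using pow_mem_pair hs i

/-- A graph would make `S₃` a quotient of `H`, and quotients inherit the exponent. -/
theorem IsSubdirect.not_trivial_of_pow (hE : IsSubdirect E (pointStab 0) H) {n : ℕ}
    (hn : ¬ ∀ s ∈ pointStab 0, s ^ n = 1) (hH : ∀ t ∈ H, t ^ n = 1) :
    ¬ ∀ s, (s, 1) ∈ E → s = 1 :=
  fun htriv => hn fun _ hs => hE.pow_eq_one htriv hH hs

theorem IndexTwoRule.top (hN : IndexTwoRule ⊤ N) (hne : ¬ ∀ t ∈ (⊤ : Subgroup (Sn 4)), t ∈ N) :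
    N = alternatingGroup (Fin 4) := by
  apply Perm.eq_alternatingGroup_of_index_eq_two
  rw [Subgroup.index_eq_two_iff]
  push Not at hne
  obtain ⟨a, -, ha⟩ := hne
  refine ⟨a, fun b => ?_⟩
  rw [hN b trivial a trivial]
  by_cases hb : b ∈ N <;> simp [hb, ha, xor_def]

/-- Squares always lie in `N`, and every element of `A₄` is a product of two squares. -/
theorem IndexTwoRule.alternating (hN : IndexTwoRule (alternatingGroup (Fin 4)) N) :
    ∀ t ∈ alternatingGroup (Fin 4), t ∈ N := by
  have hdec : ∀ t ∈ alternatingGroup (Fin 4), ∃ u ∈ alternatingGroup (Fin 4),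
      ∃ v ∈ alternatingGroup (Fin 4), u * u * (v * v) = t := by decide +kernel
  intro t ht
  obtain ⟨u, hu, v, hv, rfl⟩ := hdec t ht
  exact N.mul_mem (hN.sq_mem hu) (hN.sq_mem hv)

theorem IndexTwoRule.cent_rot3 (hN : IndexTwoRule (cent rot3) N) : ∀ t ∈ cent rot3, t ∈ N := by
  have hdec : ∀ t ∈ cent rot3, ∃ u ∈ cent rot3, u * u = t := by decide +kernel
  intro t ht
  obtain ⟨u, hu, rfl⟩ := hdec t ht
  exact hN.sq_mem hu

theorem IndexTwoRule.cent_rot4 (hN : IndexTwoRule (cent rot4) N)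
    (hne : ¬ ∀ t ∈ cent rot4, t ∈ N) :
    ∀ t ∈ cent rot4, t ∈ N ↔ t ∈ alternatingGroup (Fin 4) := by
  have hu : rot4 ∈ cent rot4 := by decide
  have hgen : ∀ t ∈ cent rot4, ∃ i : Fin 4, ∃ j : Fin 2, rot4 ^ (i : ℕ) * 1 ^ (j : ℕ) = t := by
    decide +kernel
  have h1 : rot4 ∉ N := fun h => hne fun t ht => (hN.mem_iff (indexTwoRule_top _) hu
    (one_mem _) hgen (iff_of_true h trivial) (iff_of_true (one_mem _) trivial) t ht).2 trivial
  exact hN.mem_iff (indexTwoRule_alternating _) hu (one_mem _) hgen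
    (iff_of_false h1 (by decide)) (iff_of_true (one_mem _) (one_mem _))

theorem IndexTwoRule.pointStab (hN : IndexTwoRule (pointStab 0) N)
    (hne : ¬ ∀ t ∈ pointStab 0, t ∈ N) :
    ∀ t ∈ pointStab 0, t ∈ N ↔ t ∈ alternatingGroup (Fin 4) := by
  have hu : rot3 ∈ QuarticIntersection.pointStab 0 := by decide
  have hv : swap 1 2 ∈ QuarticIntersection.pointStab 0 := by decide
  have hgen : ∀ t ∈ QuarticIntersection.pointStab 0, ∃ i : Fin 3, ∃ j : Fin 2,
      rot3 ^ (i : ℕ) * swap 1 2 ^ (j : ℕ) = t := by decide +kernel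
  -- `rot3` is its own fourth power, hence a square; only the transposition is left to decide.
  have h1 : rot3 ∈ N := by
    have := hN.sq_mem (mul_mem hu hu)
    rwa [show rot3 * rot3 * (rot3 * rot3) = rot3 by decide] at this
  have h2 : swap 1 2 ∉ N := fun h => hne fun t ht => (hN.mem_iff (indexTwoRule_top _) hu
    hv hgen (iff_of_true h1 trivial) (iff_of_true h trivial) t ht).2 trivial
  exact hN.mem_iff (indexTwoRule_alternating _) hu hv hgen
    (iff_of_true h1 (by decide)) (iff_of_false h2 (by decide))

/-- The subgroups of index two of the transitive Klein four group are conjugate. -/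
theorem IndexTwoRule.klein (hN : IndexTwoRule klein N) (hne : ¬ ∀ t ∈ klein, t ∈ N) :
    ∃ c : Sn 4, (∀ t, t ∈ QuarticIntersection.klein ↔ c * t * c⁻¹ ∈ QuarticIntersection.klein) ∧
      ∀ t ∈ QuarticIntersection.klein, t ∈ N ↔ c * t * c⁻¹ ∈ cent rot4 := by
  have hu : rot4 * rot4 ∈ QuarticIntersection.klein := by decide
  have hv : swap 0 1 * swap 2 3 ∈ QuarticIntersection.klein := by decide
  have hgen : ∀ t ∈ QuarticIntersection.klein, ∃ i : Fin 2, ∃ j : Fin 2,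
      (rot4 * rot4) ^ (i : ℕ) * (swap 0 1 * swap 2 3) ^ (j : ℕ) = t := by decide +kernel
  -- The stabilizer of `0` normalizes the Klein group and permutes its three involutions
  -- transitively; `c` is chosen to carry the involution in `N` to `rot4 * rot4`.
  have key : ∀ c ∈ QuarticIntersection.pointStab 0,
      IndexTwoRule QuarticIntersection.klein (cent (c⁻¹ * rot4 * c)) ∧
      (∀ t, t ∈ QuarticIntersection.klein ↔ c * t * c⁻¹ ∈ QuarticIntersection.klein) ∧
      ∀ t, t ∈ cent (c⁻¹ * rot4 * c) ↔ c * t * c⁻¹ ∈ cent rot4 := by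
    unfold IndexTwoRule
    decide +kernel
  have main : ∀ c ∈ QuarticIntersection.pointStab 0,
      (rot4 * rot4 ∈ N ↔ rot4 * rot4 ∈ cent (c⁻¹ * rot4 * c)) →
      (swap 0 1 * swap 2 3 ∈ N ↔ swap 0 1 * swap 2 3 ∈ cent (c⁻¹ * rot4 * c)) →
      ∃ c : Sn 4, (∀ t, t ∈ QuarticIntersection.klein ↔ c * t * c⁻¹ ∈ QuarticIntersection.klein) ∧
      ∀ t ∈ QuarticIntersection.klein, t ∈ N ↔ c * t * c⁻¹ ∈ cent rot4 := by
    intro c hc h1 h2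
    obtain ⟨hk1, hk2, hk3⟩ := key c hc
    refine ⟨c, hk2, fun t ht => ?_⟩
    rw [hN.mem_iff hk1 hu hv hgen h1 h2 t ht, hk3]
  by_cases h1 : rot4 * rot4 ∈ N <;> by_cases h2 : swap 0 1 * swap 2 3 ∈ N
  · exact absurd (fun t ht => (hN.mem_iff (indexTwoRule_top _) hu hv hgen (iff_of_true h1 trivial)
      (iff_of_true h2 trivial) t ht).2 trivial) hne
  · exact main 1 (by decide) (iff_of_true h1 (by decide)) (iff_of_false h2 (by decide))
  · exact main (swap 1 2) (by decide) (iff_of_false h1 (by decide)) (iff_of_true h2 (by decide))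
  · exact main (swap 2 3) (by decide) (iff_of_false h1 (by decide)) (iff_of_false h2 (by decide))

/-- The subgroups of index two of the intransitive Klein four group up to conjugation. -/
theorem IndexTwoRule.cent_swap (hN : IndexTwoRule (cent (swap 0 1)) N)
    (hne : ¬ ∀ t ∈ cent (swap 0 1), t ∈ N) :
    (∀ t ∈ cent (swap 0 1), t ∈ N ↔ t ∈ alternatingGroup (Fin 4)) ∨
    ∃ c : Sn 4, (∀ t, t ∈ cent (swap 0 1) ↔ c * t * c⁻¹ ∈ cent (swap 0 1)) ∧
      ∀ t ∈ cent (swap 0 1), t ∈ N ↔ c * t * c⁻¹ ∈ QuarticIntersection.pointStab 2 := by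
  have hu : swap 0 1 ∈ cent (swap 0 1) := by decide
  have hv : swap 2 3 ∈ cent (swap 0 1) := by decide
  have hgen : ∀ t ∈ cent (swap 0 1), ∃ i : Fin 2, ∃ j : Fin 2,
      swap 0 1 ^ (i : ℕ) * swap 2 3 ^ (j : ℕ) = t := by decide +kernel
  have hrule2 : IndexTwoRule (cent (swap 0 1)) (QuarticIntersection.pointStab 2) := by
    unfold IndexTwoRule; decide +kernel
  have hrule0 : IndexTwoRule (cent (swap 0 1)) (QuarticIntersection.pointStab 0) := by
    unfold IndexTwoRule; decide +kernel
  by_cases h1 : swap 0 1 ∈ N <;> by_cases h2 : swap 2 3 ∈ N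
  · exact absurd (fun t ht => (hN.mem_iff (indexTwoRule_top _) hu hv hgen (iff_of_true h1 trivial)
      (iff_of_true h2 trivial) t ht).2 trivial) hne
  · refine Or.inr ⟨1, fun t => by simp, fun t ht => ?_⟩
    rw [one_mul, inv_one, mul_one]
    exact hN.mem_iff hrule2 hu hv hgen (iff_of_true h1 (by decide)) (iff_of_false h2 (by decide))
      t ht
  -- This permutation exchanges `swap 0 1` and `swap 2 3`, reducing to the previous case.
  · refine Or.inr ⟨swap 0 2 * swap 1 3, by decide +kernel, fun t ht => ?_⟩
    rw [hN.mem_iff hrule0 hu hv hgen (iff_of_false h1 (by decide)) (iff_of_true h2 (by decide))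
      t ht]
    revert t
    decide +kernel
  · exact Or.inl (hN.mem_iff (indexTwoRule_alternating _) hu hv hgen
      (iff_of_false h1 (by decide)) (iff_of_false h2 (by decide)))

theorem IsSubdirect.existsConj_S3 (hE : IsSubdirect E (pointStab 0) H)
    (hH : H = ⊤ ∨ H = alternatingGroup (Fin 4) ∨ H = cent (rot4 * rot4) ∨
      H = cent rot4 ∨ H = klein ∨ H = cent (swap 0 1) ∨ H = pointStab 0 ∨ H = cent rot3) :
    ExistsConj (fun E => ∃ i, groupTableS3 E i) E := by
  -- The exponents of the 2-groups and of `C₃` exclude a surjection onto `S₃`.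
  have h4 : ¬ ∀ s ∈ pointStab 0, s ^ 4 = 1 := by decide
  have h3 : ¬ ∀ s ∈ pointStab 0, s ^ 3 = 1 := by decide
  rcases hH with rfl | rfl | rfl | rfl | rfl | rfl | rfl | rfl <;>
    rcases hE.cases_pointStab with h | ⟨N, hN, hne, h⟩ | h
  · exact .of_self ⟨0, groupRow_S3_S4 h⟩
  · obtain rfl := hN.top hne
    exact .of_self ⟨1, groupRow_fiber_S4 h⟩
  · obtain ⟨w, hw⟩ := hE.exists_graphPred_pointStab h trivial trivial (by decide +kernel)
      (by decide +kernel)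
    exact ⟨w, 2, groupRow_graph_S3_S4 hw⟩
  · exact .of_self ⟨3, groupRow_S3_A4 h⟩
  · exact absurd hN.alternating hne
  -- Elements of `A₄` are products of squares, so a homomorphism to `S₃` takes only even values and
  -- misses `swap 1 2`.
  · exfalso
    have hdec : ∀ t ∈ alternatingGroup (Fin 4), ∃ u ∈ alternatingGroup (Fin 4),
        ∃ v ∈ alternatingGroup (Fin 4), u * u * (v * v) = t := by decide +kernel
    obtain ⟨t, ht⟩ := (hE.fst (swap 1 2)).1 (by decide)
    obtain ⟨u, hu, v, hv, rfl⟩ := hdec t (hE.mem_snd ht)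
    obtain ⟨s, hs⟩ := (hE.snd u).1 hu
    obtain ⟨s', hs'⟩ := (hE.snd v).1 hv
    have h1 := eq_of_mem_of_mem h ht
      (mul_mem_pair (mul_mem_pair hs hs) (mul_mem_pair hs' hs'))
    have h2 := congrArg Perm.sign h1
    rw [map_mul, map_mul, map_mul, Int.units_mul_self, Int.units_mul_self] at h2
    exact absurd h2 (by decide)
  · exact .of_self ⟨4, groupRow_S3_D4 h⟩
  · rcases hN.of_cent_rot4_sq with h1 | h1 | h1 | h1
    · exact absurd h1 hne
    · exact .of_self ⟨5, groupRow_fiber_D4_cyclic (fiberPred_iff h h1)⟩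
    · exact .of_self ⟨6, groupRow_fiber_D4_intrans (fiberPred_iff h h1)⟩
    · exact .of_self ⟨7, groupRow_fiber_D4_trans (fiberPred_iff h h1)⟩
  · exact absurd h (hE.not_trivial_of_pow h4 (by decide +kernel))
  · exact .of_self ⟨8, groupRow_S3_C4 h⟩
  · exact .of_self ⟨9, groupRow_fiber_C4 (fiberPred_iff h (hN.cent_rot4 hne))⟩
  · exact absurd h (hE.not_trivial_of_pow h4 (by decide +kernel))
  · exact .of_self ⟨10, groupRow_S3_trans_V4 h⟩
  · obtain ⟨c, hc, hc'⟩ := hN.klein hne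
    exact ⟨_, 12, groupRow_fiber_trans_V4 (fiberPred_conj h c hc hc')⟩
  · exact absurd h (hE.not_trivial_of_pow h4 (by decide +kernel))
  · exact .of_self ⟨11, groupRow_S3_intrans_V4 h⟩
  · rcases hN.cent_swap hne with h1 | ⟨c, hc, hc'⟩
    · exact .of_self ⟨14, groupRow_fiber_intrans_V4_even (fiberPred_iff h h1)⟩
    · exact ⟨_, 13, groupRow_fiber_intrans_V4_swap (fiberPred_conj h c hc hc')⟩
  · exact absurd h (hE.not_trivial_of_pow h4 (by decide +kernel))
  · exact .of_self ⟨15, groupRow_S3_S3 h⟩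
  · exact .of_self ⟨16, groupRow_fiber_S3 (fiberPred_iff h (hN.pointStab hne))⟩
  · obtain ⟨w, hw⟩ := hE.exists_graphPred_pointStab h (by decide) (by decide) (by decide +kernel)
      (by decide +kernel)
    exact ⟨w, 17, groupRow_graph_S3_S3 hw⟩
  · exact .of_self ⟨18, groupRow_S3_C3 h⟩
  · exact absurd hN.cent_rot3 hne
  · exact absurd h (hE.not_trivial_of_pow h3 (by decide +kernel))

/-- Involutions die in `C₃`, so a group in which every element is a product of two elements of order
dividing two, such as `S₄` or `S₃`, cannot map onto it. -/
theorem IsSubdirect.not_trivial_of_involutions (hE : IsSubdirect E (cent rot3) H)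
    (hH : ∀ t ∈ H, ∃ u ∈ H, ∃ v ∈ H, u ^ 2 = 1 ∧ v ^ 2 = 1 ∧ u * v = t) :
    ¬ ∀ s, (s, 1) ∈ E → s = 1 := by
  intro h
  obtain ⟨t, ht⟩ := (hE.fst rot3).1 (by decide)
  obtain ⟨u, hu, v, hv, hu2, hv2, rfl⟩ := hH t (hE.mem_snd ht)
  obtain ⟨s, hs⟩ := (hE.snd u).1 hu
  obtain ⟨s', hs'⟩ := (hE.snd v).1 hv
  have hdec : ∀ s ∈ cent rot3, s ^ 2 = 1 → s = 1 := by decide +kernel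
  have h1 := hdec s (hE.mem_fst hs) (pow_eq_one_of_mem h hs hu2)
  have h2 := hdec s' (hE.mem_fst hs') (pow_eq_one_of_mem h hs' hv2)
  have h3 := eq_of_mem_of_mem h ht (mul_mem_pair hs hs')
  rw [h1, h2] at h3
  exact absurd h3 (by decide)

theorem IsSubdirect.existsConj_C3 (hE : IsSubdirect E (cent rot3) H)
    (hH : H = ⊤ ∨ H = alternatingGroup (Fin 4) ∨ H = cent (rot4 * rot4) ∨
      H = cent rot4 ∨ H = klein ∨ H = cent (swap 0 1) ∨ H = pointStab 0 ∨ H = cent rot3) :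
    ExistsConj (fun E => ∃ i, groupTableC3 E i) E := by
  have h4 : (∀ t ∈ H, t ^ 4 = 1) → ¬ ∀ s, (s, 1) ∈ E → s = 1 := by
    intro hH h
    have := hE.pow_eq_one h hH (s := rot3) (by decide)
    exact absurd this (by decide)
  rcases hH with rfl | rfl | rfl | rfl | rfl | rfl | rfl | rfl <;>
    rcases hE.cases_cent with h | h
  · exact .of_self ⟨0, groupRow_C3_S4 h⟩
  · exact absurd h (hE.not_trivial_of_involutions (by decide +kernel))
  · exact .of_self ⟨1, groupRow_C3_A4 h⟩
  · obtain ⟨w, hw⟩ := hE.exists_graphPred_cent h (by decide) (by decide +kernel)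
    exact ⟨w, 2, groupRow_graph_C3_A4 hw⟩
  · exact .of_self ⟨3, groupRow_C3_D4 h⟩
  · exact absurd h (h4 (by decide +kernel))
  · exact .of_self ⟨4, groupRow_C3_C4_cyclic h⟩
  · exact absurd h (h4 (by decide +kernel))
  · exact .of_self ⟨5, groupRow_C3_trans_V4 h⟩
  · exact absurd h (h4 (by decide +kernel))
  -- Unlike for `S₃`, both kinds of Klein group give the same row.
  · exact .of_self ⟨5, groupRow_C3_intrans_V4 h⟩
  · exact absurd h (h4 (by decide +kernel))
  · exact .of_self ⟨6, groupRow_C3_S3 h⟩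
  · exact absurd h (hE.not_trivial_of_involutions (by decide +kernel))
  · exact .of_self ⟨7, groupRow_C3_C3 h⟩
  · obtain ⟨w, hw⟩ := hE.exists_graphPred_cent h (by decide) (by decide +kernel)
    exact ⟨w, 8, groupRow_graph_C3_C3 hw⟩

/-- The coordinates can be conjugated independently, so both projections may be assumed to be the
standard groups. -/
theorem existsConj_of_isSubdirect {P : Subgroup (Sn 4 × Sn 4) → Prop} {G : Subgroup (Sn 4)}
    (hG : ConjTo (E.map (MonoidHom.fst _ _)) G) (hH : 3 ≤ Nat.card (E.map (MonoidHom.snd _ _)))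
    (h : ∀ E H, IsSubdirect E G H → (H = ⊤ ∨ H = alternatingGroup (Fin 4) ∨
      H = cent (rot4 * rot4) ∨ H = cent rot4 ∨ H = klein ∨ H = cent (swap 0 1) ∨
      H = pointStab 0 ∨ H = cent rot3) → ExistsConj P E) : ExistsConj P E := by
  obtain ⟨c, hc⟩ := hG
  have key : ∀ K, ConjTo (E.map (MonoidHom.snd _ _)) K → (K = ⊤ ∨ K = alternatingGroup (Fin 4) ∨
      K = cent (rot4 * rot4) ∨ K = cent rot4 ∨ K = klein ∨ K = cent (swap 0 1) ∨
      K = pointStab 0 ∨ K = cent rot3) → ExistsConj P E := by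
    rintro K ⟨d, hd⟩ hK
    obtain ⟨w, hw⟩ := h (conjSub (c, d) E) K
      ⟨fun s => by
        have := hc (c⁻¹ * s * c)
        rw [show c * (c⁻¹ * s * c) * c⁻¹ = s by group] at this
        rw [← this]
        simp only [mem_conjSub]
        constructor
        · rintro ⟨⟨s', t⟩, ht, rfl : s' = _⟩
          exact ⟨d * t * d⁻¹, by simpa [mul_assoc] using ht⟩
        · rintro ⟨t, ht⟩
          exact ⟨_, ht, rfl⟩, fun t => by
        have := hd (d⁻¹ * t * d)
        rw [show d * (d⁻¹ * t * d) * d⁻¹ = t by group] at this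
        rw [← this]
        simp only [mem_conjSub]
        constructor
        · rintro ⟨⟨s, t'⟩, ht, rfl : t' = _⟩
          exact ⟨c * s * c⁻¹, by simpa [mul_assoc] using ht⟩
        · rintro ⟨s, hs⟩
          exact ⟨_, hs, rfl⟩⟩ hK
    rw [conjSub_conjSub] at hw
    exact ⟨_, hw⟩
  rcases conjTo_cases hH with h | h | h | h | h | h | h | h <;> exact key _ h (by simp)

end Classification

/-! ### Existence of a row -/

theorem card_sd {n : ℕ} {N : Type} [Group N] {θ : MulAut N} {h : θ ^ n = 1} :
    Nat.card (N ⋊[cyclicAction n θ h] Cn n) = Nat.card N * n := by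
  rw [SemidirectProduct.card, card_Cn]

section Existence

variable {M : Type*} [Field M] {f g : M[X]} {x y : Fin 4 → AlgebraicClosure M}
  {A B G : Type} [Group A] [Group B] [Group G] {d : Multiset ℕ}

theorem GroupRow.card_pos {E : Subgroup (Sn 4 × Sn 4)} (h : GroupRow E A B G d) :
    0 < Nat.card G := by
  obtain ⟨e⟩ := h.all
  rw [← Nat.card_congr e.toEquiv]
  exact Nat.card_pos

theorem GroupRow.row_trivial [Infinite M] (hx : IsRootOrdering f x) (hy : IsRootOrdering g y)
    (hf : f.Separable) (hg : g.Separable)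
    (ρ : (AlgebraicClosure M ≃ₐ[M] AlgebraicClosure M) →* Sn 4 × Sn 4)
    (hρx : ∀ σ i, σ (x i) = x ((ρ σ).1 i)) (hρy : ∀ σ i, σ (y i) = y ((ρ σ).2 i))
    (h : GroupRow ρ.range A B G d)
    (he : Nat.card G = Nat.card A * Nat.card B) : Row f g A B G InterTrivial d :=
  h.row hx hy hf hg ρ hρx hρy fun L L' _ _ h1 _ _ _ =>
    interTrivial_of_card he h.card_pos L L' h1

theorem GroupRow.row_quadratic [Infinite M] (hx : IsRootOrdering f x) (hy : IsRootOrdering g y)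
    (hf : f.Separable) (hg : g.Separable)
    (ρ : (AlgebraicClosure M ≃ₐ[M] AlgebraicClosure M) →* Sn 4 × Sn 4)
    (hρx : ∀ σ i, σ (x i) = x ((ρ σ).1 i)) (hρy : ∀ σ i, σ (y i) = y ((ρ σ).2 i))
    (h : GroupRow ρ.range A B G d)
    (he : 2 * Nat.card G = Nat.card A * Nat.card B) : Row f g A B G InterQuadratic d :=
  h.row hx hy hf hg ρ hρx hρy fun L L' _ _ h1 _ _ _ =>
    interQuadratic_of_card he h.card_pos L L' h1

theorem GroupRow.row_le [Infinite M] (hx : IsRootOrdering f x) (hy : IsRootOrdering g y)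
    (hf : f.Separable) (hg : g.Separable)
    (ρ : (AlgebraicClosure M ≃ₐ[M] AlgebraicClosure M) →* Sn 4 × Sn 4)
    (hρx : ∀ σ i, σ (x i) = x ((ρ σ).1 i)) (hρy : ∀ σ i, σ (y i) = y ((ρ σ).2 i))
    (h : GroupRow ρ.range A B G d)
    (he : Nat.card G = Nat.card B) : Row f g A B G (· ≤ ·) d :=
  h.row hx hy hf hg ρ hρx hρy fun L L' _ _ _ h2 _ h4 =>
    le_of_finrank_sup L L' (by rw [h2, h4, he])

theorem GroupRow.row_eq [Infinite M] (hx : IsRootOrdering f x) (hy : IsRootOrdering g y)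
    (hf : f.Separable) (hg : g.Separable)
    (ρ : (AlgebraicClosure M ≃ₐ[M] AlgebraicClosure M) →* Sn 4 × Sn 4)
    (hρx : ∀ σ i, σ (x i) = x ((ρ σ).1 i)) (hρy : ∀ σ i, σ (y i) = y ((ρ σ).2 i))
    (h : GroupRow ρ.range A B G d)
    (he : Nat.card G = Nat.card B) (he' : Nat.card A = Nat.card B) : Row f g A B G (· = ·) d :=
  h.row hx hy hf hg ρ hρx hρy fun L L' _ _ _ h2 h3 h4 =>
    eq_of_finrank_sup L L' (by rw [h2, h4, he]) (by rw [h3, h4, he'])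

/-- The column on fields carries no further information: in each row the orders of the three groups
imply it. -/
theorem tableS3_of_groupTableS3 [Infinite M] (hx : IsRootOrdering f x) (hy : IsRootOrdering g y)
    (hf : f.Separable) (hg : g.Separable)
    (ρ : (AlgebraicClosure M ≃ₐ[M] AlgebraicClosure M) →* Sn 4 × Sn 4)
    (hρx : ∀ σ i, σ (x i) = x ((ρ σ).1 i)) (hρy : ∀ σ i, σ (y i) = y ((ρ σ).2 i))
    (i : Fin 19) (h : groupTableS3 ρ.range i) : tableS3 f g i := by
  fin_cases i
  · exact GroupRow.row_trivial hx hy hf hg ρ hρx hρy h (Nat.card_prod _ _)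
  · exact GroupRow.row_quadratic hx hy hf hg ρ hρx hρy h
      (by simp only [Nat.card_prod, card_sd, card_Sn3, card_Sn4, card_A4, card_Cn])
  · exact GroupRow.row_le hx hy hf hg ρ hρx hρy h rfl
  · exact GroupRow.row_trivial hx hy hf hg ρ hρx hρy h (Nat.card_prod _ _)
  · exact GroupRow.row_trivial hx hy hf hg ρ hρx hρy h (Nat.card_prod _ _)
  · exact GroupRow.row_quadratic hx hy hf hg ρ hρx hρy h
      (by simp only [card_Sn3, card_Dn])
  · exact GroupRow.row_quadratic hx hy hf hg ρ hρx hρy h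
      (by simp only [Nat.card_prod, card_sd, card_Sn3, card_Cn, card_Dn])
  · exact GroupRow.row_quadratic hx hy hf hg ρ hρx hρy h
      (by simp only [Nat.card_prod, card_sd, card_Sn3, card_Cn, card_Dn])
  · exact GroupRow.row_trivial hx hy hf hg ρ hρx hρy h (Nat.card_prod _ _)
  · exact GroupRow.row_quadratic hx hy hf hg ρ hρx hρy h
      (by simp only [card_sd, card_Sn3, card_Cn])
  · exact GroupRow.row_trivial hx hy hf hg ρ hρx hρy h (Nat.card_prod _ _)
  · exact GroupRow.row_trivial hx hy hf hg ρ hρx hρy h (Nat.card_prod _ _)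
  · exact GroupRow.row_quadratic hx hy hf hg ρ hρx hρy h
      (by simp only [Nat.card_prod, card_Sn3, card_Cn, card_Dn])
  · exact GroupRow.row_quadratic hx hy hf hg ρ hρx hρy h
      (by simp only [Nat.card_prod, card_Sn3, card_Cn, card_Dn])
  · exact GroupRow.row_quadratic hx hy hf hg ρ hρx hρy h
      (by simp only [Nat.card_prod, card_Sn3, card_Cn, card_Dn])
  · exact GroupRow.row_trivial hx hy hf hg ρ hρx hρy h (Nat.card_prod _ _)
  · exact GroupRow.row_quadratic hx hy hf hg ρ hρx hρy h
      (by simp only [Nat.card_prod, card_sd, card_Sn3, card_Cn])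
  · exact GroupRow.row_eq hx hy hf hg ρ hρx hρy h rfl rfl
  · exact GroupRow.row_trivial hx hy hf hg ρ hρx hρy h (Nat.card_prod _ _)

theorem tableC3_of_groupTableC3 [Infinite M] (hx : IsRootOrdering f x) (hy : IsRootOrdering g y)
    (hf : f.Separable) (hg : g.Separable)
    (ρ : (AlgebraicClosure M ≃ₐ[M] AlgebraicClosure M) →* Sn 4 × Sn 4)
    (hρx : ∀ σ i, σ (x i) = x ((ρ σ).1 i)) (hρy : ∀ σ i, σ (y i) = y ((ρ σ).2 i))
    (i : Fin 9) (h : groupTableC3 ρ.range i) : tableC3 f g i := by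
  fin_cases i
  · exact GroupRow.row_trivial hx hy hf hg ρ hρx hρy h (Nat.card_prod _ _)
  · exact GroupRow.row_trivial hx hy hf hg ρ hρx hρy h (Nat.card_prod _ _)
  · exact GroupRow.row_le hx hy hf hg ρ hρx hρy h rfl
  · exact GroupRow.row_trivial hx hy hf hg ρ hρx hρy h (Nat.card_prod _ _)
  · exact GroupRow.row_trivial hx hy hf hg ρ hρx hρy h (by simp only [card_Cn])
  · exact GroupRow.row_trivial hx hy hf hg ρ hρx hρy h (Nat.card_prod _ _)
  · exact GroupRow.row_trivial hx hy hf hg ρ hρx hρy h (Nat.card_prod _ _)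
  · exact GroupRow.row_trivial hx hy hf hg ρ hρx hρy h (Nat.card_prod _ _)
  · exact GroupRow.row_eq hx hy hf hg ρ hρx hρy h rfl rfl

theorem IsRootOrdering.comp_perm (hx : IsRootOrdering f x) (c : Equiv.Perm (Fin 4)) :
    IsRootOrdering f (x ∘ c) := by
  rw [IsRootOrdering, hx]
  exact (Equiv.prod_comp c fun i => X - C (x i)).symm

/-- Conjugating `E` by `w` is renumbering the roots by `w⁻¹`. -/
theorem exists_of_existsConj {P : Subgroup (Sn 4 × Sn 4) → Prop} (hx : IsRootOrdering f x)
    (hy : IsRootOrdering g y) (ρ : (AlgebraicClosure M ≃ₐ[M] AlgebraicClosure M) →* Sn 4 × Sn 4)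
    (hρx : ∀ σ i, σ (x i) = x ((ρ σ).1 i)) (hρy : ∀ σ i, σ (y i) = y ((ρ σ).2 i))
    (h : ExistsConj P ρ.range) : ∃ (x' y' : Fin 4 → AlgebraicClosure M)
      (ρ' : (AlgebraicClosure M ≃ₐ[M] AlgebraicClosure M) →* Sn 4 × Sn 4),
      IsRootOrdering f x' ∧ IsRootOrdering g y' ∧ (∀ σ i, σ (x' i) = x' ((ρ' σ).1 i)) ∧
      (∀ σ i, σ (y' i) = y' ((ρ' σ).2 i)) ∧ P ρ'.range := by
  obtain ⟨w, hw⟩ := h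
  refine ⟨x ∘ ⇑w.1⁻¹, y ∘ ⇑w.2⁻¹, (MulAut.conj w).toMonoidHom.comp ρ, hx.comp_perm _,
    hy.comp_perm _, fun σ i => ?_, fun σ i => ?_, ?_⟩
  · simp [hρx]
  · simp [hρy]
  · rwa [MonoidHom.range_comp]

end Existence

/-! ### Uniqueness of the row -/

/-- The existence clause of `HasDT` supplies one resolvent on which both partitions can be read. -/
theorem HasDT.unique {M : Type*} [Field M] {f g : M[X]} {d d' : Multiset ℕ} (h : HasDT f g d)
    (h' : HasDT f g d') : d = d' := by
  obtain ⟨f', g', R, hf, hg, hR, hsq⟩ := h.1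
  rw [← h.2 f' g' R hf hg hR hsq, h'.2 f' g' R hf hg hR hsq]

theorem isEmpty_C4_mulEquiv_V4 : ¬ Nonempty (Cn 4 ≃* V4) := by
  rintro ⟨e⟩
  have h1 : ∀ v : V4, v ^ 2 = 1 := by decide +kernel
  have h2 : (Multiplicative.ofAdd 1 : Cn 4) ^ 2 ≠ 1 := by decide +kernel
  exact h2 (e.injective (by rw [map_pow, h1, map_one]))

/-- The rotation `r 1` has order 12, while every element order in the other group divides 4 or 6. -/
theorem isEmpty_D12_mulEquiv : ¬ Nonempty (Dn 12 ≃* C3V4sdC2) := by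
  rintro ⟨e⟩
  have h1 : ∀ v : C3V4sdC2, v ^ 4 = 1 ∨ v ^ 6 = 1 := by
    rintro ⟨n, g⟩
    revert n g
    decide +kernel
  have h2 : (DihedralGroup.r 1 : Dn 12) ^ 4 ≠ 1 := by decide +kernel
  have h3 : (DihedralGroup.r 1 : Dn 12) ^ 6 ≠ 1 := by decide +kernel
  rcases h1 (e (DihedralGroup.r 1)) with h | h
  · exact h2 (e.injective (by rw [map_pow, h, map_one]))
  · exact h3 (e.injective (by rw [map_pow, h, map_one]))

/-- The orders of the second Galois group and of the Galois group of the product, and the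
decomposition types, in the rows for `S₃`. -/
def invariantsS3 : Fin 19 → ℕ × ℕ × Multiset ℕ := ![
  (24, 144, {24}),
  (24, 72, {12, 12}),
  (24, 24, {12, 8, 4}),
  (12, 72, {24}),
  (8, 48, {24}),
  (8, 24, {12, 12}),
  (8, 24, {24}),
  (8, 24, {12, 12}),
  (4, 24, {24}),
  (4, 12, {12, 12}),
  (4, 24, {24}),
  (4, 24, {12, 12}),
  (4, 12, {12, 12}),
  (4, 12, {12, 6, 6}),
  (4, 12, {6, 6, 6, 6}),
  (6, 36, {18, 6}),
  (6, 18, {9, 9, 3, 3}),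
  (6, 6, {6, 6, 3, 3, 3, 2, 1}),
  (3, 18, {18, 6})]

/-- The orders of the second Galois group and of the Galois group of the product, and the
decomposition types, in the rows for `C₃`. -/
def invariantsC3 : Fin 9 → ℕ × ℕ × Multiset ℕ := ![
  (24, 72, {24}),
  (12, 36, {12, 12}),
  (12, 12, {12, 4, 4, 4}),
  (8, 24, {24}),
  (4, 12, {12, 12}),
  (4, 12, {12, 12}),
  (6, 18, {18, 6}),
  (3, 9, {9, 9, 3, 3}),
  (3, 3, {3, 3, 3, 3, 3, 3, 3, 1, 1, 1})]

section Uniqueness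

variable {M : Type*} [Field M] {f g : M[X]}

/-- The orders of the Galois groups of `g` and `f * g`, and the decomposition type. -/
def HasInvariants (f g : M[X]) (v : ℕ × ℕ × Multiset ℕ) : Prop :=
  Nat.card g.Gal = v.1 ∧ Nat.card (f * g).Gal = v.2.1 ∧ HasDT f g v.2.2

theorem HasInvariants.unique {v v' : ℕ × ℕ × Multiset ℕ} (h : HasInvariants f g v)
    (h' : HasInvariants f g v') : v = v' :=
  Prod.ext (h.1.symm.trans h'.1)
    (Prod.ext (h.2.1.symm.trans h'.2.1) (h.2.2.unique h'.2.2))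

theorem Row.hasInvariants {A B G : Type} [Group A] [Group B] [Group G]
    {inter : IntermediateField M (AlgebraicClosure M) →
      IntermediateField M (AlgebraicClosure M) → Prop} {d : Multiset ℕ}
    (h : Row f g A B G inter d) : HasInvariants f g (Nat.card B, Nat.card G, d) := by
  obtain ⟨-, ⟨e⟩, ⟨e'⟩, -, hd⟩ := h
  exact ⟨Nat.card_congr e.toEquiv, Nat.card_congr e'.toEquiv, hd⟩

theorem Row.nonempty_snd {A B B' G G' : Type} [Group A] [Group B] [Group G] [Group B'] [Group G']
    {inter inter' : IntermediateField M (AlgebraicClosure M) →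
      IntermediateField M (AlgebraicClosure M) → Prop} {d d' : Multiset ℕ}
    (h : Row f g A B G inter d) (h' : Row f g A B' G' inter' d') :
    Nonempty (B ≃* B') ∧ Nonempty (G ≃* G') := by
  obtain ⟨-, ⟨e⟩, ⟨e'⟩, -⟩ := h
  obtain ⟨-, ⟨u⟩, ⟨u'⟩, -⟩ := h'
  exact ⟨⟨e.symm.trans u⟩, ⟨e'.symm.trans u'⟩⟩

theorem hasInvariants_of_tableS3 (i : Fin 19) (h : tableS3 f g i) :
    HasInvariants f g (invariantsS3 i) := by
  fin_cases i <;>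
  · have := Row.hasInvariants h
    simp only [Nat.card_prod, card_sd, card_Sn3, card_Sn4, card_A4, card_Cn, card_Dn] at this
    exact this

theorem hasInvariants_of_tableC3 (i : Fin 9) (h : tableC3 f g i) :
    HasInvariants f g (invariantsC3 i) := by
  fin_cases i <;>
  · have := Row.hasInvariants h
    simp only [Nat.card_prod, card_Sn3, card_Sn4, card_A4, card_Cn, card_Dn] at this
    exact this

/-- The numerical invariants fail to separate just three pairs of rows. One is split by the joint
Galois group, the other two by the second Galois group. -/
theorem tableS3_unique (i j : Fin 19) (hi : tableS3 f g i) (hj : tableS3 f g j) : i = j := by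
  have h := (hasInvariants_of_tableS3 i hi).unique (hasInvariants_of_tableS3 j hj)
  have hdec : ∀ i j : Fin 19, invariantsS3 i = invariantsS3 j → i = j ∨
      (i = 5 ∧ j = 7) ∨ (i = 7 ∧ j = 5) ∨ (i = 8 ∧ j = 10) ∨ (i = 10 ∧ j = 8) ∨
      (i = 9 ∧ j = 12) ∨ (i = 12 ∧ j = 9) := by decide +kernel
  rcases hdec i j h with h | ⟨rfl, rfl⟩ | ⟨rfl, rfl⟩ | ⟨rfl, rfl⟩ | ⟨rfl, rfl⟩ | ⟨rfl, rfl⟩ |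
    ⟨rfl, rfl⟩
  · exact h
  · exact absurd (Row.nonempty_snd hi hj).2 isEmpty_D12_mulEquiv
  · exact absurd (Row.nonempty_snd hj hi).2 isEmpty_D12_mulEquiv
  · exact absurd (Row.nonempty_snd hi hj).1 isEmpty_C4_mulEquiv_V4
  · exact absurd (Row.nonempty_snd hj hi).1 isEmpty_C4_mulEquiv_V4
  · exact absurd (Row.nonempty_snd hi hj).1 isEmpty_C4_mulEquiv_V4
  · exact absurd (Row.nonempty_snd hj hi).1 isEmpty_C4_mulEquiv_V4

theorem tableC3_unique (i j : Fin 9) (hi : tableC3 f g i) (hj : tableC3 f g j) : i = j := by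
  have h := (hasInvariants_of_tableC3 i hi).unique (hasInvariants_of_tableC3 j hj)
  have hdec : ∀ i j : Fin 9, invariantsC3 i = invariantsC3 j → i = j ∨
      (i = 4 ∧ j = 5) ∨ (i = 5 ∧ j = 4) := by decide +kernel
  rcases hdec i j h with h | ⟨rfl, rfl⟩ | ⟨rfl, rfl⟩
  · exact h
  · exact absurd (Row.nonempty_snd hi hj).1 isEmpty_C4_mulEquiv_V4
  · exact absurd (Row.nonempty_snd hj hi).1 isEmpty_C4_mulEquiv_V4

end Uniqueness

end QuarticIntersection

/-! ### The theorem on the two tables. -/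

theorem theorem6p1 {M : Type*} [Field M] [Infinite M] (hM : ringChar M ≠ 2)
    (a b a' b' : M)
    (hD : QuarticIntersection.quarticDisc a b * QuarticIntersection.quarticDisc a' b' ≠ 0)
    (hG' : 3 ≤ Nat.card (QuarticIntersection.quartic a' b').Gal) :
    (Nonempty ((QuarticIntersection.quartic a b).Gal ≃* QuarticIntersection.Sn 3) →
      ∃! i : Fin 19, QuarticIntersection.tableS3
        (QuarticIntersection.quartic a b) (QuarticIntersection.quartic a' b') i) ∧
    (Nonempty ((QuarticIntersection.quartic a b).Gal ≃* QuarticIntersection.Cn 3) →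
      ∃! i : Fin 9, QuarticIntersection.tableC3
        (QuarticIntersection.quartic a b) (QuarticIntersection.quartic a' b') i) := by
  rw [mul_ne_zero_iff] at hD
  have hf := QuarticIntersection.quartic_separable hD.1
  have hg := QuarticIntersection.quartic_separable hD.2
  obtain ⟨x, hx⟩ := QuarticIntersection.exists_isRootOrdering
    (QuarticIntersection.quartic_monic a b) (QuarticIntersection.quartic_natDegree a b)
  obtain ⟨y, hy⟩ := QuarticIntersection.exists_isRootOrdering
    (QuarticIntersection.quartic_monic a' b') (QuarticIntersection.quartic_natDegree a' b')
  obtain ⟨ρ, hρx, hρy⟩ := QuarticIntersection.exists_permHom_prod hx hy hf hg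
  obtain ⟨⟨e₁⟩, ⟨e₂⟩, -⟩ := QuarticIntersection.nonempty_gal_mulEquiv hx hy hf hg ρ hρx hρy
  rw [Nat.card_congr e₂.toEquiv] at hG'
  constructor
  · rintro ⟨e⟩
    have hG := QuarticIntersection.conjTo_of_card_six
      ((Nat.card_congr (e₁.symm.trans e).toEquiv).trans QuarticIntersection.card_Sn3)
    obtain ⟨x', y', ρ', hx', hy', hρx', hρy', i, hi⟩ := QuarticIntersection.exists_of_existsConj
      hx hy ρ hρx hρy (QuarticIntersection.existsConj_of_isSubdirect hG hG'
        fun E H hE hH => hE.existsConj_S3 hH)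
    have hrow := QuarticIntersection.tableS3_of_groupTableS3 hx' hy' hf hg ρ' hρx' hρy' i hi
    exact ⟨i, hrow, fun j hj => QuarticIntersection.tableS3_unique j i hj hrow⟩
  · rintro ⟨e⟩
    have hG := QuarticIntersection.conjTo_of_card_three
      ((Nat.card_congr (e₁.symm.trans e).toEquiv).trans (QuarticIntersection.card_Cn 3))
    obtain ⟨x', y', ρ', hx', hy', hρx', hρy', i, hi⟩ := QuarticIntersection.exists_of_existsConj
      hx hy ρ hρx hρy (QuarticIntersection.existsConj_of_isSubdirect hG hG'
        fun E H hE hH => hE.existsConj_C3 hH)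
    have hrow := QuarticIntersection.tableC3_of_groupTableC3 hx' hy' hf hg ρ' hρx' hρy' i hi
    exact ⟨i, hrow, fun j hj => QuarticIntersection.tableC3_unique j i hj hrow⟩
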